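/- Let $n\ge 1$, let $S^n$ be the unit sphere with its standard metric and Laplacian $\Delta$, let $q'\ge 1$ be a real constant, and let $f_1,f_2,f_3\in C^\infty((0,\infty);\mathbb{R})$ satisfy $|f_1|+|f_2|+|f_3|=O(1)$ as $\tau\to0^+$. Consider, for $\tau>0$, the model system on $(0,\infty)\times S^n$ $$\partial_\tau^2\alpha+\frac1\tau\partial_\tau\alpha+4q'\alpha-\frac{4}{(\tau^2+1)^2}\Delta\alpha=f_1(\tau)\,\tau\,\partial_\tau\alpha+f_2(\tau)\,\tau^2\alpha+f_3(\tau)\,\chi,\qquad \partial_\tau\chi=2\tau\alpha .$$ For $\chi_0,\mathcal{O},h\in C^\infty(S^n)$, a pair of real functions $(\alpha,\chi)$, with $\alpha$ defined on $(0,\infty)\times S^n$ and $\chi$ on $[0,\infty)\times S^n$, is called a smooth solution with asymptotic initial data $(\chi_0,\mathcal{O},h)$ if $\alpha,\chi\in C^\infty((0,\infty)\times S^n)$ satisfy the system for all $\tau>0$; $\alpha-\mathcal{O}\log\tau-h$ extends to an element of $C^1_\tau([0,\infty))C^\infty(S^n)$ (that is, to a $C^1$ curve $[0,\infty)\to C^\infty(S^n)$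 for the Fréchet topology of $C^\infty(S^n)$); $\chi\in C^1_\tau([0,\infty))C^\infty(S^n)$ and $\chi|_{\tau=0}=\chi_0$; and, as $\tau\to0^+$, in $C^\infty(S^n)$ (that is, in every $C^k$ norm on $S^n$), $$\alpha(\tau)=\mathcal{O}\log\tau+h+O\big(\tau^2|\log\tau|^2\big),\qquad \partial_\tau\alpha(\tau)=\frac{\mathcal{O}}{\tau}+O\big(\tau|\log\tau|^2\big).$$ Theorem. For any $\chi_0,\mathcal{O},h\in C^\infty(S^n)$ there exists a unique smooth solution $(\alpha,\chi)$ of the model system with asymptotic initial data $(\chi_0,\mathcal{O},h)$. -/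

import Mathlib

open Set Filter Topology Asymptotics
open scoped ContDiff Manifold

noncomputable section

namespace ModelSystem

/-- The unit sphere `S^n` in `ℝ^{n+1}`, with Mathlib's manifold structure. -/
abbrev Sph (n : ℕ) : Type :=
  Metric.sphere (0 : EuclideanSpace ℝ (Fin (n + 1))) 1

/-- `f ∈ C^∞(S^n)`. -/
def IsSmooth {n : ℕ} (f : Sph n → ℝ) : Prop :=
  ContMDiff (𝓡 n) 𝓘(ℝ, ℝ) ∞ f

/-- The extension of `f : S^n → ℝ` to a function on `ℝ^{n+1}` that is homogeneous of degree zero,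
`y ↦ f (y / |y|)` for `y ≠ 0`. The value at the origin is irrelevant. -/
def radialExt {n : ℕ} (f : Sph n → ℝ) (y : EuclideanSpace ℝ (Fin (n + 1))) : ℝ :=
  open scoped Classical in
  if hy : y ≠ 0 then f ⟨‖y‖⁻¹ • y, by simp [norm_smul, hy]⟩ else 0

/-- The Laplacian of the standard round metric on `S^n` (nonpositive, `Δ = div grad`):
restriction to `S^n` of the Euclidean Laplacian of the degree zero homogeneous extension. -/
def sphLaplacian {n : ℕ} (f : Sph n → ℝ) (x : Sph n) : ℝ :=
  Laplacian.laplacian (radialExt f) (x : EuclideanSpace ℝ (Fin (n + 1)))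

/-- The seminorms defining the Fréchet topology of `C^∞(S^n)`: the supremum over `S^n` of the
derivative of order `k`, computed on the degree zero homogeneous extension.
It is finite for every smooth `f`, as `S^n` is compact. -/
def seminormC {n : ℕ} (k : ℕ) (f : Sph n → ℝ) : ℝ :=
  ⨆ x : Sph n, ‖iteratedFDeriv ℝ k (radialExt f) (x : EuclideanSpace ℝ (Fin (n + 1)))‖

/-- `u ∈ C^1_τ([0,∞)) C^∞(S^n)`: the restriction of `u` to `[0,∞)` is a curve in the Fréchet space
`C^∞(S^n)` which is differentiable (one-sided at `0`) with continuous derivative `v`. -/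
def IsC1Curve {n : ℕ} (u : ℝ → Sph n → ℝ) : Prop :=
  (∀ τ, 0 ≤ τ → IsSmooth (u τ)) ∧
  ∃ v : ℝ → Sph n → ℝ, (∀ τ, 0 ≤ τ → IsSmooth (v τ)) ∧
    ∀ k : ℕ, ∀ τ₀ : ℝ, 0 ≤ τ₀ →
      Tendsto (fun τ => seminormC k (fun x => (u τ x - u τ₀ x) / (τ - τ₀) - v τ₀ x))
        (𝓝[Ici 0 \ {τ₀}] τ₀) (𝓝 0) ∧
      Tendsto (fun τ => seminormC k (fun x => v τ x - v τ₀ x)) (𝓝[Ici 0] τ₀) (𝓝 0)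

/-- `u ∈ C^∞((0,∞) × S^n)`. -/
def IsSmoothOnPos {n : ℕ} (u : ℝ → Sph n → ℝ) : Prop :=
  ContMDiffOn (𝓘(ℝ, ℝ).prod (𝓡 n)) 𝓘(ℝ, ℝ) ∞
    (fun p : ℝ × Sph n => u p.1 p.2) (Ioi 0 ×ˢ univ)

/-- The time derivative `∂_τ u`. -/
def dτ {n : ℕ} (u : ℝ → Sph n → ℝ) (τ : ℝ) (x : Sph n) : ℝ :=
  deriv (fun s => u s x) τ

/-- `(α, χ)` is a smooth solution of the model system on `(0,∞) × S^n`
with asymptotic initial data `(χ₀, 𝒪, h)` at `τ = 0`.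
Only the values `α τ` for `τ > 0` and `χ τ` for `τ ≥ 0` matter. -/
structure IsSmoothSolution {n : ℕ} (q : ℝ) (f₁ f₂ f₃ : ℝ → ℝ) (χ₀ 𝒪 h : Sph n → ℝ)
    (α χ : ℝ → Sph n → ℝ) : Prop where
  smooth_α : IsSmoothOnPos α
  smooth_χ : IsSmoothOnPos χ
  eq_α : ∀ τ, 0 < τ → ∀ x,
    dτ (dτ α) τ x + 1 / τ * dτ α τ x + 4 * q * α τ x
        - 4 / (τ ^ 2 + 1) ^ 2 * sphLaplacian (α τ) x
      = f₁ τ * τ * dτ α τ x + f₂ τ * τ ^ 2 * α τ x + f₃ τ * χ τ x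
  eq_χ : ∀ τ, 0 < τ → ∀ x, dτ χ τ x = 2 * τ * α τ x
  /-- `α - 𝒪 log τ - h`, defined for `τ > 0`, extends to an element of
  `C^1_τ([0,∞)) C^∞(S^n)`. -/
  regular_α : ∃ u : ℝ → Sph n → ℝ, IsC1Curve u ∧
    ∀ τ, 0 < τ → ∀ x, u τ x = α τ x - 𝒪 x * Real.log τ - h x
  regular_χ : IsC1Curve χ
  initial_χ : χ 0 = χ₀
  expansion_α : ∀ k : ℕ,
    (fun τ => seminormC k (fun x => α τ x - (𝒪 x * Real.log τ + h x)))
      =O[𝓝[>] 0] (fun τ => τ ^ 2 * |Real.log τ| ^ 2)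
  expansion_dα : ∀ k : ℕ,
    (fun τ => seminormC k (fun x => dτ α τ x - 𝒪 x / τ))
      =O[𝓝[>] 0] (fun τ => τ * |Real.log τ| ^ 2)

end ModelSystem

end

open MeasureTheory

noncomputable section

namespace ModelSystem

variable {n : ℕ}

/-! Expand in spherical harmonics. A mode `(a, c)` with eigenvalue `lam` solves a linear ODE with a
singular point at `τ = 0`. In the variables `p = τ a'`, `b = a - p log τ` the singularity
disappears: the vector field is linear in `(p, b, c)` with size `O((1 + lam) τ (1 + |log τ|)²)` near
zero (`BddCoeff.mode_field_le`), so it extends continuously by zero to `τ = 0`. Picard–Lindelöf then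
gives one global solution for each value of `(p, b, c)` at `0`, and these three numbers are the
modes of `𝒪`, `h` and `χ₀`.

The modes must then be summed. The projections of a smooth function on `S^n` decay faster than every
power of the degree, so it suffices that modes grow at most polynomially in `lam`, locally uniformly
in time. Gronwall in `(p, b, c)` alone costs `exp (C lam)`, which is too much. It is therefore used
only up to `τ = 1 / (1 + lam)`, where the exponent stays bounded (`BddCoeff.mode_growth_small`).
From there on the energy `a'² + (1 + 4 lam / (τ² + 1)²) a² + c²` takes over: the large terms cancel
in its derivative, the damping and the decrease of the wave speed have the good sign, and the growth
rate does not see `lam` (`BddCoeff.modeEnergy_deriv_le`). Passing to the energy at the switching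
time costs a power of `1 + lam`, hence `BddCoeff.mode_growth`. The same bounds give the rates of
convergence as `τ → 0`, and the ODE itself propagates polynomial growth to all time derivatives.

A solution is a multiplier series `∑ B_k(τ) Π_k g`, where `Π_k` projects onto degree `k`. Polynomial
growth of `B_k` against rapid decay of `Π_k g` gives joint smoothness, the `C¹` property at `τ = 0`
and the remainders in every seminorm. One series handles data that are constant multiples of a
single `g`; linearity of the system combines three of them.

For uniqueness, the difference of two solutions has zero data. Paired with a harmonic it yields a
mode, and the prescribed expansions are strong enough to make `(p, b, c)` tend to zero at `τ = 0`.
The growth bound makes that mode vanish, and completeness of the harmonics finishes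
(`eq_zero_of_pair_harmonics`).

The harmonic analysis rests on degree zero extensions to the ambient space. Integrating them against
a radial cutoff replaces the surface measure, so symmetry of the Laplacian is Euclidean integration
by parts (`pair_sphLaplacian_eq`). Harmonics of degree `k` are the orthogonal complement of degree
`k - 2` among restricted homogeneous polynomials of degree `k`. Bernstein and Nikolskii type
inequalities bound them and their derivatives with polynomial losses in `k`, Stone–Weierstrass gives
completeness, and powers of `1 - Δ` give rapid decay of the projections. -/

/-- The ambient Euclidean space of `S^n`. -/
abbrev Amb (n : ℕ) : Type := EuclideanSpace ℝ (Fin (n + 1))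

/-! ### Smoothness on the sphere versus smoothness of the degree zero extension -/

theorem radialExt_apply (f : Sph n → ℝ) {y : Amb n} (hy : y ≠ 0) :
    radialExt f y = f ⟨‖y‖⁻¹ • y, by simp [norm_smul, hy]⟩ := by
  simp [radialExt, hy]

theorem coe_sph_ne_zero (x : Sph n) : (x : Amb n) ≠ 0 := by
  have := x.2
  intro h
  simp [h] at this

theorem norm_coe_sph (x : Sph n) : ‖(x : Amb n)‖ = 1 := by
  simp

@[simp] theorem radialExt_coe (f : Sph n → ℝ) (x : Sph n) : radialExt f (x : Amb n) = f x := by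
  rw [radialExt_apply f (coe_sph_ne_zero x)]
  congr 1
  ext1
  simp

theorem radialExt_smul (f : Sph n → ℝ) {c : ℝ} (hc : 0 < c) (y : Amb n) :
    radialExt f (c • y) = radialExt f y := by
  by_cases hy : y = 0
  · simp [hy]
  rw [radialExt_apply f hy, radialExt_apply f (by simp [hy, hc.ne'])]
  congr 2
  rw [norm_smul, Real.norm_of_nonneg hc.le, smul_smul, mul_inv, mul_right_comm,
    inv_mul_cancel₀ hc.ne', one_mul]

instance instFactFinrankAmb : Fact (Module.finrank ℝ (Amb n) = n + 1) := ⟨by simp⟩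

/-- The complement of the origin. -/
def punctured (n : ℕ) : TopologicalSpace.Opens (Amb n) := ⟨{0}ᶜ, isOpen_compl_singleton⟩

/-- The normalization `y ↦ y / |y|`. -/
def normalize (y : Amb n) : Amb n := ‖y‖⁻¹ • y

theorem contDiffOn_normalize : ContDiffOn ℝ ∞ (normalize (n := n)) {0}ᶜ := by
  intro y hy
  exact ((((contDiffAt_id (x := y)).norm ℝ hy).inv (by simpa using hy)).smul
    contDiffAt_id).contDiffWithinAt

theorem norm_normalize {y : Amb n} (hy : y ≠ 0) : ‖normalize y‖ = 1 := by
  simp [normalize, norm_smul, hy]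

/-- The radial projection to the sphere, with an arbitrary value at the origin. -/
def toSph (y : Amb n) : Sph n :=
  open scoped Classical in
  if hy : y ≠ 0 then ⟨normalize y, by simpa using norm_normalize hy⟩
  else ⟨EuclideanSpace.single 0 1, by simp⟩

theorem coe_toSph {y : Amb n} (hy : y ≠ 0) : (toSph y : Amb n) = normalize y := by
  simp [toSph, hy]

theorem radialExt_eq (f : Sph n → ℝ) {y : Amb n} (hy : y ≠ 0) : radialExt f y = f (toSph y) := by
  rw [radialExt_apply f hy]
  congr 1
  ext1
  simp [coe_toSph hy, normalize]

theorem contMDiffAt_toSph {y : Amb n} (hy : y ≠ 0) :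
    ContMDiffAt 𝓘(ℝ, Amb n) (𝓡 n) ∞ (toSph (n := n)) y := by
  have h : ContMDiff 𝓘(ℝ, Amb n) (𝓡 n) ∞
      (fun y : punctured n => (⟨normalize y, by simpa using norm_normalize y.2⟩ : Sph n)) := by
    apply ContMDiff.codRestrict_sphere
    intro y
    have h : ContMDiffAt 𝓘(ℝ, Amb n) 𝓘(ℝ, Amb n) ∞ (normalize (n := n)) (y : Amb n) := by
      rw [contMDiffAt_iff_contDiffAt]
      exact contDiffOn_normalize.contDiffAt (isOpen_compl_singleton.mem_nhds y.2)
    exact contMDiffAt_subtype_iff.mpr h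
  have h2 : (fun y : punctured n => toSph (y : Amb n)) =
      fun y : punctured n => (⟨normalize y, by simpa using norm_normalize y.2⟩ : Sph n) := by
    ext1 y
    ext1
    exact coe_toSph y.2
  rw [← h2] at h
  exact contMDiffAt_subtype_iff.mp (h ⟨y, hy⟩)

theorem IsSmooth.contDiffOn_radialExt {f : Sph n → ℝ} (hf : IsSmooth f) :
    ContDiffOn ℝ ∞ (radialExt f) {0}ᶜ := by
  intro y hy
  apply ContDiffAt.contDiffWithinAt
  rw [← contMDiffAt_iff_contDiffAt]
  refine (ContMDiffAt.comp y (hf (toSph y)) (contMDiffAt_toSph hy)).congr_of_eventuallyEq ?_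
  filter_upwards [isOpen_compl_singleton.mem_nhds hy] with z hz using radialExt_eq f hz

theorem IsSmoothOnPos.contDiffOn_radialExt {u : ℝ → Sph n → ℝ} (hu : IsSmoothOnPos u) :
    ContDiffOn ℝ ∞ (fun p : ℝ × Amb n => radialExt (u p.1) p.2) (Ioi 0 ×ˢ {0}ᶜ) := by
  rintro ⟨τ, y⟩ ⟨hτ, hy⟩
  apply ContDiffAt.contDiffWithinAt
  rw [← contMDiffAt_iff_contDiffAt]
  have hU : IsOpen (Ioi (0:ℝ) ×ˢ (univ : Set (Sph n))) := isOpen_Ioi.prod isOpen_univ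
  have h1 := hu.contMDiffAt (x := (τ, toSph y)) (hU.mem_nhds ⟨hτ, mem_univ _⟩)
  have h2 : ContMDiffAt 𝓘(ℝ, ℝ × Amb n) (𝓘(ℝ, ℝ).prod (𝓡 n)) ∞
      (fun p : ℝ × Amb n => (p.1, toSph p.2)) (τ, y) := by
    refine ContMDiffAt.prodMk contDiffAt_fst.contMDiffAt ?_
    exact ContMDiffAt.comp (g := toSph) (τ, y) (contMDiffAt_toSph hy) contDiffAt_snd.contMDiffAt
  refine (ContMDiffAt.comp (τ, y) h1 h2).congr_of_eventuallyEq ?_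
  have : ∀ᶠ p : ℝ × Amb n in 𝓝 (τ, y), p.2 ≠ 0 := continuousAt_snd.eventually_ne hy
  filter_upwards [this] with z hz using radialExt_eq _ hz

theorem isSmooth_of_contDiffOn {F : Amb n → ℝ} {U : Set (Amb n)} (hU : IsOpen U)
    (hSU : ∀ x : Sph n, (x : Amb n) ∈ U) (hF : ContDiffOn ℝ ∞ F U) :
    IsSmooth (fun x : Sph n => F x) := by
  intro x
  have h : ContMDiffAt 𝓘(ℝ, Amb n) 𝓘(ℝ, ℝ) ∞ F (x : Amb n) :=
    (hF.contDiffAt (hU.mem_nhds (hSU x))).contMDiffAt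
  exact ContMDiffAt.comp (g := F) (f := fun x : Sph n => (x : Amb n)) x h
    (contMDiff_coe_sphere x)

theorem isSmoothOnPos_of_contDiffOn {F : ℝ × Amb n → ℝ} {U : Set (Amb n)} (hU : IsOpen U)
    (hSU : ∀ x : Sph n, (x : Amb n) ∈ U) (hF : ContDiffOn ℝ ∞ F (Ioi 0 ×ˢ U)) :
    IsSmoothOnPos (fun τ (x : Sph n) => F (τ, x)) := by
  rintro ⟨τ, x⟩ ⟨hτ, -⟩
  apply ContMDiffAt.contMDiffWithinAt
  have h : ContMDiffAt 𝓘(ℝ, ℝ × Amb n) 𝓘(ℝ, ℝ) ∞ F (τ, (x : Amb n)) :=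
    (hF.contDiffAt ((isOpen_Ioi.prod hU).mem_nhds ⟨hτ, hSU x⟩)).contMDiffAt
  have h2 : ContMDiff (𝓘(ℝ, ℝ).prod (𝓡 n)) 𝓘(ℝ, ℝ × Amb n) ∞
      (fun p : ℝ × Sph n => (p.1, (p.2 : Amb n))) :=
    contMDiff_fst.prodMk_space (contMDiff_coe_sphere.comp contMDiff_snd)
  exact ContMDiffAt.comp (g := F) (τ, x) h (h2 (τ, x))

/-! ### The spherical Laplacian in ambient coordinates -/

/-- The standard basis vectors of the ambient space. -/
def bvec (i : Fin (n + 1)) : Amb n := EuclideanSpace.single i 1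

theorem isOpen_punct : IsOpen ({0}ᶜ : Set (Amb n)) := isOpen_compl_singleton

theorem laplacian_eq_sum (F : Amb n → ℝ) {y : Amb n} (hF : ContDiffAt ℝ 2 F y) :
    Laplacian.laplacian F y = ∑ i, fderiv ℝ (fun z => fderiv ℝ F z (bvec i)) y (bvec i) := by
  rw [InnerProductSpace.laplacian_eq_iteratedFDeriv_orthonormalBasis F
    (EuclideanSpace.basisFun (Fin (n + 1)) ℝ)]
  refine Finset.sum_congr rfl fun i _ => ?_
  have hd : DifferentiableAt ℝ (fderiv ℝ F) y :=
    (hF.fderiv_right (m := 1) (by norm_num)).differentiableAt (by norm_num)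
  rw [iteratedFDeriv_two_apply, fderiv_clm_apply hd (differentiableAt_const _)]
  simp [bvec]

theorem contDiffOn_fderiv_apply {F : Amb n → ℝ} (hF : ContDiffOn ℝ ∞ F {0}ᶜ) (v : Amb n) :
    ContDiffOn ℝ ∞ (fun y => fderiv ℝ F y v) {0}ᶜ :=
  (hF.fderiv_of_isOpen isOpen_punct (m := ∞) (by simp)).clm_apply contDiffOn_const

theorem ContDiffOn.contDiffAt_two {F : Amb n → ℝ} (hF : ContDiffOn ℝ ∞ F {0}ᶜ) {y : Amb n}
    (hy : y ≠ 0) : ContDiffAt ℝ 2 F y :=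
  (hF.contDiffAt (isOpen_punct.mem_nhds hy)).of_le (WithTop.coe_le_coe.mpr (le_top (a := (2 : ℕ∞))))

theorem contDiffOn_laplacian {F : Amb n → ℝ} (hF : ContDiffOn ℝ ∞ F {0}ᶜ) :
    ContDiffOn ℝ ∞ (Laplacian.laplacian F) {0}ᶜ := by
  have h : ContDiffOn ℝ ∞
      (fun y => ∑ i, fderiv ℝ (fun z => fderiv ℝ F z (bvec i)) y (bvec i)) {0}ᶜ :=
    ContDiffOn.sum fun i _ => contDiffOn_fderiv_apply (contDiffOn_fderiv_apply hF _) _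
  exact h.congr fun y hy => laplacian_eq_sum F (ContDiffOn.contDiffAt_two hF hy)

theorem IsSmooth.sphLaplacian {f : Sph n → ℝ} (hf : IsSmooth f) : IsSmooth (sphLaplacian f) :=
  isSmooth_of_contDiffOn isOpen_punct coe_sph_ne_zero (contDiffOn_laplacian hf.contDiffOn_radialExt)

/-- Second derivatives of a function homogeneous of degree zero are homogeneous of degree `-2`; the
factor `‖y‖ ^ 2` restores degree zero, so the Laplacian on the sphere is known on the whole
punctured space. -/
theorem radialExt_sphLaplacian {f : Sph n → ℝ} (hf : IsSmooth f) {y : Amb n} (hy : y ≠ 0) :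
    radialExt (sphLaplacian f) y = ‖y‖ ^ 2 * Laplacian.laplacian (radialExt f) y := by
  have hny : 0 < ‖y‖ := norm_pos_iff.mpr hy
  rw [radialExt_apply _ hy, sphLaplacian]
  have hF := hf.contDiffOn_radialExt
  have hc : ∀ c : ℝ, 0 < c → ∀ z : Amb n, ∀ v,
      fderiv ℝ (radialExt f) z v = c * fderiv ℝ (radialExt f) (c • z) v := by
    intro c hc z v
    have h1 : (fun w : Amb n => radialExt f (c • w)) = radialExt f :=
      funext fun w => radialExt_smul f hc w
    conv_lhs => rw [← h1, fderiv_comp_smul]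
    rfl
  have hc2 : ∀ c : ℝ, 0 < c → ∀ v : Amb n,
      fderiv ℝ (fun z => fderiv ℝ (radialExt f) z v) y v =
        c ^ 2 * fderiv ℝ (fun z => fderiv ℝ (radialExt f) z v) (c • y) v := by
    intro c hc' v
    have h1 : (fun z => fderiv ℝ (radialExt f) z v) =
        fun z => c * (fun w => fderiv ℝ (radialExt f) w v) (c • z) := funext fun z => hc c hc' z v
    have hd : DifferentiableAt ℝ (fun z => (fun w => fderiv ℝ (radialExt f) w v) (c • z)) y := by
      have h3 := ((contDiffOn_fderiv_apply hF v).contDiffAt (x := c • y)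
        (isOpen_punct.mem_nhds (by simp [hy, hc'.ne']))).differentiableAt (by simp)
      exact DifferentiableAt.comp y h3 (differentiableAt_id.const_smul c)
    conv_lhs => rw [h1, fderiv_const_mul hd,
      fderiv_comp_smul (f := fun w => fderiv ℝ (radialExt f) w v)]
    simp only [_root_.smul_apply, smul_eq_mul]
    ring
  have hy' : ‖y‖⁻¹ • y ≠ 0 := by simp [hy]
  rw [laplacian_eq_sum _ (ContDiffOn.contDiffAt_two hF hy),
    laplacian_eq_sum _ (ContDiffOn.contDiffAt_two hF hy'), Finset.mul_sum]
  refine Finset.sum_congr rfl fun i _ => ?_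
  rw [hc2 ‖y‖⁻¹ (by positivity) (bvec i)]
  field_simp

/-- The extension is constant along rays. This is what removes the derivative of the radial cutoff
in the integration by parts below. -/
theorem fderiv_radialExt_self {f : Sph n → ℝ} (hf : IsSmooth f) {y : Amb n} (hy : y ≠ 0) :
    fderiv ℝ (radialExt f) y y = 0 := by
  have hd : DifferentiableAt ℝ (radialExt f) y :=
    (hf.contDiffOn_radialExt.contDiffAt (isOpen_punct.mem_nhds hy)).differentiableAt (by simp)
  have h1 : HasDerivAt (fun t : ℝ => radialExt f (t • y)) (fderiv ℝ (radialExt f) y y) 1 := by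
    have h2 : HasDerivAt (fun t : ℝ => t • y) ((1:ℝ) • y) 1 := (hasDerivAt_id 1).smul_const y
    have h3 : HasFDerivAt (radialExt f) (fderiv ℝ (radialExt f) y) ((1:ℝ) • y) := by
      simpa using hd.hasFDerivAt
    have h4 := h3.comp_hasDerivAt (1:ℝ) h2
    rwa [one_smul] at h4
  have h4 : HasDerivAt (fun t : ℝ => radialExt f (t • y)) 0 1 := by
    refine (hasDerivAt_const (1:ℝ) (radialExt f y)).congr_of_eventuallyEq ?_
    filter_upwards [lt_mem_nhds (zero_lt_one' ℝ)] with t ht using radialExt_smul f ht y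
  exact h1.unique h4

/-! ### The weighted pairing and symmetry of the Laplacian -/

/-- A bump function around `1`, used as a radial weight. -/
def radialBump : ContDiffBump (1 : ℝ) := ⟨1 / 4, 1 / 2, by norm_num, by norm_num⟩

/-- A smooth radial weight supported in an annulus around the unit sphere. -/
def wt (y : Amb n) : ℝ := radialBump (‖y‖ ^ 2)

/-- A compact annulus containing the support of the weight. -/
def annulus (n : ℕ) : Set (Amb n) := {y | 1 / 2 ≤ ‖y‖ ^ 2 ∧ ‖y‖ ^ 2 ≤ 3 / 2}

theorem isClosed_annulus : IsClosed (annulus n) :=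
  (isClosed_le continuous_const (continuous_norm.pow 2)).inter
    (isClosed_le (continuous_norm.pow 2) continuous_const)

theorem isCompact_annulus : IsCompact (annulus n) := by
  refine Metric.isCompact_of_isClosed_isBounded isClosed_annulus ?_
  refine (Metric.isBounded_closedBall (x := (0 : Amb n)) (r := 2)).subset fun y hy => ?_
  have := hy.2
  simp only [Metric.mem_closedBall, dist_zero_right]
  nlinarith [norm_nonneg y]

theorem annulus_subset : annulus n ⊆ {0}ᶜ := by
  intro y hy h
  have h1 := hy.1
  simp only [mem_singleton_iff] at h
  norm_num [h] at h1

theorem wt_nonneg (y : Amb n) : 0 ≤ wt y := radialBump.nonneg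

theorem wt_eq_zero {y : Amb n} (hy : y ∉ annulus n) : wt y = 0 := by
  apply radialBump.zero_of_le_dist
  by_contra! h
  apply hy
  rw [Real.dist_eq, abs_lt] at h
  have e : radialBump.rOut = 1 / 2 := rfl
  rw [e] at h
  exact ⟨by linarith [h.1], by linarith [h.2]⟩

theorem wt_eq_one {y : Amb n} (hy : |‖y‖ ^ 2 - 1| ≤ 1 / 4) : wt y = 1 := by
  apply radialBump.one_of_mem_closedBall
  rw [Metric.mem_closedBall, Real.dist_eq]
  exact hy

theorem contDiff_wt : ContDiff ℝ ∞ (wt (n := n)) :=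
  radialBump.contDiff.comp (contDiff_norm_sq ℝ)

theorem fderiv_wt_apply (y v : Amb n) :
    fderiv ℝ (wt (n := n)) y v = deriv radialBump (‖y‖ ^ 2) * (2 * inner ℝ y v) := by
  have h1 : HasFDerivAt (fun y : Amb n => ‖y‖ ^ 2) (2 • (innerSL ℝ y)) y :=
    (hasStrictFDerivAt_norm_sq y).hasFDerivAt
  have h2 : HasDerivAt radialBump (deriv radialBump (‖y‖ ^ 2)) (‖y‖ ^ 2) :=
    (radialBump.contDiff (n := 1)).differentiable (by norm_num) _ |>.hasDerivAt
  have := (h2.comp_hasFDerivAt y h1).fderiv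
  have e : wt (n := n) = radialBump ∘ fun y : Amb n => ‖y‖ ^ 2 := rfl
  rw [e, this]
  simp

theorem integrable_of_annulus {H : Amb n → ℝ} (hH : ContinuousOn H {0}ᶜ)
    (h0 : ∀ y ∉ annulus n, H y = 0) : Integrable H := by
  rw [← integrableOn_iff_integrable_of_support_subset (s := annulus n)]
  · exact (hH.mono annulus_subset).integrableOn_compact isCompact_annulus
  · intro y hy
    by_contra h
    exact hy (h0 y h)

/-- The weighted `L²` pairing of functions on the sphere. -/
def pair (f g : Sph n → ℝ) : ℝ := ∫ y : Amb n, wt y * (radialExt f y * radialExt g y)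

theorem pair_comm (f g : Sph n → ℝ) : pair f g = pair g f := by
  simp only [pair, mul_comm (radialExt f _)]

theorem fderiv_eq_zero_of_annulus {H : Amb n → ℝ} (h0 : ∀ y ∉ annulus n, H y = 0) {y : Amb n}
    (hy : y ∉ annulus n) : fderiv ℝ H y = 0 := by
  have : H =ᶠ[𝓝 y] fun _ => 0 := by
    filter_upwards [isClosed_annulus.isOpen_compl.mem_nhds hy] with z hz using h0 z hz
  rw [this.fderiv_eq]
  simp

/-- Integrate by parts in each coordinate. The full weight `wt y * ‖y‖ ^ 2` has a radial gradient,
and `radialExt f` has no radial derivative, so only the product of gradients survives, which is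
symmetric in `f` and `g`. -/
theorem pair_sphLaplacian_eq {f g : Sph n → ℝ} (hf : IsSmooth f) (hg : IsSmooth g) :
    pair (sphLaplacian f) g = - ∫ y : Amb n, (wt y * ‖y‖ ^ 2) *
      ∑ i, fderiv ℝ (radialExt f) y (bvec i) * fderiv ℝ (radialExt g) y (bvec i) := by
  have hF := hf.contDiffOn_radialExt
  have hG := hg.contDiffOn_radialExt
  set F := radialExt f
  set G := radialExt g
  -- The factor `‖y‖ ^ 2` comes from `radialExt_sphLaplacian`. The support of `η` avoids the origin,
  -- so products with `η` are regular everywhere although `F` and `G` are not.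
  set η : Amb n → ℝ := fun y => wt y * ‖y‖ ^ 2 with hη
  have hηs : ContDiff ℝ ∞ η := contDiff_wt.mul (contDiff_norm_sq ℝ)
  have hη0 : ∀ y ∉ annulus n, η y = 0 := fun y hy => by simp [hη, wt_eq_zero hy]
  have hηG : ContDiffOn ℝ ∞ (fun y => η y * G y) {0}ᶜ := hηs.contDiffOn.mul hG
  have hηG0 : ∀ y ∉ annulus n, η y * G y = 0 := fun y hy => by simp [hη0 y hy]
  have hts : ∀ y ∈ tsupport (fun y => η y * G y), y ≠ 0 := by
    intro y hy
    have : tsupport (fun y => η y * G y) ⊆ annulus n := by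
      apply closure_minimal _ isClosed_annulus
      intro z hz
      by_contra h
      exact hz (hηG0 z h)
    exact annulus_subset (this hy)
  have hdF : ∀ v, ContDiffOn ℝ ∞ (fun y => fderiv ℝ F y v) {0}ᶜ := contDiffOn_fderiv_apply hF
  have hddF : ∀ v w, ContDiffOn ℝ ∞ (fun y => fderiv ℝ (fun z => fderiv ℝ F z v) y w) {0}ᶜ :=
    fun v w => contDiffOn_fderiv_apply (hdF v) w
  have hdηG : ∀ v, ContDiffOn ℝ ∞ (fun y => fderiv ℝ (fun z => η z * G z) y v) {0}ᶜ :=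
    contDiffOn_fderiv_apply hηG
  have hηGd : Differentiable ℝ (fun y => η y * G y) := by
    intro y
    by_cases hy : y = 0
    · have : (fun y => η y * G y) =ᶠ[𝓝 y] fun _ => 0 := by
        have : y ∉ annulus n := fun h => annulus_subset h hy
        filter_upwards [isClosed_annulus.isOpen_compl.mem_nhds this] with z hz using hηG0 z hz
      exact (differentiableAt_const _).congr_of_eventuallyEq this
    · exact (hηG.contDiffAt (isOpen_punct.mem_nhds hy)).differentiableAt (by simp)
  have hibp : ∀ i : Fin (n + 1),
      ∫ y, η y * G y * fderiv ℝ (fun z => fderiv ℝ F z (bvec i)) y (bvec i) =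
      - ∫ y, fderiv ℝ (fun z => η z * G z) y (bvec i) * fderiv ℝ F y (bvec i) := by
    intro i
    apply integral_mul_fderiv_eq_neg_fderiv_mul_of_integrable
    · refine integrable_of_annulus ((hdηG _).mul (hdF _)).continuousOn fun y hy => ?_
      simp [fderiv_eq_zero_of_annulus hηG0 hy]
    · refine integrable_of_annulus (hηG.mul (hddF _ _)).continuousOn fun y hy => ?_
      simp [hη0 y hy]
    · refine integrable_of_annulus (hηG.mul (hdF _)).continuousOn fun y hy => ?_
      simp [hη0 y hy]
    · exact fun y _ => hηGd y
    · intro y hy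
      exact ((hdF _).contDiffAt (isOpen_punct.mem_nhds (hts y hy))).differentiableAt (by simp)
  calc pair (sphLaplacian f) g
      = ∫ y, ∑ i, η y * G y * fderiv ℝ (fun z => fderiv ℝ F z (bvec i)) y (bvec i) := by
        refine integral_congr_ae (Eventually.of_forall fun y => ?_)
        by_cases hy : y = 0
        · have : y ∉ annulus n := fun h => annulus_subset h hy
          simp [hη0 y this, wt_eq_zero this]
        · simp only [← Finset.mul_sum]
          rw [radialExt_sphLaplacian hf hy, laplacian_eq_sum _ (ContDiffOn.contDiffAt_two hF hy)]
          simp only [hη]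
          ring
    _ = ∑ i, ∫ y, η y * G y * fderiv ℝ (fun z => fderiv ℝ F z (bvec i)) y (bvec i) := by
        refine integral_finsetSum _ fun i _ => ?_
        refine integrable_of_annulus (hηG.mul (hddF _ _)).continuousOn fun y hy => ?_
        simp [hη0 y hy]
    _ = - ∑ i, ∫ y, fderiv ℝ (fun z => η z * G z) y (bvec i) * fderiv ℝ F y (bvec i) := by
        rw [← Finset.sum_neg_distrib]
        exact Finset.sum_congr rfl fun i _ => hibp i
    _ = - ∫ y, ∑ i, fderiv ℝ (fun z => η z * G z) y (bvec i) * fderiv ℝ F y (bvec i) := by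
        congr 1
        refine (integral_finsetSum _ fun i _ => ?_).symm
        refine integrable_of_annulus ((hdηG _).mul (hdF _)).continuousOn fun y hy => ?_
        simp [fderiv_eq_zero_of_annulus hηG0 hy]
    _ = _ := by
        congr 1
        refine integral_congr_ae (Eventually.of_forall fun y => ?_)
        by_cases hy : y = 0
        · have : y ∉ annulus n := fun h => annulus_subset h hy
          simp [fderiv_eq_zero_of_annulus hηG0 this, wt_eq_zero this]
        have hdη : DifferentiableAt ℝ η y := hηs.differentiable (by simp) y
        have hdG : DifferentiableAt ℝ G y :=
          (hG.contDiffAt (isOpen_punct.mem_nhds hy)).differentiableAt (by simp)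
        have hdw : DifferentiableAt ℝ (wt (n := n)) y := contDiff_wt.differentiable (by simp) y
        have hrad : ∃ c : ℝ, ∀ v, fderiv ℝ η y v = c * inner ℝ y v := by
          refine ⟨wt y * 2 + ‖y‖ ^ 2 * (deriv radialBump (‖y‖ ^ 2) * 2), fun v => ?_⟩
          have h1 : HasFDerivAt (fun y : Amb n => ‖y‖ ^ 2) (2 • (innerSL ℝ y)) y :=
            (hasStrictFDerivAt_norm_sq y).hasFDerivAt
          have := (hdw.hasFDerivAt.mul h1).fderiv
          have e : η = wt * fun y : Amb n => ‖y‖ ^ 2 := rfl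
          rw [e, this]
          simp only [_root_.add_apply, _root_.smul_apply, smul_eq_mul,
            fderiv_wt_apply, innerSL_apply_apply, nsmul_eq_mul]
          push_cast
          ring
        obtain ⟨c, hc⟩ := hrad
        -- The contribution of the gradient of `η` is `G y * c` times this radial derivative of `F`.
        have hy0 : ∑ i, inner ℝ y (bvec i) * fderiv ℝ F y (bvec i) = 0 := by
          rw [← fderiv_radialExt_self hf hy]
          have h2 := congrArg (fderiv ℝ F y) ((EuclideanSpace.basisFun (Fin (n + 1)) ℝ).sum_repr y)
          rw [← h2, map_sum]
          simp [bvec, EuclideanSpace.inner_single_right]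
        simp only
        rw [Finset.mul_sum]
        have : ∀ i, fderiv ℝ (fun z => η z * G z) y (bvec i) * fderiv ℝ F y (bvec i) =
            wt y * ‖y‖ ^ 2 * (fderiv ℝ F y (bvec i) * fderiv ℝ G y (bvec i)) +
              G y * c * (inner ℝ y (bvec i) * fderiv ℝ F y (bvec i)) := by
          intro i
          rw [fderiv_fun_mul hdη hdG]
          simp only [_root_.add_apply, _root_.smul_apply, smul_eq_mul, hc]
          simp only [hη]
          ring
        simp only [this, Finset.sum_add_distrib, ← Finset.mul_sum, hy0]
        ring

/-- The spherical Laplacian is symmetric. -/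
theorem pair_sphLaplacian_comm {f g : Sph n → ℝ} (hf : IsSmooth f) (hg : IsSmooth g) :
    pair (sphLaplacian f) g = pair f (sphLaplacian g) := by
  rw [pair_comm f, pair_sphLaplacian_eq hf hg, pair_sphLaplacian_eq hg hf]
  simp only [mul_comm (fderiv ℝ (radialExt f) _ _)]

/-! ### Homogeneous polynomials and their Laplacians -/

/-- Multiplication by the `i`-th coordinate function. -/
def coordMul (i : Fin (n + 1)) : (Amb n → ℝ) →ₗ[ℝ] (Amb n → ℝ) :=
  LinearMap.mulLeft ℝ (fun y : Amb n => y i)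

/-- Homogeneous polynomial functions of degree `k` on the ambient space. -/
def HP (n : ℕ) : ℕ → Submodule ℝ (Amb n → ℝ)
  | 0 => Submodule.span ℝ {fun _ => 1}
  | k + 1 => ⨆ i, (HP n k).map (coordMul i)

theorem coordMul_mem (i : Fin (n + 1)) {k : ℕ} {p : Amb n → ℝ} (hp : p ∈ HP n k) :
    (fun y => y i * p y) ∈ HP n (k + 1) :=
  Submodule.mem_iSup_of_mem i (Submodule.mem_map_of_mem (f := coordMul i) hp)

theorem HP_induction {P : ℕ → (Amb n → ℝ) → Prop} (h1 : P 0 fun _ => 1)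
    (h0 : ∀ k, P k 0) (hadd : ∀ k p q, p ∈ HP n k → q ∈ HP n k → P k p → P k q → P k (p + q))
    (hsmul : ∀ k (c : ℝ) p, p ∈ HP n k → P k p → P k (c • p))
    (hmul : ∀ k i p, p ∈ HP n k → P k p → P (k + 1) (fun y => y i * p y)) :
    ∀ k, ∀ p ∈ HP n k, P k p := by
  intro k
  induction k with
  | zero =>
    intro p hp
    obtain ⟨c, rfl⟩ := Submodule.mem_span_singleton.mp hp
    exact hsmul 0 c _ (Submodule.mem_span_singleton_self _) h1
  | succ k ih =>
    intro p hp
    -- Membership is carried along with `P`, because the additive step is allowed to use it.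
    have : p ∈ HP n (k + 1) ∧ P (k + 1) p := by
      refine Submodule.iSup_induction (fun i => (HP n k).map (coordMul i))
        (motive := fun p => p ∈ HP n (k + 1) ∧ P (k + 1) p) hp ?_ ⟨zero_mem _, h0 _⟩ ?_
      · rintro i _ ⟨q, hq, rfl⟩
        exact ⟨coordMul_mem i hq, hmul k i q hq (ih q hq)⟩
      · rintro p q ⟨hp, hp'⟩ ⟨hq, hq'⟩
        exact ⟨add_mem hp hq, hadd _ _ _ hp hq hp' hq'⟩
    exact this.2

theorem contDiff_coord (i : Fin (n + 1)) : ContDiff ℝ ∞ (fun y : Amb n => y i) :=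
  (EuclideanSpace.proj (𝕜 := ℝ) i).contDiff

theorem contDiff_of_mem_HP {k : ℕ} {p : Amb n → ℝ} (hp : p ∈ HP n k) : ContDiff ℝ ∞ p := by
  refine HP_induction (P := fun _ p => ContDiff ℝ ∞ p) contDiff_const (fun _ => contDiff_const)
    (fun _ _ _ _ _ hp hq => hp.add hq) (fun _ c _ _ hp => contDiff_const.smul hp)
    (fun _ i _ _ hp => (contDiff_coord i).mul hp) k p hp

theorem homogeneous_of_mem_HP {k : ℕ} {p : Amb n → ℝ} (hp : p ∈ HP n k) (c : ℝ) (y : Amb n) :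
    p (c • y) = c ^ k * p y := by
  revert c y
  refine HP_induction (P := fun k p => ∀ c : ℝ, ∀ y, p (c • y) = c ^ k * p y) ?_ ?_ ?_ ?_ ?_ k p hp
  · simp
  · simp
  · intro k p q _ _ hp hq c y
    simp [hp, hq]; ring
  · intro k a p _ hp c y
    simp [hp]; ring
  · intro k i p _ hp c y
    simp [hp]; ring

theorem fderiv_coord_mul (i : Fin (n + 1)) {p : Amb n → ℝ} (hp : ContDiff ℝ ∞ p) (y v : Amb n) :
    fderiv ℝ (fun y => y i * p y) y v = v i * p y + y i * fderiv ℝ p y v := by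
  have h1 : fderiv ℝ (fun y : Amb n => y i) y = EuclideanSpace.proj (𝕜 := ℝ) i :=
    (EuclideanSpace.proj (𝕜 := ℝ) i).fderiv
  rw [fderiv_fun_mul ((contDiff_coord i).differentiable (by simp) y)
    (hp.differentiable (by simp) y), h1]
  simp
  ring

/-- For `k = 0` truncated subtraction makes `k - 1 = 0`, and the first clause alone is too weak: the
product rule needs `y i * fderiv ℝ p y v` in `HP n k`, which for `k = 0` holds only because the
derivative vanishes. Hence the second clause. -/
theorem fderiv_mem_HP_aux {k : ℕ} {p : Amb n → ℝ} (hp : p ∈ HP n k) (v : Amb n) :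
    (fun y => fderiv ℝ p y v) ∈ HP n (k - 1) ∧ (k = 0 → (fun y => fderiv ℝ p y v) = 0) := by
  refine HP_induction (P := fun k p => (fun y => fderiv ℝ p y v) ∈ HP n (k - 1) ∧
    (k = 0 → (fun y => fderiv ℝ p y v) = 0)) ?_ ?_ ?_ ?_ ?_ k p hp
  · have : (fun y : Amb n => fderiv ℝ (fun _ => (1:ℝ)) y v) = 0 := by ext; simp
    exact ⟨by rw [this]; exact zero_mem _, fun _ => this⟩
  · intro k
    have : (fun y : Amb n => fderiv ℝ (0 : Amb n → ℝ) y v) = 0 := by ext; simp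
    exact ⟨by rw [this]; exact zero_mem _, fun _ => this⟩
  · intro k p q hp' hq' hp hq
    have : (fun y : Amb n => fderiv ℝ (p + q) y v) =
        (fun y => fderiv ℝ p y v) + fun y => fderiv ℝ q y v := by
      ext y
      rw [fderiv_add ((contDiff_of_mem_HP hp').differentiable (by simp) y)
        ((contDiff_of_mem_HP hq').differentiable (by simp) y)]
      rfl
    rw [this]
    exact ⟨add_mem hp.1 hq.1, fun h => by rw [hp.2 h, hq.2 h, add_zero]⟩
  · intro k c p hp' hp
    have : (fun y : Amb n => fderiv ℝ (c • p) y v) = c • (fun y => fderiv ℝ p y v) := by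
      ext y
      rw [fderiv_const_smul ((contDiff_of_mem_HP hp').differentiable (by simp) y)]
      rfl
    rw [this]
    exact ⟨Submodule.smul_mem _ _ hp.1, fun h => by rw [hp.2 h, smul_zero]⟩
  · intro k i p hp' hp
    refine ⟨?_, fun h => by omega⟩
    have : (fun y : Amb n => fderiv ℝ (fun y => y i * p y) y v) =
        (v i) • p + fun y => y i * fderiv ℝ p y v := by
      ext y
      rw [fderiv_coord_mul i (contDiff_of_mem_HP hp')]
      rfl
    rw [this, Nat.add_sub_cancel]
    refine add_mem (Submodule.smul_mem _ _ hp') ?_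
    rcases Nat.eq_zero_or_pos k with rfl | hk
    · have h2 := hp.2 rfl
      have : (fun y : Amb n => y i * fderiv ℝ p y v) = 0 := by
        ext y
        rw [congrFun h2 y]
        simp
      rw [this]
      exact zero_mem _
    · have := coordMul_mem i hp.1
      rwa [Nat.sub_add_cancel hk] at this

theorem fderiv_mem_HP {k : ℕ} {p : Amb n → ℝ} (hp : p ∈ HP n k) (v : Amb n) :
    (fun y => fderiv ℝ p y v) ∈ HP n (k - 1) := (fderiv_mem_HP_aux hp v).1

theorem sum_coord_sq (y : Amb n) : ∑ i, y i * y i = ‖y‖ ^ 2 := by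
  rw [EuclideanSpace.norm_sq_eq]
  exact Finset.sum_congr rfl fun i _ => by rw [Real.norm_eq_abs, sq_abs, sq]

theorem normSq_mul_mem_HP {k : ℕ} {p : Amb n → ℝ} (hp : p ∈ HP n k) :
    (fun y => ‖y‖ ^ 2 * p y) ∈ HP n (k + 2) := by
  have : (fun y => ‖y‖ ^ 2 * p y) = ∑ i : Fin (n + 1), fun y : Amb n => y i * (y i * p y) := by
    ext y
    rw [Finset.sum_apply, ← sum_coord_sq, Finset.sum_mul]
    exact Finset.sum_congr rfl fun i _ => by ring
  rw [this]
  exact sum_mem fun i _ => coordMul_mem i (coordMul_mem i hp)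

theorem mul_mem_HP {j k : ℕ} {p q : Amb n → ℝ} (hp : p ∈ HP n j) (hq : q ∈ HP n k) :
    (fun y => p y * q y) ∈ HP n (j + k) := by
  refine HP_induction (P := fun j p => (fun y => p y * q y) ∈ HP n (j + k)) ?_ ?_ ?_ ?_ ?_ j p hp
  · simpa using hq
  · intro j
    have : (fun y => (0 : Amb n → ℝ) y * q y) = 0 := by ext; simp
    rw [this]
    exact zero_mem _
  · intro j p p' _ _ h1 h2
    have : (fun y => (p + p') y * q y) = (fun y => p y * q y) + fun y => p' y * q y := by
      ext; simp [add_mul]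
    rw [this]
    exact add_mem h1 h2
  · intro j c p _ h1
    have : (fun y => (c • p) y * q y) = c • (fun y => p y * q y) := by
      ext; simp [mul_assoc]
    rw [this]
    exact Submodule.smul_mem _ _ h1
  · intro j i p _ h1
    have := coordMul_mem i h1
    simp only [mul_assoc, Nat.add_right_comm j 1 k]
    exact this

instance finiteDimensional_HP (k : ℕ) : FiniteDimensional ℝ (HP n k) := by
  induction k with
  | zero => exact FiniteDimensional.span_singleton ℝ _
  | succ k ih =>
    have : ∀ i, FiniteDimensional ℝ ((HP n k).map (coordMul i)) := fun i => inferInstance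
    exact Submodule.finiteDimensional_iSup _

theorem euler_HP {k : ℕ} {p : Amb n → ℝ} (hp : p ∈ HP n k) (y : Amb n) :
    fderiv ℝ p y y = k * p y := by
  have h1 : HasDerivAt (fun t : ℝ => p (t • y)) (fderiv ℝ p y y) 1 := by
    have h2 : HasDerivAt (fun t : ℝ => t • y) ((1:ℝ) • y) 1 := (hasDerivAt_id 1).smul_const y
    have h3 : HasFDerivAt p (fderiv ℝ p y) ((1:ℝ) • y) := by
      simpa using ((contDiff_of_mem_HP hp).differentiable (by simp) y).hasFDerivAt
    have h4 := h3.comp_hasDerivAt (1:ℝ) h2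
    rwa [one_smul] at h4
  have h4 : HasDerivAt (fun t : ℝ => p (t • y)) (k * p y) 1 := by
    simp only [homogeneous_of_mem_HP hp]
    simpa using (hasDerivAt_pow k (1:ℝ)).mul_const (p y)
  exact h1.unique h4

/-- The Euclidean Laplacian of a smooth function, in coordinates. -/
def coordLaplacian (p : Amb n → ℝ) (y : Amb n) : ℝ :=
  ∑ i, fderiv ℝ (fun z => fderiv ℝ p z (bvec i)) y (bvec i)

theorem coordLaplacian_mem_HP {k : ℕ} {p : Amb n → ℝ} (hp : p ∈ HP n k) :
    coordLaplacian p ∈ HP n (k - 2) := by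
  have : coordLaplacian p =
      ∑ i, fun y => fderiv ℝ (fun z => fderiv ℝ p z (bvec i)) y (bvec i) := by
    ext y
    simp [coordLaplacian]
  rw [this]
  exact sum_mem fun i _ => fderiv_mem_HP (fderiv_mem_HP hp _) _

theorem coordLaplacian_eq_zero {k : ℕ} (hk : k < 2) {p : Amb n → ℝ} (hp : p ∈ HP n k) :
    coordLaplacian p = 0 := by
  ext y
  refine Finset.sum_eq_zero fun i _ => ?_
  have := (fderiv_mem_HP_aux (fderiv_mem_HP hp (bvec i)) (bvec i)).2 (by omega)
  exact congrFun this y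

theorem isSmooth_of_mem_HP {k : ℕ} {p : Amb n → ℝ} (hp : p ∈ HP n k) :
    IsSmooth (fun x : Sph n => p x) :=
  isSmooth_of_contDiffOn isOpen_univ (fun _ => mem_univ _) (contDiff_of_mem_HP hp).contDiffOn

theorem sum_coord_fderiv (p : Amb n → ℝ) (y : Amb n) :
    ∑ i, y i * fderiv ℝ p y (bvec i) = fderiv ℝ p y y := by
  have h2 := congrArg (fderiv ℝ p y) ((EuclideanSpace.basisFun (Fin (n + 1)) ℝ).sum_repr y)
  rw [← h2, map_sum]
  simp [bvec]

theorem hasFDerivAt_normSq_rpow (r : ℝ) {y : Amb n} (hy : y ≠ 0) :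
    HasFDerivAt (fun z : Amb n => (‖z‖ ^ 2) ^ r)
      ((2 * r * (‖y‖ ^ 2) ^ (r - 1)) • innerSL ℝ y) y := by
  have h1 : HasFDerivAt (fun y : Amb n => ‖y‖ ^ 2) (2 • (innerSL ℝ y)) y :=
    (hasStrictFDerivAt_norm_sq y).hasFDerivAt
  have h2 := h1.rpow_const (p := r) (Or.inl (by simp [hy]))
  refine h2.congr_fderiv ?_
  ext v
  simp only [_root_.smul_apply, smul_eq_mul, nsmul_eq_mul, innerSL_apply_apply]
  push_cast
  ring

/-- The spherical Laplacian of a homogeneous polynomial. -/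
theorem sphLaplacian_HP {k : ℕ} {p : Amb n → ℝ} (hp : p ∈ HP n k) (x : Sph n) :
    sphLaplacian (fun x : Sph n => p x) x = coordLaplacian p x - (k * (k + n - 1)) * p x := by
  -- Away from the origin the degree zero extension of `p` is `‖y‖ ^ (-k) * p`, that is `(‖y‖ ^ 2) ^
  -- r * p`.
  set r : ℝ := -(k / 2) with hr
  have hx := coe_sph_ne_zero x
  have hps := contDiff_of_mem_HP hp
  have hF : ∀ y : Amb n, y ≠ 0 →
      radialExt (fun x : Sph n => p x) y = (‖y‖ ^ 2) ^ r * p y := by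
    intro y hy
    have hny : 0 < ‖y‖ := norm_pos_iff.mpr hy
    rw [radialExt_apply _ hy]
    simp only
    rw [homogeneous_of_mem_HP hp, hr, ← Real.rpow_natCast ‖y‖ 2, ← Real.rpow_mul hny.le,
      ← Real.rpow_natCast, Real.inv_rpow hny.le, ← Real.rpow_neg hny.le]
    congr 2
    push_cast
    ring
  have hd1 : ∀ i, ∀ y : Amb n, y ≠ 0 →
      fderiv ℝ (radialExt (fun x : Sph n => p x)) y (bvec i) =
        (‖y‖ ^ 2) ^ r * fderiv ℝ p y (bvec i) + 2 * r * ((‖y‖ ^ 2) ^ (r - 1) * (y i * p y)) := by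
    intro i y hy
    have he : radialExt (fun x : Sph n => p x) =ᶠ[𝓝 y] fun y => (‖y‖ ^ 2) ^ r * p y := by
      filter_upwards [isOpen_punct.mem_nhds hy] with z hz using hF z hz
    have h : HasFDerivAt (fun y => (‖y‖ ^ 2) ^ r * p y) _ y := (hasFDerivAt_normSq_rpow r hy).mul
      (hps.differentiable (by simp) y).hasFDerivAt
    rw [he.fderiv_eq, h.fderiv]
    simp [bvec, EuclideanSpace.inner_single_right]
    ring
  rw [sphLaplacian, laplacian_eq_sum _
    (ContDiffOn.contDiffAt_two (isSmooth_of_mem_HP hp).contDiffOn_radialExt hx)]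
  have hd2 : ∀ i, fderiv ℝ (fun z =>
      fderiv ℝ (radialExt (fun x : Sph n => p x)) z (bvec i)) (x : Amb n) (bvec i) =
      fderiv ℝ (fun z => fderiv ℝ p z (bvec i)) x (bvec i) +
        4 * r * ((x : Amb n) i * fderiv ℝ p x (bvec i)) + 2 * r * p x +
        4 * r * (r - 1) * p x * ((x : Amb n) i * (x : Amb n) i) := by
    intro i
    have he : (fun z => fderiv ℝ (radialExt (fun x : Sph n => p x)) z (bvec i)) =ᶠ[𝓝 (x : Amb n)]
        fun y => (‖y‖ ^ 2) ^ r * fderiv ℝ p y (bvec i) +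
          2 * r * ((‖y‖ ^ 2) ^ (r - 1) * (y i * p y)) := by
      filter_upwards [isOpen_punct.mem_nhds hx] with z hz using hd1 i z hz
    have hq := contDiff_of_mem_HP (fderiv_mem_HP hp (bvec i))
    have hc := (contDiff_coord i).mul hps
    have h : HasFDerivAt (fun y : Amb n => (‖y‖ ^ 2) ^ r * fderiv ℝ p y (bvec i) +
        2 * r * ((‖y‖ ^ 2) ^ (r - 1) * (y i * p y))) _ (x : Amb n) :=
      ((hasFDerivAt_normSq_rpow r hx).mul (hq.differentiable (by simp) x).hasFDerivAt).add
        (((hasFDerivAt_normSq_rpow (r - 1) hx).mul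
          (hc.differentiable (by simp) x).hasFDerivAt).const_mul (2 * r))
    rw [he.fderiv_eq, h.fderiv]
    simp only [_root_.add_apply, _root_.smul_apply, smul_eq_mul, fderiv_coord_mul i hps,
      norm_coe_sph, innerSL_apply_apply]
    simp [bvec, EuclideanSpace.inner_single_right]
    ring
  -- By Euler's identity and `∑ x_i² = 1` the coefficient of `p x` is `4 r k + 2 r (n + 1) + 4 r (r
  -- - 1)`, which equals `-k (k + n - 1)` for `r = -k / 2`.
  simp only [hd2, Finset.sum_add_distrib, ← Finset.mul_sum, sum_coord_fderiv, euler_HP hp,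
    sum_coord_sq, norm_coe_sph, coordLaplacian]
  simp [hr]
  ring

/-! ### Derivative bounds with polynomial loss in the degree -/

/-- On a great circle each coordinate is a trigonometric polynomial of degree one. Multiplication by
`exp (i k θ)` clears the negative frequencies and leaves an algebraic polynomial in `exp (i θ)`. -/
theorem exists_polynomial_circle {k : ℕ} {p : Amb n → ℝ} (hp : p ∈ HP n k) (x v : Amb n) :
    ∃ P : Polynomial ℂ, P.natDegree ≤ 2 * k ∧ ∀ θ : ℝ,
      (p (Real.cos θ • x + Real.sin θ • v) : ℂ) * Complex.exp (θ * Complex.I) ^ k =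
        P.eval (Complex.exp (θ * Complex.I)) := by
  refine HP_induction (P := fun k p => ∃ P : Polynomial ℂ, P.natDegree ≤ 2 * k ∧ ∀ θ : ℝ,
      (p (Real.cos θ • x + Real.sin θ • v) : ℂ) * Complex.exp (θ * Complex.I) ^ k =
        P.eval (Complex.exp (θ * Complex.I))) ?_ ?_ ?_ ?_ ?_ k p hp
  · exact ⟨1, by simp, by simp⟩
  · exact fun k => ⟨0, by simp, by simp⟩
  · rintro k p q _ _ ⟨P, hP, hP'⟩ ⟨Q, hQ, hQ'⟩
    refine ⟨P + Q, (Polynomial.natDegree_add_le _ _).trans (max_le hP hQ), fun θ => ?_⟩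
    rw [Polynomial.eval_add, ← hP', ← hQ', Pi.add_apply]
    push_cast
    ring
  · rintro k c p _ ⟨P, hP, hP'⟩
    refine ⟨Polynomial.C (c : ℂ) * P, (Polynomial.natDegree_C_mul_le _ _).trans hP, fun θ => ?_⟩
    rw [Polynomial.eval_mul, ← hP', Polynomial.eval_C, Pi.smul_apply, smul_eq_mul]
    push_cast
    ring
  · rintro k i p _ ⟨P, hP, hP'⟩
    -- With `z = exp (i θ)`, the first factor is `(x_i cos θ + v_i sin θ) z`, using `z cos θ = (z² +
    -- 1) / 2` and `z sin θ = -i (z² - 1) / 2`.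
    refine ⟨(Polynomial.C (x i / 2 : ℂ) * (Polynomial.X ^ 2 + 1) +
      Polynomial.C (-(v i / 2) * Complex.I : ℂ) * (Polynomial.X ^ 2 - 1)) * P, ?_, fun θ => ?_⟩
    · refine Polynomial.natDegree_mul_le.trans ?_
      have : (Polynomial.C (x i / 2 : ℂ) * (Polynomial.X ^ 2 + 1) +
        Polynomial.C (-(v i / 2) * Complex.I : ℂ) * (Polynomial.X ^ 2 - 1)).natDegree ≤ 2 := by
        compute_degree
      omega
    · have hc : (Real.cos θ : ℂ) * Complex.exp (θ * Complex.I) =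
          (Complex.exp (θ * Complex.I) ^ 2 + 1) / 2 := by
        rw [Complex.ofReal_cos, Complex.cos, neg_mul, Complex.exp_neg]
        field_simp [Complex.exp_ne_zero]
      have hs : (Real.sin θ : ℂ) * Complex.exp (θ * Complex.I) =
          (Complex.exp (θ * Complex.I) ^ 2 - 1) * (-Complex.I / 2) := by
        rw [Complex.ofReal_sin, Complex.sin, neg_mul, Complex.exp_neg]
        field_simp [Complex.exp_ne_zero]
        ring
      simp only [Polynomial.eval_mul, Polynomial.eval_add, Polynomial.eval_sub, Polynomial.eval_C,
        Polynomial.eval_pow, Polynomial.eval_X, Polynomial.eval_one, ← hP']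
      rw [PiLp.add_apply, PiLp.smul_apply, PiLp.smul_apply]
      simp only [smul_eq_mul]
      rw [pow_succ]
      push_cast [-Complex.ofReal_cos, -Complex.ofReal_sin]
      linear_combination (x i * (p (Real.cos θ • x + Real.sin θ • v) : ℂ) *
        Complex.exp (θ * Complex.I) ^ k) * hc + (v i * (p (Real.cos θ • x + Real.sin θ • v) : ℂ) *
        Complex.exp (θ * Complex.I) ^ k) * hs

/-- Parseval: the sum of the squared coefficients is the mean of `‖P‖ ^ 2` over the unit circle. -/
theorem norm_coeff_le_of_circle (P : Polynomial ℂ) {M : ℝ} (hM : 0 ≤ M)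
    (h : ∀ z : ℂ, ‖z‖ = 1 → ‖P.eval z‖ ≤ M) (j : ℕ) : ‖P.coeff j‖ ≤ M := by
  by_cases hj : j ∈ P.support
  · have h1 : ‖P.coeff j‖ ^ 2 ≤ M ^ 2 := by
      calc ‖P.coeff j‖ ^ 2 ≤ ∑ i ∈ P.support, ‖P.coeff i‖ ^ 2 :=
            Finset.single_le_sum (f := fun i => ‖P.coeff i‖ ^ 2) (fun i _ => by positivity) hj
        _ = Real.circleAverage (fun θ ↦ ‖P.eval θ‖ ^ 2) 0 1 :=
            Polynomial.sum_sq_norm_coeff_eq_circleAverage P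
        _ ≤ M ^ 2 := by
            apply Real.circleAverage_mono_on_of_le_circle
            · apply ContinuousOn.circleIntegrable'
              exact (P.continuous.norm.pow 2).continuousOn
            · intro z hz
              have : ‖z‖ = 1 := by simpa using hz
              exact pow_le_pow_left₀ (norm_nonneg _) (h z this) 2
    exact abs_le_of_sq_le_sq' h1 hM |>.2
  · rw [Polynomial.notMem_support_iff.mp hj]
    simpa using hM

theorem norm_cos_smul_add_sin_smul {x v : Amb n} (hx : ‖x‖ = 1) (hv : ‖v‖ = 1)
    (hxv : inner ℝ x v = 0) (θ : ℝ) : ‖Real.cos θ • x + Real.sin θ • v‖ = 1 := by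
  have h : ‖Real.cos θ • x + Real.sin θ • v‖ ^ 2 = 1 := by
    rw [norm_add_sq_real, norm_smul, norm_smul, inner_smul_left, inner_smul_right, hxv, hx, hv]
    simp
  nlinarith [norm_nonneg (Real.cos θ • x + Real.sin θ • v)]

/-- A crude Bernstein inequality along great circles. -/
theorem abs_fderiv_HP_tangent_le {k : ℕ} {p : Amb n → ℝ} (hp : p ∈ HP n k) {M : ℝ}
    (hM : ∀ y : Amb n, ‖y‖ = 1 → |p y| ≤ M) {x v : Amb n} (hx : ‖x‖ = 1) (hv : ‖v‖ = 1)
    (hxv : inner ℝ x v = 0) :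
    |fderiv ℝ p x v| ≤ (k + (2 * k + 1) * (2 * k)) * M := by
  have hM0 : 0 ≤ M := (abs_nonneg _).trans (hM x hx)
  obtain ⟨P, hPd, hP⟩ := exists_polynomial_circle hp x v
  have hPM : ∀ z : ℂ, ‖z‖ = 1 → ‖P.eval z‖ ≤ M := by
    intro z hz
    obtain ⟨θ, rfl⟩ : ∃ θ : ℝ, Complex.exp (θ * Complex.I) = z := by
      refine ⟨z.arg, ?_⟩
      have := Complex.norm_mul_exp_arg_mul_I z
      rwa [hz, Complex.ofReal_one, one_mul] at this
    rw [← hP, norm_mul, norm_pow, Complex.norm_exp_ofReal_mul_I, one_pow, mul_one,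
      Complex.norm_real, Real.norm_eq_abs]
    exact hM _ (norm_cos_smul_add_sin_smul hx hv hxv θ)
  have hcoef := norm_coeff_le_of_circle P hM0 hPM
  have hT : HasDerivAt (fun θ : ℝ => p (Real.cos θ • x + Real.sin θ • v)) (fderiv ℝ p x v) 0 := by
    have h2 : HasDerivAt (fun θ : ℝ => Real.cos θ • x + Real.sin θ • v)
        ((-Real.sin 0) • x + Real.cos 0 • v) 0 :=
      ((Real.hasDerivAt_cos 0).smul_const x).add ((Real.hasDerivAt_sin 0).smul_const v)
    have h3 : HasFDerivAt p (fderiv ℝ p x) (Real.cos 0 • x + Real.sin 0 • v) := by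
      simpa using ((contDiff_of_mem_HP hp).differentiable (by simp) x).hasFDerivAt
    have h4 := h3.comp_hasDerivAt (0:ℝ) h2
    simp only [Real.sin_zero, neg_zero, zero_smul, Real.cos_zero, one_smul, zero_add] at h4
    exact h4
  have hE : HasDerivAt (fun θ : ℝ => Complex.exp (θ * Complex.I)) Complex.I 0 := by
    have := ((Complex.ofRealCLM.hasDerivAt (x := (0:ℝ))).mul_const Complex.I).cexp
    simpa using this
  have h1 := (hT.ofReal_comp).mul (hE.pow k)
  have h2 : HasDerivAt (fun θ : ℝ => P.eval (Complex.exp (θ * Complex.I)))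
      (P.derivative.eval 1 * Complex.I) 0 := by
    have h3 : HasDerivAt (fun z => P.eval z) (P.derivative.eval 1)
        (Complex.exp ((0:ℝ) * Complex.I)) := by
      simpa using P.hasDerivAt 1
    exact h3.comp (0:ℝ) hE
  -- Differentiating the circle identity at `θ = 0` in two ways expresses the tangential derivative
  -- by `P.derivative.eval 1` and `k * p x`.
  have h3 := h1.unique (h2.congr_of_eventuallyEq (Eventually.of_forall hP))
  simp only [Complex.ofReal_zero, zero_mul, Complex.exp_zero, one_pow, mul_one, Real.cos_zero,
    one_smul, Real.sin_zero, zero_smul, add_zero, Pi.pow_apply] at h3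
  have h4 : (fderiv ℝ p x v : ℂ) =
      P.derivative.eval 1 * Complex.I - p x * (k * Complex.I) := by
    rw [← h3]; ring
  -- At most `2 k + 1` coefficients occur, each of norm at most `M` and multiplied by an index at
  -- most `2 k`.
  have h5 : ‖P.derivative.eval 1‖ ≤ (2 * k + 1) * (2 * k) * M := by
    rw [Polynomial.derivative_eval, Polynomial.sum_def]
    calc ‖∑ j ∈ P.support, P.coeff j * (j : ℂ) * 1 ^ (j - 1)‖
        ≤ ∑ j ∈ P.support, (2 * k) * M := by
          refine norm_sum_le_of_le _ fun j hj => ?_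
          have hj : j ≤ 2 * k := (Polynomial.le_natDegree_of_mem_supp j hj).trans hPd
          have hj : (j : ℝ) ≤ 2 * k := by exact_mod_cast hj
          rw [one_pow, mul_one, norm_mul, Complex.norm_natCast, mul_comm]
          exact mul_le_mul hj (hcoef j) (norm_nonneg _) (by positivity)
      _ = P.support.card * ((2 * k) * M) := by simp
      _ ≤ (2 * k + 1) * ((2 * k) * M) := by
          refine mul_le_mul_of_nonneg_right ?_ (by positivity)
          have : P.support.card ≤ 2 * k + 1 := by
            have := Finset.card_le_card (Polynomial.supp_subset_range_natDegree_succ (p := P))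
            rw [Finset.card_range] at this
            omega
          exact_mod_cast this
      _ = _ := by ring
  calc |fderiv ℝ p x v| = ‖(fderiv ℝ p x v : ℂ)‖ := by rw [Complex.norm_real, Real.norm_eq_abs]
    _ ≤ ‖P.derivative.eval 1 * Complex.I‖ + ‖(p x : ℂ) * (k * Complex.I)‖ := by
        rw [h4]; exact norm_sub_le _ _
    _ = ‖P.derivative.eval 1‖ + |p x| * k := by simp
    _ ≤ (2 * k + 1) * (2 * k) * M + M * k :=
        add_le_add h5 (mul_le_mul_of_nonneg_right (hM x hx) (by positivity))
    _ = _ := by ring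

/-- Split `v` into a radial part, controlled by Euler's identity, and a tangential part, controlled
by the inequality on great circles. The sum of the constants is `4 k² + 4 k`. -/
theorem abs_fderiv_HP_le {k : ℕ} {p : Amb n → ℝ} (hp : p ∈ HP n k) {M : ℝ}
    (hM : ∀ y : Amb n, ‖y‖ = 1 → |p y| ≤ M) {x : Amb n} (hx : ‖x‖ = 1) (v : Amb n) :
    |fderiv ℝ p x v| ≤ 4 * (k + 1) ^ 2 * M * ‖v‖ := by
  have hM0 : 0 ≤ M := (abs_nonneg _).trans (hM x hx)
  set a := inner ℝ x v with ha
  set w := v - a • x with hw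
  have hxw : inner ℝ x w = 0 := by
    rw [hw, inner_sub_right, inner_smul_right, real_inner_self_eq_norm_sq, hx, ← ha]
    ring
  have ha' : |a| ≤ ‖v‖ := by
    have := abs_real_inner_le_norm x v
    rwa [hx, one_mul] at this
  have hvw : v = a • x + w := by rw [hw]; abel
  have hw' : ‖w‖ ≤ ‖v‖ := by
    have h1 : ‖v‖ ^ 2 = a ^ 2 + ‖w‖ ^ 2 := by
      rw [hvw, norm_add_sq_real, norm_smul, inner_smul_left, hxw, hx]
      simp
    exact abs_le_of_sq_le_sq' (by nlinarith [sq_nonneg a]) (norm_nonneg v) |>.2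
  have h1 : |fderiv ℝ p x w| ≤ (k + (2 * k + 1) * (2 * k)) * M * ‖w‖ := by
    by_cases hw0 : w = 0
    · simp [hw0]
    have hnw : 0 < ‖w‖ := norm_pos_iff.mpr hw0
    have := abs_fderiv_HP_tangent_le hp hM hx (v := ‖w‖⁻¹ • w) (by simp [norm_smul, hw0])
      (by rw [inner_smul_right, hxw, mul_zero])
    rw [map_smul, smul_eq_mul, abs_mul, abs_of_pos (by positivity), inv_mul_le_iff₀ hnw] at this
    linarith
  have h2 : |fderiv ℝ p x (a • x)| ≤ k * M * ‖v‖ := by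
    rw [map_smul, euler_HP hp, smul_eq_mul, abs_mul, abs_mul, Nat.abs_cast]
    calc |a| * (k * |p x|) ≤ ‖v‖ * (k * M) := by
          gcongr
          exact hM x hx
      _ = _ := by ring
  rw [hvw, map_add, ← hvw]
  calc _ ≤ |fderiv ℝ p x (a • x)| + |fderiv ℝ p x w| := abs_add_le _ _
    _ ≤ k * M * ‖v‖ + (k + (2 * k + 1) * (2 * k)) * M * ‖v‖ := by
        refine add_le_add h2 (h1.trans ?_)
        gcongr
    _ = (k + (k + (2 * k + 1) * (2 * k))) * (M * ‖v‖) := by ring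
    _ ≤ 4 * (k + 1) ^ 2 * (M * ‖v‖) := by
        refine mul_le_mul_of_nonneg_right ?_ (by positivity)
        have : (0:ℝ) ≤ k := by positivity
        nlinarith
    _ = _ := by ring

/-- A directional derivative is again a homogeneous polynomial, so the first order bound can be
iterated. The degree drops at each stage; the fixed upper bound `K` keeps one constant for all of
them. -/
theorem norm_iteratedFDeriv_HP_le (K m : ℕ) : ∀ {k : ℕ}, k ≤ K → ∀ {p : Amb n → ℝ}, p ∈ HP n k →
    ∀ {M : ℝ}, (∀ y : Amb n, ‖y‖ = 1 → |p y| ≤ M) → ∀ {x : Amb n}, ‖x‖ = 1 →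
    ‖iteratedFDeriv ℝ m p x‖ ≤ (4 * ((K : ℝ) + 1) ^ 2) ^ m * M := by
  induction m with
  | zero =>
    intro k hk p hp M hM x hx
    simpa using hM x hx
  | succ m ih =>
    intro k hk p hp M hM x hx
    have hM0 : 0 ≤ M := (abs_nonneg _).trans (hM x hx)
    have hps := contDiff_of_mem_HP hp
    refine ContinuousMultilinearMap.opNorm_le_bound (by positivity) fun w => ?_
    rw [iteratedFDeriv_succ_apply_right]
    set v := w (Fin.last m)
    have h1 : iteratedFDeriv ℝ m (fun y => fderiv ℝ p y v) x =
        (ContinuousLinearMap.apply ℝ ℝ v).compContinuousMultilinearMap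
          (iteratedFDeriv ℝ m (fderiv ℝ p) x) :=
      (ContinuousLinearMap.apply ℝ ℝ v).iteratedFDeriv_comp_left
        ((hps.fderiv_right (m := ∞) (by simp)).contDiffAt) (i := m)
        (by exact_mod_cast le_top)
    have h2 : iteratedFDeriv ℝ m (fderiv ℝ p) x (Fin.init w) v =
        iteratedFDeriv ℝ m (fun y => fderiv ℝ p y v) x (Fin.init w) := by
      rw [h1]; rfl
    rw [show (fun y => fderiv ℝ p y) = fderiv ℝ p from rfl, h2]
    have hM' : ∀ y : Amb n, ‖y‖ = 1 → |fderiv ℝ p y v| ≤ 4 * ((K : ℝ) + 1) ^ 2 * M * ‖v‖ := by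
      intro y hy
      refine (abs_fderiv_HP_le hp hM hy v).trans ?_
      gcongr
    have h3 := ih ((Nat.sub_le k 1).trans hk) (fderiv_mem_HP hp v) hM' hx
    refine (ContinuousMultilinearMap.le_of_opNorm_le h3 _).trans (le_of_eq ?_)
    rw [Fin.prod_univ_castSucc]
    simp only [Fin.init]
    ring

/-- The extension is `p ∘ normalize`. Derivatives of `normalize` are bounded on the compact set
independently of `p`, and each derivative of `p` costs a factor of order `(k + 1) ^ 2`. -/
theorem exists_norm_iteratedFDeriv_radialExt_HP_le {K : Set (Amb n)} (hK : IsCompact K)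
    (hK0 : K ⊆ {0}ᶜ) (j : ℕ) : ∃ C : ℝ, 1 ≤ C ∧ ∀ (k : ℕ) (p : Amb n → ℝ), p ∈ HP n k →
      ∀ M : ℝ, (∀ x : Sph n, |p x| ≤ M) → ∀ y ∈ K,
        ‖iteratedFDeriv ℝ j (radialExt (fun x : Sph n => p x)) y‖ ≤
          C * ((k : ℝ) + 1) ^ (2 * j) * M := by
  have hbd : ∀ i : ℕ, ∃ D : ℝ, ∀ y ∈ K,
      ‖iteratedFDerivWithin ℝ i (normalize (n := n)) {0}ᶜ y‖ ≤ D := by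
    intro i
    have hc : ContinuousOn (iteratedFDerivWithin ℝ i (normalize (n := n)) {0}ᶜ) {0}ᶜ :=
      contDiffOn_normalize.continuousOn_iteratedFDerivWithin (WithTop.coe_le_coe.mpr le_top)
        isOpen_punct.uniqueDiffOn
    exact hK.exists_bound_of_continuousOn (hc.mono hK0)
  choose D hD using hbd
  -- The composition estimate wants the `i`-th derivative of the inner map bounded by an `i`-th
  -- power; any `E ≥ 1` dominating all `D i` provides this.
  set E : ℝ := 1 + ∑ i ∈ Finset.range (j + 1), |D i| with hE
  have hE1 : 1 ≤ E := by
    rw [hE]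
    have : 0 ≤ ∑ i ∈ Finset.range (j + 1), |D i| := Finset.sum_nonneg fun i _ => abs_nonneg _
    linarith
  have hDE : ∀ i, 1 ≤ i → i ≤ j → D i ≤ E ^ i := by
    intro i hi hij
    have h1 : |D i| ≤ ∑ i ∈ Finset.range (j + 1), |D i| :=
      Finset.single_le_sum (f := fun i => |D i|) (fun i _ => abs_nonneg _)
        (Finset.mem_range.mpr (by omega))
    calc D i ≤ |D i| := le_abs_self _
      _ ≤ E := by rw [hE]; linarith
      _ ≤ E ^ i := le_self_pow₀ hE1 (by omega)
  refine ⟨j.factorial * 4 ^ j * E ^ j, ?_, ?_⟩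
  · have h1 : (1:ℝ) ≤ j.factorial := by exact_mod_cast Nat.one_le_iff_ne_zero.mpr (Nat.factorial_ne_zero j)
    have h2 : (1:ℝ) ≤ 4 ^ j := one_le_pow₀ (by norm_num)
    have h3 : (1:ℝ) ≤ E ^ j := one_le_pow₀ hE1
    exact one_le_mul_of_one_le_of_one_le (one_le_mul_of_one_le_of_one_le h1 h2) h3
  intro k p hp M hM y hy
  have hy0 : y ∈ ({0}ᶜ : Set (Amb n)) := hK0 hy
  have hM' : ∀ z : Amb n, ‖z‖ = 1 → |p z| ≤ M := fun z hz => hM ⟨z, by simpa using hz⟩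
  have hny := norm_normalize hy0
  have hM0 : 0 ≤ M := (abs_nonneg _).trans (hM' _ hny)
  rw [← iteratedFDerivWithin_of_isOpen j isOpen_punct hy0]
  have hcongr : EqOn (radialExt (fun x : Sph n => p x)) (p ∘ normalize) {0}ᶜ := by
    intro z hz
    rw [radialExt_apply _ hz]
    rfl
  rw [iteratedFDerivWithin_congr hcongr hy0]
  have hB : (1:ℝ) ≤ 4 * ((k : ℝ) + 1) ^ 2 := by nlinarith [(Nat.cast_nonneg k : (0:ℝ) ≤ k)]
  have h := norm_iteratedFDerivWithin_comp_le (n := j) (g := p) (f := normalize) (s := {0}ᶜ)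
    (t := univ) (x := y) (contDiff_of_mem_HP hp).contDiffOn contDiffOn_normalize
    (WithTop.coe_le_coe.mpr le_top) uniqueDiffOn_univ isOpen_punct.uniqueDiffOn
    (fun _ _ => mem_univ _) hy0 (C := (4 * ((k : ℝ) + 1) ^ 2) ^ j * M) (D := E) ?_ ?_
  · refine h.trans (le_of_eq ?_)
    rw [mul_pow, pow_mul]
    ring
  · intro i hi
    rw [iteratedFDerivWithin_univ]
    refine (norm_iteratedFDeriv_HP_le k i le_rfl hp hM' hny).trans ?_
    exact mul_le_mul_of_nonneg_right (pow_le_pow_right₀ hB hi) hM0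
  · exact fun i h1 h2 => (hD i y hy).trans (hDE i h1 h2)

/-! ### Definiteness of the pairing and its comparison with the supremum norm -/

theorem pair_self_nonneg (f : Sph n → ℝ) : 0 ≤ pair f f :=
  integral_nonneg fun y => mul_nonneg (wt_nonneg y) (mul_self_nonneg _)

theorem continuousOn_radialExt {f : Sph n → ℝ} (hf : Continuous f) :
    ContinuousOn (radialExt f) {0}ᶜ := by
  intro y hy
  have h1 : ContinuousAt (toSph (n := n)) y := (contMDiffAt_toSph hy).continuousAt
  have h2 : ContinuousAt (f ∘ toSph) y := ContinuousAt.comp hf.continuousAt h1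
  refine (h2.congr ?_).continuousWithinAt
  filter_upwards [isOpen_punct.mem_nhds hy] with z hz using (radialExt_eq f hz).symm

theorem integrable_pair {f g : Sph n → ℝ} (hf : Continuous f) (hg : Continuous g) :
    Integrable fun y : Amb n => wt y * (radialExt f y * radialExt g y) :=
  integrable_of_annulus (contDiff_wt.continuous.continuousOn.mul
    ((continuousOn_radialExt hf).mul (continuousOn_radialExt hg)))
    fun y hy => by rw [wt_eq_zero hy, zero_mul]

theorem abs_norm_sub_one_le (x : Sph n) (y : Amb n) : |‖y‖ - 1| ≤ ‖y - x‖ := by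
  have := abs_norm_sub_norm_le y (x : Amb n)
  rwa [norm_coe_sph] at this

instance instNonemptySph : Nonempty (Sph n) := ⟨toSph 0⟩

/-- The weight equals one on a ball of radius at most `1 / 16` about a point of the sphere, so `pair
f f` is at least `m ^ 2` times the volume of that ball. -/
theorem half_bound_le_pair {f : Sph n → ℝ} (hf : Continuous f) (x : Sph n) {m δ : ℝ} (hm : 0 ≤ m)
    (hδ0 : 0 ≤ δ) (hδ : δ ≤ 1 / 16)
    (h : ∀ y ∈ Metric.ball (x : Amb n) δ, m ≤ |radialExt f y|) :
    m ^ 2 * δ ^ (n + 1) * (volume : Measure (Amb n)).real (Metric.ball 0 1) ≤ pair f f := by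
  have hball : (volume : Measure (Amb n)).real (Metric.ball (x : Amb n) δ) =
      δ ^ (n + 1) * (volume : Measure (Amb n)).real (Metric.ball 0 1) := by
    rw [Measure.real, Measure.addHaar_ball _ _ hδ0, ENNReal.toReal_mul,
      ENNReal.toReal_ofReal (by positivity)]
    simp [Measure.real]
  have hwt : ∀ y ∈ Metric.ball (x : Amb n) δ, wt y = 1 := by
    intro y hy
    apply wt_eq_one
    rw [mem_ball_iff_norm] at hy
    have h1 : |‖y‖ - 1| ≤ 1 / 16 := (abs_norm_sub_one_le x y).trans (hy.le.trans hδ)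
    rw [abs_le] at h1 ⊢
    constructor <;> nlinarith [h1.1, h1.2]
  rw [mul_assoc, ← hball]
  calc m ^ 2 * (volume : Measure (Amb n)).real (Metric.ball (x : Amb n) δ)
      = ∫ _ in Metric.ball (x : Amb n) δ, m ^ 2 := by
        rw [setIntegral_const, smul_eq_mul, mul_comm]
    _ ≤ ∫ y in Metric.ball (x : Amb n) δ, wt y * (radialExt f y * radialExt f y) := by
        refine setIntegral_mono_on ?_ (integrable_pair hf hf).integrableOn
          measurableSet_ball fun y hy => ?_
        · exact integrableOn_const (measure_ball_lt_top.ne)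
        · rw [hwt y hy, one_mul, ← abs_mul_abs_self, ← sq]
          exact pow_le_pow_left₀ hm (h y hy) 2
    _ ≤ pair f f := setIntegral_le_integral (integrable_pair hf hf)
        (Eventually.of_forall fun y => mul_nonneg (wt_nonneg y) (mul_self_nonneg _))

theorem pair_self_pos {f : Sph n → ℝ} (hf : Continuous f) (h : pair f f = 0) : f = 0 := by
  by_contra hne
  obtain ⟨x, hx⟩ := Function.ne_iff.mp hne
  have hpos : 0 < |f x| := abs_pos.mpr hx
  have h1 : ∀ᶠ y in 𝓝 (x : Amb n), |f x| / 2 < |radialExt f y| := by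
    have : ContinuousAt (fun y => |radialExt f y|) (x : Amb n) :=
      ((continuousOn_radialExt hf).continuousAt (isOpen_punct.mem_nhds (coe_sph_ne_zero x))).abs
    exact this.eventually (lt_mem_nhds (by simp only [radialExt_coe]; linarith))
  obtain ⟨δ, hδ, hb⟩ := Metric.eventually_nhds_iff_ball.mp h1
  have h2 := half_bound_le_pair hf x (m := |f x| / 2) (δ := min δ (1 / 16)) (by positivity)
    (by positivity) (min_le_right _ _)
    fun y hy => (hb y (Metric.ball_subset_ball (min_le_left _ _) hy)).le
  have h3 : 0 < (volume : Measure (Amb n)).real (Metric.ball 0 1) :=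
    ENNReal.toReal_pos (Metric.measure_ball_pos _ _ one_pos).ne' measure_ball_lt_top.ne
  have : 0 < min δ (1 / 16) := by positivity
  rw [h] at h2
  have : 0 < (|f x| / 2) ^ 2 * min δ (1 / 16) ^ (n + 1) *
    (volume : Measure (Amb n)).real (Metric.ball 0 1) := by positivity
  linarith

/-- A crude Nikolskii inequality. -/
theorem exists_sq_le_pair_HP (n : ℕ) : ∃ C : ℝ, 0 ≤ C ∧ ∀ (k : ℕ) (p : Amb n → ℝ), p ∈ HP n k →
    ∀ x : Sph n, (p x) ^ 2 ≤ C * ((k : ℝ) + 1) ^ (2 * (n + 1)) *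
      pair (fun x : Sph n => p x) (fun x : Sph n => p x) := by
  obtain ⟨C, hC1, hC⟩ := exists_norm_iteratedFDeriv_radialExt_HP_le (n := n)
    isCompact_annulus annulus_subset 1
  set V := (volume : Measure (Amb n)).real (Metric.ball 0 1) with hV
  have hVpos : 0 < V :=
    ENNReal.toReal_pos (Metric.measure_ball_pos _ _ one_pos).ne' measure_ball_lt_top.ne
  refine ⟨4 * (16 * C) ^ (n + 1) / V, by positivity, fun k p hp x => ?_⟩
  have hps := isSmooth_of_mem_HP (n := n) hp
  set f : Sph n → ℝ := fun x => p x with hf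
  have hfc : Continuous f := hps.continuous
  obtain ⟨x₀, -, hx₀⟩ := isCompact_univ.exists_isMaxOn (univ_nonempty (α := Sph n))
    (hfc.abs.continuousOn)
  have hmax : ∀ x, |f x| ≤ |f x₀| := fun x => hx₀ (mem_univ x)
  set M := |f x₀| with hM
  have hk : (0:ℝ) < (k : ℝ) + 1 := by positivity
  have hk1 : (1:ℝ) ≤ (k : ℝ) + 1 := by linarith [(Nat.cast_nonneg k : (0:ℝ) ≤ k)]
  -- With the gradient bound `C (k + 1)² M`, a polynomial with maximum `M` at `x₀` changes by at
  -- most `M / 16` within distance `δ`, so it stays above `M / 2` there. The volume `δ ^ (n + 1)` of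
  -- the ball is the source of the exponent `2 (n + 1)`.
  set δ : ℝ := 1 / (16 * C * ((k : ℝ) + 1) ^ 2) with hδ
  have hCk : 1 ≤ C * ((k : ℝ) + 1) ^ 2 := one_le_mul_of_one_le_of_one_le hC1 (one_le_pow₀ hk1)
  have hδ0 : 0 < δ := by positivity
  have hδ16 : δ ≤ 1 / 16 := by
    rw [hδ]
    apply one_div_le_one_div_of_le (by norm_num)
    linarith
  have hball : Metric.ball (x₀ : Amb n) δ ⊆ annulus n := by
    intro y hy
    rw [mem_ball_iff_norm] at hy
    have h1 : |‖y‖ - 1| ≤ 1 / 16 := (abs_norm_sub_one_le x₀ y).trans (hy.le.trans hδ16)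
    rw [abs_le] at h1
    exact ⟨by nlinarith [h1.1, h1.2], by nlinarith [h1.1, h1.2]⟩
  have hlow : ∀ y ∈ Metric.ball (x₀ : Amb n) δ, M / 2 ≤ |radialExt f y| := by
    intro y hy
    have h1 := (convex_ball (x₀ : Amb n) δ).norm_image_sub_le_of_norm_fderiv_le (𝕜 := ℝ)
      (f := radialExt f) (C := C * ((k : ℝ) + 1) ^ 2 * M) (fun z hz =>
        (hps.contDiffOn_radialExt.contDiffAt
          (isOpen_punct.mem_nhds (annulus_subset (hball hz)))).differentiableAt (by simp))
      (fun z hz => by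
        rw [← norm_iteratedFDeriv_one]
        exact hC k p hp M hmax z (hball hz)) (Metric.mem_ball_self hδ0) hy
    rw [mem_ball_iff_norm] at hy
    have h2 : C * ((k : ℝ) + 1) ^ 2 * M * ‖y - x₀‖ ≤ M / 2 := by
      calc C * ((k : ℝ) + 1) ^ 2 * M * ‖y - x₀‖ ≤ C * ((k : ℝ) + 1) ^ 2 * M * δ := by
            gcongr
        _ = M / 16 := by rw [hδ]; field_simp
        _ ≤ M / 2 := by have : 0 ≤ M := abs_nonneg _; linarith
    have h3 := h1.trans h2
    rw [radialExt_coe, Real.norm_eq_abs] at h3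
    have := abs_sub_abs_le_abs_sub (f x₀) (radialExt f y)
    rw [abs_sub_comm] at this
    linarith
  have h1 := half_bound_le_pair hfc x₀ (m := M / 2) (by positivity) hδ0.le hδ16 hlow
  have h2 : (p x) ^ 2 ≤ M ^ 2 := by
    rw [← sq_abs]
    exact pow_le_pow_left₀ (abs_nonneg _) (hmax x) 2
  refine h2.trans ?_
  have h3 : M ^ 2 = 4 * (16 * C) ^ (n + 1) / V * ((k : ℝ) + 1) ^ (2 * (n + 1)) *
      ((M / 2) ^ 2 * δ ^ (n + 1) * V) := by
    rw [hδ, div_pow 1, one_pow, mul_pow (16 * C), ← pow_mul]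
    field_simp
    ring
  rw [h3]
  gcongr

theorem pair_add_left {f g h : Sph n → ℝ} (hf : Continuous f) (hg : Continuous g)
    (hh : Continuous h) : pair (f + g) h = pair f h + pair g h := by
  rw [pair, pair, pair, ← integral_add (integrable_pair hf hh) (integrable_pair hg hh)]
  refine integral_congr_ae (Eventually.of_forall fun y => ?_)
  by_cases hy : y = 0
  · have : y ∉ annulus n := fun h => annulus_subset h hy
    simp [wt_eq_zero this]
  · simp only [radialExt_eq _ hy, Pi.add_apply]
    ring

theorem pair_smul_left (c : ℝ) (f h : Sph n → ℝ) : pair (c • f) h = c * pair f h := by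
  rw [pair, pair, ← integral_const_mul]
  refine integral_congr_ae (Eventually.of_forall fun y => ?_)
  by_cases hy : y = 0
  · have : y ∉ annulus n := fun h => annulus_subset h hy
    simp [wt_eq_zero this]
  · simp only [radialExt_eq _ hy, Pi.smul_apply, smul_eq_mul]
    ring

theorem pair_add_right {f g h : Sph n → ℝ} (hf : Continuous f) (hg : Continuous g)
    (hh : Continuous h) : pair h (f + g) = pair h f + pair h g := by
  rw [pair_comm, pair_add_left hf hg hh, pair_comm f, pair_comm g]

theorem pair_smul_right (c : ℝ) (f h : Sph n → ℝ) : pair h (c • f) = c * pair h f := by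
  rw [pair_comm, pair_smul_left, pair_comm]

@[simp] theorem pair_zero_left (h : Sph n → ℝ) : pair 0 h = 0 := by
  simpa using pair_smul_left 0 (0 : Sph n → ℝ) h

@[simp] theorem pair_zero_right (h : Sph n → ℝ) : pair h 0 = 0 := by
  rw [pair_comm, pair_zero_left]

theorem pair_sub_left {f g h : Sph n → ℝ} (hf : Continuous f) (hg : Continuous g)
    (hh : Continuous h) : pair (f - g) h = pair f h - pair g h := by
  have : f - g = f + (-1 : ℝ) • g := by ext; simp [sub_eq_add_neg]
  rw [this, pair_add_left hf (hg.const_smul _) hh, pair_smul_left]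
  ring

theorem pair_sub_right {f g h : Sph n → ℝ} (hf : Continuous f) (hg : Continuous g)
    (hh : Continuous h) : pair h (f - g) = pair h f - pair h g := by
  rw [pair_comm, pair_sub_left hf hg hh, pair_comm f, pair_comm g]

/-- The total mass of the weight. -/
def wtMass (n : ℕ) : ℝ := ∫ y : Amb n, wt y

theorem integrable_wt : Integrable (wt (n := n)) :=
  integrable_of_annulus contDiff_wt.continuous.continuousOn fun _ hy => wt_eq_zero hy

theorem wtMass_nonneg : 0 ≤ wtMass n := integral_nonneg wt_nonneg

theorem abs_pair_le {f g : Sph n → ℝ} {A B : ℝ} (hf : ∀ x, |f x| ≤ A) (hg : ∀ x, |g x| ≤ B) :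
    |pair f g| ≤ A * B * wtMass n := by
  rw [pair, wtMass, ← integral_const_mul, ← Real.norm_eq_abs]
  refine norm_integral_le_of_norm_le (integrable_wt.const_mul _) (Eventually.of_forall fun y => ?_)
  by_cases hy : y = 0
  · have : y ∉ annulus n := fun h => annulus_subset h hy
    simp [wt_eq_zero this]
  · rw [radialExt_eq _ hy, radialExt_eq _ hy, norm_mul, Real.norm_of_nonneg (wt_nonneg y),
      mul_comm (A * B), Real.norm_eq_abs, abs_mul]
    exact mul_le_mul_of_nonneg_left (mul_le_mul (hf _) (hg _) (abs_nonneg _)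
      ((abs_nonneg _).trans (hf (toSph y)))) (wt_nonneg y)

/-! ### Spherical harmonics: eigenfunctions, orthogonality, completeness -/

/-- Restriction of functions to the sphere. -/
def toSphere (n : ℕ) : (Amb n → ℝ) →ₗ[ℝ] (Sph n → ℝ) :=
  LinearMap.funLeft ℝ ℝ (fun x : Sph n => (x : Amb n))

/-- Restrictions to the sphere of homogeneous polynomials of degree `k`. -/
def HPS (n k : ℕ) : Submodule ℝ (Sph n → ℝ) := (HP n k).map (toSphere n)

instance finiteDimensional_HPS (k : ℕ) : FiniteDimensional ℝ (HPS n k) :=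
  inferInstanceAs (FiniteDimensional ℝ ((HP n k).map (toSphere n)))

theorem mem_HPS_iff {k : ℕ} {f : Sph n → ℝ} :
    f ∈ HPS n k ↔ ∃ p ∈ HP n k, f = fun x : Sph n => p x := by
  constructor
  · rintro ⟨p, hp, rfl⟩
    exact ⟨p, hp, rfl⟩
  · rintro ⟨p, hp, rfl⟩
    exact ⟨p, hp, rfl⟩

theorem isSmooth_of_mem_HPS {k : ℕ} {f : Sph n → ℝ} (hf : f ∈ HPS n k) : IsSmooth f := by
  obtain ⟨p, hp, rfl⟩ := mem_HPS_iff.mp hf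
  exact isSmooth_of_mem_HP hp

/-- Restrictions to the sphere of homogeneous polynomials of degree `k - 2`. -/
def lowerHPS (n : ℕ) : ℕ → Submodule ℝ (Sph n → ℝ)
  | 0 => ⊥
  | 1 => ⊥
  | k + 2 => HPS n k

/-- Multiplication by `‖y‖ ^ 2` raises the degree by two and is invisible on the sphere. -/
theorem lowerHPS_le (k : ℕ) : lowerHPS n k ≤ HPS n k := by
  match k with
  | 0 => exact bot_le
  | 1 => exact bot_le
  | k + 2 =>
    intro f hf
    obtain ⟨p, hp, rfl⟩ := mem_HPS_iff.mp hf
    exact mem_HPS_iff.mpr ⟨_, normSq_mul_mem_HP hp, by ext x; simp⟩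

instance finiteDimensional_lowerHPS (k : ℕ) : FiniteDimensional ℝ (lowerHPS n k) :=
  Submodule.finiteDimensional_of_le (lowerHPS_le k)

/-- The eigenvalues of the spherical Laplacian, up to sign. -/
def eig (n k : ℕ) : ℝ := k * (k + n - 1)

/-- By `sphLaplacian_HP` the sum is the restriction of the Euclidean Laplacian, which has degree `k
- 2` and vanishes when `k < 2`. -/
theorem sphLaplacian_add_mem {k : ℕ} {f : Sph n → ℝ} (hf : f ∈ HPS n k) :
    sphLaplacian f + eig n k • f ∈ lowerHPS n k := by
  obtain ⟨p, hp, rfl⟩ := mem_HPS_iff.mp hf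
  have h : sphLaplacian (fun x : Sph n => p x) + eig n k • (fun x : Sph n => p x) =
      fun x : Sph n => coordLaplacian p x := by
    ext x
    simp [sphLaplacian_HP hp, eig]
  rw [h]
  match k with
  | 0 =>
    rw [coordLaplacian_eq_zero (by norm_num) hp]
    exact zero_mem _
  | 1 =>
    rw [coordLaplacian_eq_zero (by norm_num) hp]
    exact zero_mem _
  | k + 2 => exact mem_HPS_iff.mpr ⟨_, coordLaplacian_mem_HP hp, rfl⟩

theorem sphLaplacian_mem_HPS {k : ℕ} {f : Sph n → ℝ} (hf : f ∈ HPS n k) :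
    sphLaplacian f ∈ HPS n k := by
  have h := sub_mem (lowerHPS_le k (sphLaplacian_add_mem hf)) (Submodule.smul_mem _ (eig n k) hf)
  simpa using h

theorem sphLaplacian_mem_lowerHPS {k : ℕ} {f : Sph n → ℝ} (hf : f ∈ lowerHPS n k) :
    sphLaplacian f ∈ lowerHPS n k := by
  match k with
  | 0 =>
    have h := sphLaplacian_add_mem (lowerHPS_le 0 hf)
    have hf' : f = 0 := hf
    rw [hf', smul_zero, add_zero] at h
    rwa [hf']
  | 1 =>
    have h := sphLaplacian_add_mem (lowerHPS_le 1 hf)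
    have hf' : f = 0 := hf
    rw [hf', smul_zero, add_zero] at h
    rwa [hf']
  | k + 2 => exact sphLaplacian_mem_HPS hf

/-- Riesz representation in finite dimension: definiteness makes the map from `Q` to its dual
injective, hence surjective. -/
theorem exists_pair_representative (Q : Submodule ℝ (Sph n → ℝ)) [FiniteDimensional ℝ Q]
    (hQ : ∀ f ∈ Q, Continuous f) {f : Sph n → ℝ} (hf : Continuous f) :
    ∃ q ∈ Q, ∀ g ∈ Q, pair q g = pair f g := by
  let B : Q →ₗ[ℝ] Q →ₗ[ℝ] ℝ := LinearMap.mk₂ ℝ (fun a b => pair (a : Sph n → ℝ) b)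
    (fun a b c => pair_add_left (hQ _ a.2) (hQ _ b.2) (hQ _ c.2))
    (fun c a b => pair_smul_left c _ _)
    (fun a b c => pair_add_right (hQ _ b.2) (hQ _ c.2) (hQ _ a.2))
    (fun c a b => pair_smul_right c _ _)
  let l : Q →ₗ[ℝ] ℝ :=
    { toFun := fun g => pair f g
      map_add' := fun a b => pair_add_right (hQ _ a.2) (hQ _ b.2) hf
      map_smul' := fun c a => pair_smul_right c _ _ }
  have hinj : Function.Injective B := by
    rw [← LinearMap.ker_eq_bot, LinearMap.ker_eq_bot']
    intro a ha
    have h1 : pair (a : Sph n → ℝ) a = 0 := congrArg (fun L : Q →ₗ[ℝ] ℝ => L a) ha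
    exact Subtype.ext (pair_self_pos (hQ _ a.2) h1)
  have hsurj : Function.Surjective B :=
    (LinearMap.injective_iff_surjective_of_finrank_eq_finrank
      (Subspace.dual_finrank_eq (K := ℝ) (V := Q)).symm).mp hinj
  obtain ⟨q, hq⟩ := hsurj l
  exact ⟨q, q.2, fun g hg => congrArg (fun L : Q →ₗ[ℝ] ℝ => L ⟨g, hg⟩) hq⟩

theorem continuous_of_mem_HPS {k : ℕ} {f : Sph n → ℝ} (hf : f ∈ HPS n k) : Continuous f :=
  (isSmooth_of_mem_HPS hf).continuous

theorem continuous_of_mem_lowerHPS {k : ℕ} {f : Sph n → ℝ} (hf : f ∈ lowerHPS n k) :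
    Continuous f := continuous_of_mem_HPS (lowerHPS_le k hf)

/-- Spherical harmonics of degree `k`. -/
def harmonics (n k : ℕ) : Submodule ℝ (Sph n → ℝ) where
  carrier := {f | f ∈ HPS n k ∧ ∀ g ∈ lowerHPS n k, pair f g = 0}
  add_mem' := by
    rintro f g ⟨hf, hf'⟩ ⟨hg, hg'⟩
    refine ⟨add_mem hf hg, fun h hh => ?_⟩
    rw [pair_add_left (continuous_of_mem_HPS hf) (continuous_of_mem_HPS hg)
      (continuous_of_mem_lowerHPS hh), hf' h hh, hg' h hh, add_zero]
  zero_mem' := ⟨zero_mem _, fun _ _ => pair_zero_left _⟩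
  smul_mem' := by
    rintro c f ⟨hf, hf'⟩
    refine ⟨Submodule.smul_mem _ _ hf, fun h hh => ?_⟩
    rw [pair_smul_left, hf' h hh, mul_zero]

theorem harmonics_le (k : ℕ) : harmonics n k ≤ HPS n k := fun _ hf => hf.1

instance finiteDimensional_harmonics (k : ℕ) : FiniteDimensional ℝ (harmonics n k) :=
  Submodule.finiteDimensional_of_le (harmonics_le k)

theorem isSmooth_of_mem_harmonics {k : ℕ} {f : Sph n → ℝ} (hf : f ∈ harmonics n k) :
    IsSmooth f := isSmooth_of_mem_HPS hf.1

theorem continuous_of_mem_harmonics {k : ℕ} {f : Sph n → ℝ} (hf : f ∈ harmonics n k) :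
    Continuous f := continuous_of_mem_HPS hf.1

/-- Spherical harmonics are eigenfunctions of the spherical Laplacian. -/
theorem sphLaplacian_harmonics {k : ℕ} {f : Sph n → ℝ} (hf : f ∈ harmonics n k) :
    sphLaplacian f = -eig n k • f := by
  have hr := sphLaplacian_add_mem hf.1
  set r := sphLaplacian f + eig n k • f with hrdef
  have hrs := isSmooth_of_mem_HPS (lowerHPS_le k hr)
  have hfs := isSmooth_of_mem_harmonics hf
  -- The defect `r` lies in the lower space, which `sphLaplacian` preserves. Moving the Laplacian
  -- from `f` to `r` leaves only pairings of `f` with the lower space, all zero.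
  have h0 : pair r r = 0 := by
    calc pair r r = pair (sphLaplacian f) r + eig n k * pair f r := by
          conv_lhs => rw [hrdef]
          rw [pair_add_left hfs.sphLaplacian.continuous (hfs.continuous.const_smul _)
            hrs.continuous, pair_smul_left]
      _ = pair f (sphLaplacian r) + eig n k * pair f r := by
          rw [pair_sphLaplacian_comm hfs hrs]
      _ = 0 := by
          rw [hf.2 _ hr, hf.2 _ (sphLaplacian_mem_lowerHPS hr)]
          ring
  have h1 := pair_self_pos hrs.continuous h0
  rw [neg_smul]
  exact eq_neg_of_add_eq_zero_left h1

theorem eig_nonneg (n k : ℕ) : 0 ≤ eig n k := by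
  rcases Nat.eq_zero_or_pos k with rfl | hk
  · simp [eig]
  · have : (1:ℝ) ≤ k := by exact_mod_cast hk
    have : (0:ℝ) ≤ n := by positivity
    exact mul_nonneg (by linarith) (by linarith)

/-- The sequence is strictly increasing once `n ≥ 1`. For `n = 0` degrees `0` and `1` share the
eigenvalue zero. -/
theorem eig_ne {n j k : ℕ} (hn : 1 ≤ n) (hjk : j ≠ k) : eig n j ≠ eig n k := by
  have hn' : (1:ℝ) ≤ n := by exact_mod_cast hn
  have key : ∀ a b : ℕ, a < b → eig n a < eig n b := by
    intro a b hab
    have h1 : (a:ℝ) + 1 ≤ b := by exact_mod_cast hab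
    have h0 : (0:ℝ) ≤ a := by positivity
    simp only [eig]
    nlinarith [mul_nonneg h0 (sub_nonneg.mpr hn')]
  rcases lt_or_gt_of_ne hjk with h | h
  · exact (key _ _ h).ne
  · exact (key _ _ h).ne'

theorem pair_harmonics_eq_zero {j k : ℕ} (hn : 1 ≤ n) (hjk : j ≠ k) {f g : Sph n → ℝ}
    (hf : f ∈ harmonics n j) (hg : g ∈ harmonics n k) : pair f g = 0 := by
  have h := pair_sphLaplacian_comm (isSmooth_of_mem_harmonics hf) (isSmooth_of_mem_harmonics hg)
  rw [sphLaplacian_harmonics hf, sphLaplacian_harmonics hg, pair_smul_left, pair_smul_right] at h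
  have h2 : (eig n j - eig n k) * pair f g = 0 := by linarith
  exact (mul_eq_zero.mp h2).resolve_left (sub_ne_zero.mpr (eig_ne hn hjk))

/-- Subtracting from a degree `k` polynomial its projection to the lower space leaves a harmonic,
and the projection itself is covered by induction on the degree. -/
theorem pair_HPS_eq_zero {h : Sph n → ℝ} (hh : Continuous h)
    (h0 : ∀ k, ∀ Y ∈ harmonics n k, pair h Y = 0) (k : ℕ) : ∀ f ∈ HPS n k, pair h f = 0 := by
  induction k using Nat.strong_induction_on with
  | _ k ih =>
    intro f hf
    have hfc := continuous_of_mem_HPS hf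
    obtain ⟨g, hg, hg'⟩ := exists_pair_representative (lowerHPS n k)
      (fun _ => continuous_of_mem_lowerHPS) hfc
    have hgc := continuous_of_mem_lowerHPS hg
    have h1 : f - g ∈ harmonics n k := by
      refine ⟨sub_mem hf (lowerHPS_le k hg), fun u hu => ?_⟩
      rw [pair_sub_left hfc hgc (continuous_of_mem_lowerHPS hu), hg' u hu, sub_self]
    have h2 : pair h g = 0 := by
      match k, hg with
      | 0, hg => rw [show g = 0 from hg, pair_zero_right]
      | 1, hg => rw [show g = 0 from hg, pair_zero_right]
      | k + 2, hg => exact ih k (by omega) g hg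
    have h3 := h0 k _ h1
    rw [pair_sub_right hfc hgc hh, h2, sub_zero] at h3
    exact h3

/-- The coordinate functions on the sphere. -/
def coordFn (i : Fin (n + 1)) : C(Sph n, ℝ) :=
  ⟨fun x => (x : Amb n) i, (contDiff_coord i).continuous.comp continuous_subtype_val⟩

theorem exists_mem_HPS_of_mem_closure {a : C(Sph n, ℝ)}
    (ha : a ∈ Submonoid.closure (range (coordFn (n := n)))) : ∃ k, ∃ p ∈ HP n k,
      (a : Sph n → ℝ) = fun x : Sph n => p x := by
  induction ha using Submonoid.closure_induction with
  | mem a ha =>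
    obtain ⟨i, rfl⟩ := ha
    refine ⟨1, _, coordMul_mem i (k := 0) (Submodule.mem_span_singleton_self _), ?_⟩
    ext x
    simp [coordFn]
  | one => exact ⟨0, _, Submodule.mem_span_singleton_self _, rfl⟩
  | mul a b _ _ ha hb =>
    obtain ⟨j, p, hp, hp'⟩ := ha
    obtain ⟨k, q, hq, hq'⟩ := hb
    refine ⟨j + k, _, mul_mem_HP hp hq, ?_⟩
    rw [ContinuousMap.coe_mul, hp', hq']
    rfl

/-- The spherical harmonics are complete. -/
theorem eq_zero_of_pair_harmonics {h : Sph n → ℝ} (hh : Continuous h)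
    (h0 : ∀ k, ∀ Y ∈ harmonics n k, pair h Y = 0) : h = 0 := by
  have hS : ∀ a ∈ Algebra.adjoin ℝ (range (coordFn (n := n))), pair h a = 0 := by
    intro a ha
    rw [← Subalgebra.mem_toSubmodule, Algebra.adjoin_eq_span] at ha
    induction ha using Submodule.span_induction with
    | mem a ha =>
      obtain ⟨k, p, hp, hp'⟩ := exists_mem_HPS_of_mem_closure ha
      exact pair_HPS_eq_zero hh h0 k _ (mem_HPS_iff.mpr ⟨p, hp, hp'⟩)
    | zero => exact pair_zero_right h
    | add a b _ _ ha hb =>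
      rw [ContinuousMap.coe_add, pair_add_right a.continuous b.continuous hh, ha, hb, add_zero]
    | smul c a _ ha =>
      rw [ContinuousMap.coe_smul, pair_smul_right, ha, mul_zero]
  have hsep : (Algebra.adjoin ℝ (range (coordFn (n := n)))).SeparatesPoints := by
    intro x y hxy
    obtain ⟨i, hi⟩ : ∃ i, (x : Amb n) i ≠ (y : Amb n) i := by
      by_contra! hcon
      exact hxy (Subtype.ext (PiLp.ext hcon))
    exact ⟨_, ⟨coordFn i, Algebra.subset_adjoin (mem_range_self i), rfl⟩, hi⟩
  -- Stone–Weierstrass: polynomials are dense, and all of them pair to zero with `h`, so `pair h h =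
  -- pair h (h - a)` is arbitrarily small.
  have htop := ContinuousMap.subalgebra_topologicalClosure_eq_top_of_separatesPoints _ hsep
  set H : C(Sph n, ℝ) := ⟨h, hh⟩ with hH
  have hmem : H ∈ (Algebra.adjoin ℝ (range (coordFn (n := n)))).topologicalClosure := by
    rw [htop]; trivial
  have hcl : H ∈ closure ((Algebra.adjoin ℝ (range (coordFn (n := n)))) : Set C(Sph n, ℝ)) := hmem
  apply pair_self_pos hh
  have hle : ∀ ε > 0, pair h h ≤ ε * (‖H‖ * wtMass n) := by
    intro ε hε
    obtain ⟨a, ha, hd⟩ := Metric.mem_closure_iff.mp hcl ε hε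
    have h1 : pair h h = pair h (h - a) := by
      rw [pair_sub_right hh a.continuous hh, hS a ha, sub_zero]
    rw [h1]
    refine (le_abs_self _).trans ((abs_pair_le (A := ‖H‖) (B := ε) (fun x => H.norm_coe_le_norm x)
      fun x => ?_).trans (le_of_eq (by ring)))
    exact ((H - a).norm_coe_le_norm x).trans (by rw [← dist_eq_norm]; exact hd.le)
  refine le_antisymm (le_of_forall_pos_le_add fun ε hε => ?_) (pair_self_nonneg h)
  have hC : 0 ≤ ‖H‖ * wtMass n := mul_nonneg (norm_nonneg _) wtMass_nonneg
  refine (hle (ε / (‖H‖ * wtMass n + 1)) (by positivity)).trans ?_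
  rw [zero_add, div_mul_eq_mul_div, div_le_iff₀ (by positivity)]
  nlinarith

/-! ### Harmonic projections, their rapid decay, and the expansion of smooth functions -/

theorem IsSmooth.sub {f g : Sph n → ℝ} (hf : IsSmooth f) (hg : IsSmooth g) : IsSmooth (f - g) :=
  ContMDiff.sub hf hg

theorem exists_harmProj (k : ℕ) {f : Sph n → ℝ} (hf : Continuous f) :
    ∃ q ∈ harmonics n k, ∀ g ∈ harmonics n k, pair q g = pair f g :=
  exists_pair_representative _ (fun _ => continuous_of_mem_harmonics) hf

/-- The projection of a continuous function to the spherical harmonics of degree `k`. -/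
def harmProj (k : ℕ) (f : Sph n → ℝ) : Sph n → ℝ :=
  open scoped Classical in
  if hf : Continuous f then (exists_harmProj k hf).choose else 0

theorem harmProj_mem (k : ℕ) (f : Sph n → ℝ) : harmProj k f ∈ harmonics n k := by
  unfold harmProj
  split_ifs with hf
  · exact (exists_harmProj k hf).choose_spec.1
  · exact zero_mem _

theorem pair_harmProj {k : ℕ} {f g : Sph n → ℝ} (hf : Continuous f) (hg : g ∈ harmonics n k) :
    pair (harmProj k f) g = pair f g := by
  rw [harmProj, dif_pos hf]
  exact (exists_harmProj k hf).choose_spec.2 g hg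

theorem isSmooth_harmProj (k : ℕ) (f : Sph n → ℝ) : IsSmooth (harmProj k f) :=
  isSmooth_of_mem_harmonics (harmProj_mem k f)

theorem continuous_harmProj (k : ℕ) (f : Sph n → ℝ) : Continuous (harmProj k f) :=
  (isSmooth_harmProj k f).continuous

theorem harmProj_unique {k : ℕ} {f q : Sph n → ℝ} (hf : Continuous f) (hq : q ∈ harmonics n k)
    (h : ∀ g ∈ harmonics n k, pair q g = pair f g) : harmProj k f = q := by
  have hd := sub_mem (harmProj_mem k f) hq
  have := pair_self_pos (continuous_of_mem_harmonics hd) (by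
    rw [pair_sub_left (continuous_harmProj k f) (continuous_of_mem_harmonics hq)
      (continuous_of_mem_harmonics hd), pair_harmProj hf hd, h _ hd, sub_self])
  exact sub_eq_zero.mp this

/-- Symmetry moves `1 - Δ` onto the harmonic, where it is multiplication by `1 + eig n k`. Iterated,
this trades smoothness of `f` for decay in `k`. -/
theorem harmProj_sub_sphLaplacian (k : ℕ) {f : Sph n → ℝ} (hf : IsSmooth f) :
    harmProj k (f - sphLaplacian f) = (1 + eig n k) • harmProj k f := by
  refine harmProj_unique (hf.sub hf.sphLaplacian).continuous
    (Submodule.smul_mem _ _ (harmProj_mem k f)) fun g hg => ?_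
  have hgs := isSmooth_of_mem_harmonics hg
  rw [pair_smul_left, pair_harmProj hf.continuous hg, pair_sub_left hf.continuous
    hf.sphLaplacian.continuous hgs.continuous, pair_sphLaplacian_comm hf hgs,
    sphLaplacian_harmonics hg, pair_smul_right]
  ring

theorem isSmooth_iterate {f : Sph n → ℝ} (hf : IsSmooth f) (m : ℕ) :
    IsSmooth ((fun f : Sph n → ℝ => f - sphLaplacian f)^[m] f) := by
  induction m with
  | zero => exact hf
  | succ m ih =>
    rw [Function.iterate_succ_apply']
    exact ih.sub ih.sphLaplacian

theorem harmProj_iterate (k : ℕ) {f : Sph n → ℝ} (hf : IsSmooth f) (m : ℕ) :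
    harmProj k ((fun f : Sph n → ℝ => f - sphLaplacian f)^[m] f) =
      (1 + eig n k) ^ m • harmProj k f := by
  induction m with
  | zero => simp
  | succ m ih =>
    rw [Function.iterate_succ_apply', harmProj_sub_sphLaplacian k (isSmooth_iterate hf m), ih,
      smul_smul, pow_succ']

theorem exists_bound_continuous {f : Sph n → ℝ} (hf : Continuous f) :
    ∃ M : ℝ, 0 ≤ M ∧ ∀ x, |f x| ≤ M := by
  obtain ⟨M, hM⟩ := isCompact_univ.exists_bound_of_continuousOn hf.continuousOn
  exact ⟨M, (norm_nonneg _).trans (hM (toSph 0) (mem_univ _)), fun x => hM x (mem_univ x)⟩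

/-- For `Y = harmProj k f` one has `pair Y Y = pair f Y`. At a maximum point of `|Y|` the Nikolskii
bound gives `Y² ≤ C (k + 1)^(2 (n + 1)) pair f Y`, while the pairing is at most `M |Y|` times the
mass; divide by `|Y|`. -/
theorem exists_abs_harmProj_le (n : ℕ) : ∃ C : ℝ, 0 ≤ C ∧ ∀ (k : ℕ) (f : Sph n → ℝ),
    Continuous f → ∀ M : ℝ, (∀ x, |f x| ≤ M) → ∀ x,
      |harmProj k f x| ≤ C * ((k : ℝ) + 1) ^ (2 * (n + 1)) * M := by
  obtain ⟨C, hC0, hC⟩ := exists_sq_le_pair_HP n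
  refine ⟨C * wtMass n, mul_nonneg hC0 wtMass_nonneg, fun k f hf M hM x => ?_⟩
  set Y := harmProj k f with hY
  have hYm : Y ∈ harmonics n k := harmProj_mem k f
  obtain ⟨p, hp, hpY⟩ := mem_HPS_iff.mp hYm.1
  have hYc := continuous_of_mem_harmonics hYm
  obtain ⟨x₀, -, hx₀⟩ := isCompact_univ.exists_isMaxOn (univ_nonempty (α := Sph n))
    (hYc.abs.continuousOn)
  have hmax : ∀ x, |Y x| ≤ |Y x₀| := fun x => hx₀ (mem_univ x)
  refine (hmax x).trans ?_
  have h1 := hC k p hp x₀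
  rw [← hpY, show p x₀ = Y x₀ from (congrFun hpY x₀).symm, pair_harmProj hf hYm] at h1
  have h2 := abs_pair_le hM hmax
  have hM0 : 0 ≤ M := (abs_nonneg _).trans (hM x₀)
  rcases (abs_nonneg (Y x₀)).eq_or_lt with h0 | h0
  · rw [← h0]
    have := wtMass_nonneg (n := n)
    positivity
  · refine le_of_mul_le_mul_right ?_ h0
    rw [← sq, sq_abs]
    refine h1.trans ?_
    calc C * ((k : ℝ) + 1) ^ (2 * (n + 1)) * pair f Y
        ≤ C * ((k : ℝ) + 1) ^ (2 * (n + 1)) * (M * |Y x₀| * wtMass n) := by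
          gcongr
          exact (le_abs_self _).trans h2
      _ = _ := by ring

theorem sq_le_eig {n : ℕ} (hn : 1 ≤ n) (k : ℕ) : ((k : ℝ) + 1) ^ 2 ≤ 2 * (1 + eig n k) := by
  have hn' : (1:ℝ) ≤ n := by exact_mod_cast hn
  have h0 : (0:ℝ) ≤ k := by positivity
  simp only [eig]
  nlinarith [mul_nonneg h0 (sub_nonneg.mpr hn'), sq_nonneg ((k:ℝ) - 1)]

/-- The projections of a smooth function decay rapidly. -/
theorem exists_abs_harmProj_mul_le (hn : 1 ≤ n) {f : Sph n → ℝ} (hf : IsSmooth f) (m : ℕ) :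
    ∃ C : ℝ, 0 ≤ C ∧ ∀ k x, |harmProj k f x| * ((k : ℝ) + 1) ^ m ≤ C := by
  obtain ⟨C, hC0, hC⟩ := exists_abs_harmProj_le n
  -- The extra `2 (n + 1)` powers pay for the loss in `exists_abs_harmProj_le`.
  set N := m + 2 * (n + 1)
  have hg := isSmooth_iterate hf N
  obtain ⟨M, hM0, hM⟩ := exists_bound_continuous hg.continuous
  refine ⟨2 ^ N * (C * M), by positivity, fun k x => ?_⟩
  have h1 := hC k _ hg.continuous M hM x
  have he := eig_nonneg n k
  rw [harmProj_iterate k hf, Pi.smul_apply, smul_eq_mul, abs_mul,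
    abs_of_nonneg (by positivity)] at h1
  have hk1 : (1:ℝ) ≤ (k : ℝ) + 1 := by linarith [(Nat.cast_nonneg k : (0:ℝ) ≤ k)]
  have hpos : (0:ℝ) < ((k : ℝ) + 1) ^ (2 * (n + 1)) := by positivity
  refine le_of_mul_le_mul_right ?_ hpos
  calc |harmProj k f x| * ((k : ℝ) + 1) ^ m * ((k : ℝ) + 1) ^ (2 * (n + 1))
      = ((k : ℝ) + 1) ^ N * |harmProj k f x| := by simp only [N, pow_add]; ring
    _ ≤ (((k : ℝ) + 1) ^ 2) ^ N * |harmProj k f x| := by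
        gcongr
        exact le_self_pow₀ hk1 (by norm_num)
    _ ≤ (2 * (1 + eig n k)) ^ N * |harmProj k f x| := by
        gcongr
        exact sq_le_eig hn k
    _ = 2 ^ N * ((1 + eig n k) ^ N * |harmProj k f x|) := by rw [mul_pow]; ring
    _ ≤ 2 ^ N * (C * ((k : ℝ) + 1) ^ (2 * (n + 1)) * M) := by gcongr
    _ = _ := by ring

theorem summable_inv_sq : Summable fun k : ℕ => (((k : ℝ) + 1) ^ 2)⁻¹ := by
  have := (summable_nat_add_iff 1).mpr (Real.summable_nat_pow_inv (p := 2).mpr (by norm_num))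
  simpa using this

/-- All derivatives of the projections decay rapidly. -/
theorem exists_norm_iteratedFDeriv_harmProj_le (hn : 1 ≤ n) {f : Sph n → ℝ} (hf : IsSmooth f)
    {K : Set (Amb n)} (hK : IsCompact K) (hK0 : K ⊆ {0}ᶜ) (j m : ℕ) :
    ∃ C : ℝ, 0 ≤ C ∧ ∀ k, ∀ y ∈ K,
      ‖iteratedFDeriv ℝ j (radialExt (harmProj k f)) y‖ * ((k : ℝ) + 1) ^ m ≤ C := by
  obtain ⟨C, hC1, hC⟩ := exists_norm_iteratedFDeriv_radialExt_HP_le hK hK0 j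
  obtain ⟨D, hD0, hD⟩ := exists_abs_harmProj_mul_le hn hf (m + 2 * j)
  refine ⟨C * D, by positivity, fun k y hy => ?_⟩
  obtain ⟨p, hp, hpY⟩ := mem_HPS_iff.mp (harmProj_mem k f).1
  have hpos : (0:ℝ) < ((k : ℝ) + 1) ^ (m + 2 * j) := by positivity
  have h1 := hC k p hp (D / ((k : ℝ) + 1) ^ (m + 2 * j)) (fun x => by
    rw [le_div_iff₀ hpos, ← congrFun hpY x]
    exact hD k x) y hy
  rw [hpY]
  calc _ ≤ C * ((k : ℝ) + 1) ^ (2 * j) * (D / ((k : ℝ) + 1) ^ (m + 2 * j)) * ((k : ℝ) + 1) ^ m := by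
        gcongr
    _ = C * D := by
        rw [pow_add]
        field_simp

/-- A smooth function is the sum of its projections. -/
theorem hasSum_harmProj (hn : 1 ≤ n) {f : Sph n → ℝ} (hf : IsSmooth f) (x : Sph n) :
    HasSum (fun k => harmProj k f x) (f x) := by
  obtain ⟨C, hC0, hC⟩ := exists_abs_harmProj_mul_le hn hf 2
  have hle : ∀ k x, |harmProj k f x| ≤ C * (((k : ℝ) + 1) ^ 2)⁻¹ := by
    intro k x
    rw [← div_eq_mul_inv, le_div_iff₀ (by positivity)]
    exact hC k x
  have hsum : Summable fun k : ℕ => C * (((k : ℝ) + 1) ^ 2)⁻¹ := summable_inv_sq.mul_left C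
  have hs : ∀ x, Summable fun k => harmProj k f x := fun x =>
    Summable.of_norm_bounded hsum fun k => hle k x
  set g : Sph n → ℝ := fun x => ∑' k, harmProj k f x with hg
  have hgc : Continuous g := continuous_tsum (fun k => continuous_harmProj k f) hsum
    fun k x => hle k x
  -- Completeness reduces the claim to pairings with harmonics. There the series may be integrated
  -- termwise, and orthogonality leaves one term, which pairs like `f`.
  have hzero : f - g = 0 := by
    refine eq_zero_of_pair_harmonics (hf.continuous.sub hgc) fun j Y hY => ?_
    have hYc := continuous_of_mem_harmonics hY
    obtain ⟨B, hB0, hB⟩ := exists_bound_continuous hYc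
    have hint : HasSum (fun k => pair (harmProj k f) Y) (pair g Y) := by
      refine hasSum_integral_of_dominated_convergence
        (fun k (y : Amb n) => C * (((k : ℝ) + 1) ^ 2)⁻¹ * B * wt y) ?_ ?_ ?_ ?_ ?_
      · exact fun k => (integrable_pair (continuous_harmProj k f) hYc).aestronglyMeasurable
      · intro k
        refine Eventually.of_forall fun y => ?_
        by_cases hy : y = 0
        · have : y ∉ annulus n := fun h => annulus_subset h hy
          simp [wt_eq_zero this]
        · rw [radialExt_eq _ hy, radialExt_eq _ hy, norm_mul, Real.norm_of_nonneg (wt_nonneg y),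
            mul_comm _ (wt y), Real.norm_eq_abs, abs_mul]
          exact mul_le_mul_of_nonneg_left (mul_le_mul (hle k _) (hB _) (abs_nonneg _)
            (by positivity)) (wt_nonneg y)
      · exact Eventually.of_forall fun y => (hsum.mul_right B).mul_right _
      · simp only [tsum_mul_right]
        exact integrable_wt.const_mul _
      · refine Eventually.of_forall fun y => ?_
        by_cases hy : y = 0
        · have : y ∉ annulus n := fun h => annulus_subset h hy
          simp [wt_eq_zero this]
        · simp only [radialExt_eq _ hy]
          exact ((hs _).hasSum.mul_right _).mul_left _
    have hsingle : HasSum (fun k => pair (harmProj k f) Y) (pair (harmProj j f) Y) :=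
      hasSum_single j fun k hk => pair_harmonics_eq_zero hn hk (harmProj_mem k f) hY
    rw [pair_sub_left hf.continuous hgc hYc, hint.unique hsingle,
      pair_harmProj hf.continuous hY, sub_self]
  have : f x = g x := by
    have := congrFun hzero x
    simpa [sub_eq_zero] using this
  rw [this]
  exact (hs x).hasSum

/-! ### Termwise differentiation and multiplier series -/

/-- Induction on the order: the summable bound of order `j + 1` permits differentiating the series
of `j`-th derivatives, and the currying isometry commutes with the sum. Bounds are needed only on
`s`, since the extensions are smooth only away from the origin. -/
theorem iteratedFDeriv_tsum_of_isPreconnected {E : Type*} [NormedAddCommGroup E] [NormedSpace ℝ E]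
    {s : Set E} (hs : IsOpen s) (hpc : IsPreconnected s) {f : ℕ → E → ℝ}
    (hf : ∀ i, ContDiffOn ℝ ∞ (f i) s) {v : ℕ → ℕ → ℝ} (hv : ∀ j, Summable (v j))
    (hfv : ∀ j i, ∀ x ∈ s, ‖iteratedFDeriv ℝ j (f i) x‖ ≤ v j i) (j : ℕ) :
    ∀ x ∈ s, iteratedFDeriv ℝ j (fun y => ∑' i, f i y) x = ∑' i, iteratedFDeriv ℝ j (f i) x ∧
      DifferentiableAt ℝ (iteratedFDeriv ℝ j fun y => ∑' i, f i y) x := by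
  have hdiff : ∀ j, (∀ x ∈ s, iteratedFDeriv ℝ j (fun y => ∑' i, f i y) x =
      ∑' i, iteratedFDeriv ℝ j (f i) x) → ∀ x ∈ s,
      HasFDerivAt (iteratedFDeriv ℝ j fun y => ∑' i, f i y)
        (∑' i, fderiv ℝ (iteratedFDeriv ℝ j (f i)) x) x := by
    intro j hj x hx
    have h1 : HasFDerivAt (fun y => ∑' i, iteratedFDeriv ℝ j (f i) y)
        (∑' i, fderiv ℝ (iteratedFDeriv ℝ j (f i)) x) x := by
      refine hasFDerivAt_tsum_of_isPreconnected (hv (j + 1)) hs hpc (fun i y hy => ?_)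
        (fun i y hy => ?_) hx (Summable.of_norm_bounded (hv j) fun i => hfv j i x hx) hx
      · have h2 := (hf i).contDiffAt (hs.mem_nhds hy)
        exact (h2.differentiableAt_iteratedFDeriv
          (WithTop.coe_lt_coe.mpr (ENat.natCast_lt_top j))).hasFDerivAt
      · rw [fderiv_iteratedFDeriv, Function.comp_apply, LinearIsometryEquiv.norm_map]
        exact hfv (j + 1) i y hy
    refine h1.congr_of_eventuallyEq ?_
    filter_upwards [hs.mem_nhds hx] with z hz using hj z hz
  suffices h : ∀ x ∈ s, iteratedFDeriv ℝ j (fun y => ∑' i, f i y) x =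
      ∑' i, iteratedFDeriv ℝ j (f i) x from
    fun x hx => ⟨h x hx, (hdiff j h x hx).differentiableAt⟩
  induction j with
  | zero =>
    intro x _
    simp_rw [iteratedFDeriv_zero_eq_comp]
    exact (continuousMultilinearCurryFin0 ℝ E ℝ).symm.toContinuousLinearEquiv.map_tsum
  | succ j ih =>
    intro x hx
    simp_rw [iteratedFDeriv_succ_eq_comp_left, Function.comp_apply]
    rw [(hdiff j ih x hx).fderiv]
    exact (continuousMultilinearCurryLeftEquiv ℝ
      (fun _ : Fin (j + 1) => E) ℝ).symm.toContinuousLinearEquiv.map_tsum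

theorem contDiffOn_tsum_of_isPreconnected {E : Type*} [NormedAddCommGroup E] [NormedSpace ℝ E]
    {s : Set E} (hs : IsOpen s) (hpc : IsPreconnected s) {f : ℕ → E → ℝ}
    (hf : ∀ i, ContDiffOn ℝ ∞ (f i) s) {v : ℕ → ℕ → ℝ} (hv : ∀ j, Summable (v j))
    (hfv : ∀ j i, ∀ x ∈ s, ‖iteratedFDeriv ℝ j (f i) x‖ ≤ v j i) :
    ContDiffOn ℝ ∞ (fun y => ∑' i, f i y) s := by
  refine contDiffOn_of_differentiableOn fun m _ => ?_
  have h : DifferentiableOn ℝ (iteratedFDeriv ℝ m fun y => ∑' i, f i y) s := fun x hx =>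
    (iteratedFDeriv_tsum_of_isPreconnected hs hpc hf hv hfv m x hx).2.differentiableWithinAt
  exact h.congr fun x hx => iteratedFDerivWithin_of_isOpen m hs hx

/-- The series `∑ B_k Π_k g` of multiples of the projections of `g` to the spherical harmonics. -/
def harmSeries (B : ℕ → ℝ) (g : Sph n → ℝ) (x : Sph n) : ℝ := ∑' k, B k * harmProj k g x

/-- Sequences of at most polynomial growth. -/
def PolyGrowth (B : ℕ → ℝ) : Prop := ∃ (C : ℝ) (m : ℕ), ∀ k, |B k| ≤ C * ((k : ℝ) + 1) ^ m

theorem summable_of_mul_pow_le {a : ℕ → ℝ} {C : ℝ} (ha : ∀ k, 0 ≤ a k)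
    (h : ∀ k : ℕ, a k * ((k : ℝ) + 1) ^ 2 ≤ C) : Summable a := by
  refine Summable.of_nonneg_of_le ha (fun k => ?_) (summable_inv_sq.mul_left C)
  rw [← div_eq_mul_inv, le_div_iff₀ (by positivity)]
  exact h k

/-- Uniform bounds for the derivatives of the projections of a smooth function near the sphere. -/
theorem exists_harmProj_bounds (hn : 1 ≤ n) {g : Sph n → ℝ} (hg : IsSmooth g) :
    ∃ v : ℕ → ℕ → ℝ, (∀ j k, 0 ≤ v j k) ∧
      (∀ j m : ℕ, Summable fun k : ℕ => ((k : ℝ) + 1) ^ m * v j k) ∧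
      ∀ j k, ∀ y ∈ annulus n, ‖iteratedFDeriv ℝ j (radialExt (harmProj k g)) y‖ ≤ v j k := by
  have hbdd : ∀ j k, BddAbove (range fun y : annulus n =>
      ‖iteratedFDeriv ℝ j (radialExt (harmProj k g)) y‖) := by
    intro j k
    obtain ⟨C, hC0, hC⟩ := exists_norm_iteratedFDeriv_harmProj_le hn hg isCompact_annulus
      annulus_subset j 0
    refine ⟨C, ?_⟩
    rintro _ ⟨y, rfl⟩
    simpa using hC k y y.2
  -- Taking the exact supremum over the annulus gives a single sequence that beats every power `(k +
  -- 1) ^ m`; a constant chosen for one `m` would not.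
  refine ⟨fun j k => ⨆ y : annulus n, ‖iteratedFDeriv ℝ j (radialExt (harmProj k g)) y‖,
    fun j k => Real.iSup_nonneg fun _ => norm_nonneg _, fun j m => ?_,
    fun j k y hy => le_ciSup (hbdd j k) ⟨y, hy⟩⟩
  obtain ⟨C, hC0, hC⟩ := exists_norm_iteratedFDeriv_harmProj_le hn hg isCompact_annulus
    annulus_subset j (m + 2)
  refine summable_of_mul_pow_le (C := C)
    (fun k => mul_nonneg (by positivity) (Real.iSup_nonneg fun _ => norm_nonneg _)) fun k => ?_
  rw [mul_right_comm, ← pow_add, ← le_div_iff₀' (by positivity)]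
  refine Real.iSup_le (fun y => ?_) (by positivity)
  rw [le_div_iff₀ (by positivity)]
  exact hC k y y.2

theorem ball_subset_annulus (x : Sph n) : Metric.ball (x : Amb n) (1 / 16) ⊆ annulus n := by
  intro y hy
  rw [mem_ball_iff_norm] at hy
  have h1 := (abs_norm_sub_one_le x y).trans hy.le
  rw [abs_le] at h1
  exact ⟨by nlinarith [h1.1, h1.2], by nlinarith [h1.1, h1.2]⟩

theorem radialExt_harmSeries (B : ℕ → ℝ) (g : Sph n → ℝ) {y : Amb n} (hy : y ≠ 0) :
    radialExt (harmSeries B g) y = ∑' k, B k * radialExt (harmProj k g) y := by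
  simp only [radialExt_eq _ hy, harmSeries]

theorem isSmooth_of_contDiffAt {F : Amb n → ℝ} (hF : ∀ x : Sph n, ContDiffAt ℝ ∞ F x) :
    IsSmooth (fun x : Sph n => F x) := by
  intro x
  exact ContMDiffAt.comp (g := F) (f := fun x : Sph n => (x : Amb n)) x (hF x).contMDiffAt
    (contMDiff_coe_sphere x)

/-- Polynomial growth of the multipliers is absorbed by the decay of `v`, so all derivative series
converge uniformly on a ball of radius `1 / 16`, which lies inside the annulus. -/
theorem harmSeries_aux {B : ℕ → ℝ} (hB : PolyGrowth B) {v : ℕ → ℕ → ℝ} {g : Sph n → ℝ}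
    (hvs : ∀ j m : ℕ, Summable fun k : ℕ => ((k : ℝ) + 1) ^ m * v j k)
    (hv : ∀ j k, ∀ y ∈ annulus n, ‖iteratedFDeriv ℝ j (radialExt (harmProj k g)) y‖ ≤ v j k)
    (x : Sph n) :
    ContDiffAt ℝ ∞ (radialExt (harmSeries B g)) x ∧
    ∀ j, (Summable fun k => |B k| * v j k) ∧ iteratedFDeriv ℝ j (radialExt (harmSeries B g)) x =
      ∑' k, B k • iteratedFDeriv ℝ j (radialExt (harmProj k g)) x := by
  have hv0 : ∀ j k, 0 ≤ v j k := fun j k =>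
    (norm_nonneg _).trans (hv j k x (ball_subset_annulus x (Metric.mem_ball_self (by norm_num))))
  have hball : ∀ y ∈ Metric.ball (x : Amb n) (1 / 16), y ≠ 0 := fun y hy =>
    annulus_subset (ball_subset_annulus x hy)
  have hs : ∀ k, ContDiffOn ℝ ∞ (radialExt (harmProj k g)) {0}ᶜ := fun k =>
    (isSmooth_harmProj k g).contDiffOn_radialExt
  have hsum : ∀ j, Summable fun k => |B k| * v j k := by
    obtain ⟨C, m, hC⟩ := hB
    intro j
    refine Summable.of_nonneg_of_le (fun k => mul_nonneg (abs_nonneg _) (hv0 j k)) (fun k => ?_)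
      ((hvs j m).mul_left C)
    rw [← mul_assoc]
    exact mul_le_mul_of_nonneg_right (hC k) (hv0 j k)
  have hit : ∀ j k, ∀ y ∈ Metric.ball (x : Amb n) (1 / 16),
      iteratedFDeriv ℝ j (fun y => B k * radialExt (harmProj k g) y) y =
        B k • iteratedFDeriv ℝ j (radialExt (harmProj k g)) y := by
    intro j k y hy
    exact iteratedFDeriv_const_smul_apply (a := B k)
      (((hs k).contDiffAt (isOpen_punct.mem_nhds (hball y hy))).of_le
        (WithTop.coe_le_coe.mpr le_top))
  have hbound : ∀ j k, ∀ y ∈ Metric.ball (x : Amb n) (1 / 16),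
      ‖iteratedFDeriv ℝ j (fun y => B k * radialExt (harmProj k g) y) y‖ ≤ |B k| * v j k := by
    intro j k y hy
    rw [hit j k y hy, norm_smul, Real.norm_eq_abs]
    exact mul_le_mul_of_nonneg_left (hv j k y (ball_subset_annulus x hy)) (abs_nonneg _)
  have hsm : ∀ k, ContDiffOn ℝ ∞ (fun y => B k * radialExt (harmProj k g) y)
      (Metric.ball (x : Amb n) (1 / 16)) := fun k =>
    contDiffOn_const.mul ((hs k).mono fun y hy => hball y hy)
  have hxb : (x : Amb n) ∈ Metric.ball (x : Amb n) (1 / 16) := Metric.mem_ball_self (by norm_num)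
  have heq : radialExt (harmSeries B g) =ᶠ[𝓝 (x : Amb n)]
      fun y => ∑' k, B k * radialExt (harmProj k g) y := by
    filter_upwards [Metric.isOpen_ball.mem_nhds hxb] with y hy using
      radialExt_harmSeries B g (hball y hy)
  have hpc := (convex_ball (x : Amb n) (1 / 16)).isPreconnected
  refine ⟨?_, fun j => ⟨hsum j, ?_⟩⟩
  · exact ((contDiffOn_tsum_of_isPreconnected Metric.isOpen_ball hpc hsm hsum
      hbound).contDiffAt (Metric.isOpen_ball.mem_nhds hxb)).congr_of_eventuallyEq heq
  · rw [(heq.iteratedFDeriv ℝ j).eq_of_nhds, (iteratedFDeriv_tsum_of_isPreconnected Metric.isOpen_ball hpc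
      hsm hsum hbound j x hxb).1]
    exact tsum_congr fun k => hit j k x hxb

theorem isSmooth_harmSeries (hn : 1 ≤ n) {B : ℕ → ℝ} (hB : PolyGrowth B) {g : Sph n → ℝ}
    (hg : IsSmooth g) : IsSmooth (harmSeries B g) := by
  obtain ⟨v, -, hvs, hv⟩ := exists_harmProj_bounds hn hg
  have := isSmooth_of_contDiffAt (F := radialExt (harmSeries B g))
    fun x => (harmSeries_aux hB hvs hv x).1
  simpa using this

theorem seminormC_nonneg (j : ℕ) (f : Sph n → ℝ) : 0 ≤ seminormC j f :=
  Real.iSup_nonneg fun _ => norm_nonneg _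

theorem seminormC_harmSeries_le {B : ℕ → ℝ} (hB : PolyGrowth B) {v : ℕ → ℕ → ℝ} {g : Sph n → ℝ}
    (hvs : ∀ j m : ℕ, Summable fun k : ℕ => ((k : ℝ) + 1) ^ m * v j k)
    (hv : ∀ j k, ∀ y ∈ annulus n, ‖iteratedFDeriv ℝ j (radialExt (harmProj k g)) y‖ ≤ v j k)
    (j : ℕ) : seminormC j (harmSeries B g) ≤ ∑' k, |B k| * v j k := by
  refine ciSup_le fun x => ?_
  obtain ⟨hs, he⟩ := (harmSeries_aux hB hvs hv x).2 j
  rw [he]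
  refine tsum_of_norm_bounded hs.hasSum fun k => ?_
  rw [norm_smul, Real.norm_eq_abs]
  exact mul_le_mul_of_nonneg_left
    (hv j k x (ball_subset_annulus x (Metric.mem_ball_self (by norm_num)))) (abs_nonneg _)

/-- The constant depends on `g` and the exponent but not on the multipliers, so a bound on `B` that
is uniform in `k` transfers to the seminorm with the same dependence on `τ`. -/
theorem exists_seminormC_harmSeries_le (hn : 1 ≤ n) {g : Sph n → ℝ} (hg : IsSmooth g) (j m : ℕ) :
    ∃ D : ℝ, 0 ≤ D ∧ ∀ (B : ℕ → ℝ) (C : ℝ), (∀ k, |B k| ≤ C * ((k : ℝ) + 1) ^ m) →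
      seminormC j (harmSeries B g) ≤ C * D := by
  obtain ⟨v, hv0, hvs, hv⟩ := exists_harmProj_bounds hn hg
  refine ⟨∑' k : ℕ, ((k : ℝ) + 1) ^ m * v j k,
    tsum_nonneg fun k => mul_nonneg (by positivity) (hv0 j k), fun B C hC => ?_⟩
  refine (seminormC_harmSeries_le ⟨C, m, hC⟩ hvs hv j).trans ?_
  rw [← tsum_mul_left]
  have hle : ∀ k, |B k| * v j k ≤ C * (((k : ℝ) + 1) ^ m * v j k) := fun k => by
    rw [← mul_assoc]
    exact mul_le_mul_of_nonneg_right (hC k) (hv0 j k)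
  exact Summable.tsum_le_tsum hle (Summable.of_nonneg_of_le
    (fun k => mul_nonneg (abs_nonneg _) (hv0 j k)) hle ((hvs j m).mul_left C))
    ((hvs j m).mul_left C)

/-- Dominated convergence for series of spherical harmonics. -/
theorem tendsto_seminormC_harmSeries (hn : 1 ≤ n) {g : Sph n → ℝ} (hg : IsSmooth g) (j : ℕ)
    {l : Filter ℝ} {B : ℝ → ℕ → ℝ} {C : ℝ} {m : ℕ}
    (hC : ∀ᶠ τ in l, ∀ k, |B τ k| ≤ C * ((k : ℝ) + 1) ^ m)
    (h0 : ∀ k, Tendsto (fun τ => B τ k) l (𝓝 0)) :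
    Tendsto (fun τ => seminormC j (harmSeries (B τ) g)) l (𝓝 0) := by
  obtain ⟨v, hv0, hvs, hv⟩ := exists_harmProj_bounds hn hg
  have h1 : Tendsto (fun τ => ∑' k, |B τ k| * v j k) l (𝓝 (∑' _ : ℕ, (0 : ℝ))) := by
    refine tendsto_tsum_of_dominated_convergence (bound := fun k => C * (((k : ℝ) + 1) ^ m * v j k))
      ((hvs j m).mul_left C) (fun k => ?_) ?_
    · simpa using ((h0 k).abs).mul_const (v j k)
    · filter_upwards [hC] with τ hτ k
      rw [Real.norm_of_nonneg (mul_nonneg (abs_nonneg _) (hv0 j k)), ← mul_assoc]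
      exact mul_le_mul_of_nonneg_right (hτ k) (hv0 j k)
  rw [tsum_zero] at h1
  refine tendsto_of_tendsto_of_tendsto_of_le_of_le' tendsto_const_nhds h1
    (Eventually.of_forall fun τ => seminormC_nonneg _ _) ?_
  filter_upwards [hC] with τ hτ
  exact seminormC_harmSeries_le ⟨C, m, hτ⟩ hvs hv j

theorem summable_harmSeries (hn : 1 ≤ n) {B : ℕ → ℝ} (hB : PolyGrowth B) {g : Sph n → ℝ}
    (hg : IsSmooth g) (x : Sph n) : Summable fun k => B k * harmProj k g x := by
  obtain ⟨v, hv0, hvs, hv⟩ := exists_harmProj_bounds hn hg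
  have hs := ((harmSeries_aux hB hvs hv x).2 0).1
  refine Summable.of_norm_bounded hs fun k => ?_
  rw [norm_mul, Real.norm_eq_abs]
  have := hv 0 k x (ball_subset_annulus x (Metric.mem_ball_self (by norm_num)))
  rw [norm_iteratedFDeriv_zero, radialExt_coe] at this
  exact mul_le_mul_of_nonneg_left this (abs_nonneg _)

/-- Evaluate the termwise second derivative on pairs of basis vectors and use the eigenvalue
equation in every term. -/
theorem sphLaplacian_harmSeries (hn : 1 ≤ n) {B : ℕ → ℝ} (hB : PolyGrowth B) {g : Sph n → ℝ}
    (hg : IsSmooth g) (x : Sph n) :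
    sphLaplacian (harmSeries B g) x = harmSeries (fun k => -eig n k * B k) g x := by
  obtain ⟨v, hv0, hvs, hv⟩ := exists_harmProj_bounds hn hg
  obtain ⟨hs, he⟩ := (harmSeries_aux hB hvs hv x).2 2
  have hlap : ∀ F : Amb n → ℝ, Laplacian.laplacian F (x : Amb n) =
      ∑ i, iteratedFDeriv ℝ 2 F x ![bvec i, bvec i] := by
    intro F
    rw [InnerProductSpace.laplacian_eq_iteratedFDeriv_orthonormalBasis F
      (EuclideanSpace.basisFun (Fin (n + 1)) ℝ)]
    simp [bvec]
  have hsum : Summable fun k => B k • iteratedFDeriv ℝ 2 (radialExt (harmProj k g)) x := by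
    refine Summable.of_norm_bounded hs fun k => ?_
    rw [norm_smul, Real.norm_eq_abs]
    exact mul_le_mul_of_nonneg_left
      (hv 2 k x (ball_subset_annulus x (Metric.mem_ball_self (by norm_num)))) (abs_nonneg _)
  have happ : ∀ w, HasSum (fun k => B k * iteratedFDeriv ℝ 2 (radialExt (harmProj k g)) x w)
      (iteratedFDeriv ℝ 2 (radialExt (harmSeries B g)) x w) := by
    intro w
    rw [he]
    exact hsum.hasSum.mapL (ContinuousMultilinearMap.apply ℝ (fun _ : Fin 2 => Amb n) ℝ w)
  rw [sphLaplacian, hlap, harmSeries]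
  refine (HasSum.tsum_eq ?_).symm
  refine (hasSum_sum fun i (_ : i ∈ Finset.univ) => happ ![bvec i, bvec i]).congr_fun ?_
  intro k
  rw [← Finset.mul_sum, ← hlap]
  have := congrFun (sphLaplacian_harmonics (harmProj_mem k g)) x
  rw [sphLaplacian] at this
  rw [this]
  simp
  ring

/-! ### Time-dependent multipliers and joint smoothness -/

/-- Families of functions on `(0,∞)` with polynomial growth in the index, uniformly on compact
subintervals. -/
def LocPolyBdd (B : ℕ → ℝ → ℝ) : Prop :=
  ∀ a b : ℝ, 0 < a → ∃ (C : ℝ) (m : ℕ), 0 ≤ C ∧ ∀ k, ∀ τ ∈ Icc a b, |B k τ| ≤ C * ((k : ℝ) + 1) ^ m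

theorem LocPolyBdd.polyGrowth {B : ℕ → ℝ → ℝ} (hB : LocPolyBdd B) {τ : ℝ} (hτ : 0 < τ) :
    PolyGrowth fun k => B k τ := by
  obtain ⟨C, m, -, h⟩ := hB τ τ hτ
  exact ⟨C, m, fun k => h k τ ⟨le_rfl, le_rfl⟩⟩

theorem LocPolyBdd.add {A B : ℕ → ℝ → ℝ} (hA : LocPolyBdd A) (hB : LocPolyBdd B) :
    LocPolyBdd fun k τ => A k τ + B k τ := by
  intro a b ha
  obtain ⟨C, m, hC, h⟩ := hA a b ha
  obtain ⟨D, l, hD, h'⟩ := hB a b ha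
  refine ⟨C + D, m + l, by positivity, fun k τ hτ => ?_⟩
  have hk1 : (1:ℝ) ≤ (k : ℝ) + 1 := by linarith [(Nat.cast_nonneg k : (0:ℝ) ≤ k)]
  calc |A k τ + B k τ| ≤ |A k τ| + |B k τ| := abs_add_le _ _
    _ ≤ C * ((k : ℝ) + 1) ^ m + D * ((k : ℝ) + 1) ^ l := add_le_add (h k τ hτ) (h' k τ hτ)
    _ ≤ C * ((k : ℝ) + 1) ^ (m + l) + D * ((k : ℝ) + 1) ^ (m + l) := by
        gcongr <;> first | exact hk1 | omega
    _ = _ := by ring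

theorem LocPolyBdd.mul {A B : ℕ → ℝ → ℝ} (hA : LocPolyBdd A) (hB : LocPolyBdd B) :
    LocPolyBdd fun k τ => A k τ * B k τ := by
  intro a b ha
  obtain ⟨C, m, hC, h⟩ := hA a b ha
  obtain ⟨D, l, hD, h'⟩ := hB a b ha
  refine ⟨C * D, m + l, by positivity, fun k τ hτ => ?_⟩
  rw [abs_mul]
  calc |A k τ| * |B k τ| ≤ (C * ((k : ℝ) + 1) ^ m) * (D * ((k : ℝ) + 1) ^ l) :=
        mul_le_mul (h k τ hτ) (h' k τ hτ) (abs_nonneg _) (by positivity)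
    _ = _ := by ring

theorem locPolyBdd_of_continuousOn {f : ℝ → ℝ} (hf : ContinuousOn f (Ioi 0)) :
    LocPolyBdd fun _ => f := by
  intro a b ha
  obtain ⟨C, hC⟩ := (isCompact_Icc (a := a) (b := b)).exists_bound_of_continuousOn
    (hf.mono fun τ hτ => lt_of_lt_of_le ha hτ.1)
  exact ⟨max C 0, 0, le_max_right _ _, fun k τ hτ => by simpa using Or.inl (hC τ hτ)⟩

theorem eig_le (n k : ℕ) : eig n k ≤ (n + 1) * ((k : ℝ) + 1) ^ 2 := by
  have h0 : (0:ℝ) ≤ k := by positivity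
  have h1 : (0:ℝ) ≤ n := by positivity
  simp only [eig]
  nlinarith [mul_nonneg h0 h1, mul_nonneg (mul_nonneg h0 h1) h0]

theorem locPolyBdd_eig (n : ℕ) : LocPolyBdd fun k _ => eig n k := fun _ _ _ =>
  ⟨n + 1, 2, by positivity, fun k _ _ => by
    rw [abs_of_nonneg (eig_nonneg n k)]
    exact eig_le n k⟩

/-- Families whose derivatives up to order `m` have locally uniform polynomial growth. -/
def TameN : ℕ → (ℕ → ℝ → ℝ) → Prop
  | 0, B => LocPolyBdd B
  | m + 1, B => LocPolyBdd B ∧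
      ∃ B' : ℕ → ℝ → ℝ, (∀ k, ∀ τ, 0 < τ → HasDerivAt (B k) (B' k τ) τ) ∧ TameN m B'

theorem TameN.locPolyBdd {m : ℕ} {B : ℕ → ℝ → ℝ} (hB : TameN m B) : LocPolyBdd B := by
  cases m with
  | zero => exact hB
  | succ m => exact hB.1

theorem TameN.of_succ {m : ℕ} : ∀ {B : ℕ → ℝ → ℝ}, TameN (m + 1) B → TameN m B := by
  induction m with
  | zero => exact fun hB => hB.1
  | succ m ih =>
    rintro B ⟨h, B', hd, hB'⟩
    exact ⟨h, B', hd, ih hB'⟩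

theorem TameN.add {m : ℕ} : ∀ {A B : ℕ → ℝ → ℝ}, TameN m A → TameN m B →
    TameN m fun k τ => A k τ + B k τ := by
  induction m with
  | zero => exact fun hA hB => LocPolyBdd.add hA hB
  | succ m ih =>
    rintro A B ⟨h, A', hd, hA'⟩ ⟨h2, B', hd2, hB'⟩
    exact ⟨h.add h2, _, fun k τ hτ => (hd k τ hτ).add (hd2 k τ hτ), ih hA' hB'⟩

theorem TameN.mul {m : ℕ} : ∀ {A B : ℕ → ℝ → ℝ}, TameN m A → TameN m B →
    TameN m fun k τ => A k τ * B k τ := by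
  induction m with
  | zero => exact fun hA hB => LocPolyBdd.mul hA hB
  | succ m ih =>
    intro A B hA hB
    obtain ⟨h, A', hd, hA'⟩ := id hA
    obtain ⟨h2, B', hd2, hB'⟩ := id hB
    exact ⟨h.mul h2, _, fun k τ hτ => (hd k τ hτ).mul (hd2 k τ hτ),
      (ih hA' hB.of_succ).add (ih hA.of_succ hB')⟩

theorem tameN_of_contDiffOn {m : ℕ} : ∀ {f : ℝ → ℝ}, ContDiffOn ℝ ∞ f (Ioi 0) →
    TameN m fun _ => f := by
  induction m with
  | zero => exact fun hf => locPolyBdd_of_continuousOn hf.continuousOn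
  | succ m ih =>
    intro f hf
    refine ⟨locPolyBdd_of_continuousOn hf.continuousOn, fun _ => deriv f, fun k τ hτ => ?_,
      ih (hf.deriv_of_isOpen isOpen_Ioi (by simp))⟩
    exact ((hf.contDiffAt (Ioi_mem_nhds hτ)).differentiableAt (by simp)).hasDerivAt

theorem tameN_const (m : ℕ) (c : ℝ) : TameN m fun _ _ => c := tameN_of_contDiffOn contDiffOn_const

theorem tameN_eig (n m : ℕ) : TameN m fun k _ => eig n k := by
  cases m with
  | zero => exact locPolyBdd_eig n
  | succ m => exact ⟨locPolyBdd_eig n, fun _ _ => 0, fun k τ _ => hasDerivAt_const _ _,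
      tameN_const m 0⟩

theorem TameN.iteratedDeriv {m : ℕ} : ∀ {B : ℕ → ℝ → ℝ}, TameN m B →
    LocPolyBdd fun k => iteratedDeriv m (B k) := by
  induction m with
  | zero =>
    intro B hB
    simpa using hB.locPolyBdd
  | succ m ih =>
    rintro B ⟨-, B', hd, hB'⟩ a b ha
    obtain ⟨C, l, hC, h⟩ := ih hB' a b ha
    refine ⟨C, l, hC, fun k τ hτ => ?_⟩
    have he : deriv (B k) =ᶠ[𝓝 τ] B' k := by
      filter_upwards [Ioi_mem_nhds (lt_of_lt_of_le ha hτ.1)] with s hs using (hd k s hs).deriv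
    simp only [iteratedDeriv_succ']
    rw [he.iteratedDeriv_eq m]
    exact h k τ hτ

/-- One level is lost: `TameN 0` is only a bound, and continuity of the last derivative comes from
its being differentiable itself. -/
theorem TameN.contDiffOn {m : ℕ} : ∀ {B : ℕ → ℝ → ℝ}, TameN (m + 1) B → ∀ k,
    ContDiffOn ℝ m (B k) (Ioi 0) := by
  induction m with
  | zero =>
    rintro B ⟨-, B', hd, -⟩ k
    rw [Nat.cast_zero, contDiffOn_zero]
    exact fun τ hτ => (hd k τ hτ).continuousAt.continuousWithinAt
  | succ m ih =>
    rintro B ⟨-, B', hd, hB'⟩ k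
    rw [Nat.cast_succ, contDiffOn_succ_iff_deriv_of_isOpen isOpen_Ioi]
    refine ⟨fun τ hτ => (hd k τ hτ).differentiableAt.differentiableWithinAt, by simp, ?_⟩
    exact (ih hB' k).congr fun τ hτ => (hd k τ hτ).deriv

theorem hasDerivAt_harmSeries (hn : 1 ≤ n) {B B' : ℕ → ℝ → ℝ} (hB : LocPolyBdd B)
    (hB' : LocPolyBdd B') (hd : ∀ k, ∀ τ, 0 < τ → HasDerivAt (B k) (B' k τ) τ) {g : Sph n → ℝ}
    (hg : IsSmooth g) (x : Sph n) {τ : ℝ} (hτ : 0 < τ) :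
    HasDerivAt (fun s => harmSeries (fun k => B k s) g x) (harmSeries (fun k => B' k τ) g x) τ := by
  obtain ⟨C, m, hC0, hC⟩ := hB' (τ / 2) (τ + 1) (by linarith)
  obtain ⟨v, hv0, hvs, hv⟩ := exists_harmProj_bounds hn hg
  have hvx : ∀ k, |harmProj k g x| ≤ v 0 k := fun k => by
    have := hv 0 k x (ball_subset_annulus x (Metric.mem_ball_self (by norm_num)))
    rwa [norm_iteratedFDeriv_zero, radialExt_coe] at this
  have hmem : τ ∈ Ioo (τ / 2) (τ + 1) := ⟨by linarith, by linarith⟩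
  refine hasDerivAt_tsum_of_isPreconnected (u := fun k : ℕ => C * (((k : ℝ) + 1) ^ m * v 0 k))
    ((hvs 0 m).mul_left C) isOpen_Ioo isPreconnected_Ioo
    (fun k s hs => (hd k s (by linarith [hs.1])).mul_const _) (fun k s hs => ?_) hmem
    (summable_harmSeries hn (hB.polyGrowth hτ) hg x) hmem
  rw [norm_mul, Real.norm_eq_abs, Real.norm_eq_abs, ← mul_assoc]
  exact mul_le_mul (hC k s ⟨hs.1.le, hs.2.le⟩) (hvx k) (abs_nonneg _) (by positivity)

theorem isSmoothOnPos_of_contDiffAt {F : ℝ × Amb n → ℝ}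
    (hF : ∀ τ, 0 < τ → ∀ x : Sph n, ContDiffAt ℝ ∞ F (τ, (x : Amb n))) :
    IsSmoothOnPos (fun τ (x : Sph n) => F (τ, x)) := by
  rintro ⟨τ, x⟩ ⟨hτ, -⟩
  apply ContMDiffAt.contMDiffWithinAt
  have h2 : ContMDiff (𝓘(ℝ, ℝ).prod (𝓡 n)) 𝓘(ℝ, ℝ × Amb n) ∞
      (fun p : ℝ × Sph n => (p.1, (p.2 : Amb n))) :=
    contMDiff_fst.prodMk_space (contMDiff_coe_sphere.comp contMDiff_snd)
  exact ContMDiffAt.comp (g := F) (τ, x) (hF τ hτ x).contMDiffAt (h2 (τ, x))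

/-- Leibniz rule, after noting that the two coordinate projections have norm at most one. It
separates time derivatives, which grow polynomially in `k`, from space derivatives, which decay
rapidly. -/
theorem norm_iteratedFDeriv_mul_fst_snd_le {E : Type*} [NormedAddCommGroup E] [NormedSpace ℝ E]
    {s : Set ℝ} {t : Set E} (hs : IsOpen s) (ht : IsOpen t) {f : ℝ → ℝ} {g : E → ℝ}
    (hf : ContDiffOn ℝ ∞ f s) (hg : ContDiffOn ℝ ∞ g t) (j : ℕ) {p : ℝ × E} (hp : p ∈ s ×ˢ t) :
    ‖iteratedFDeriv ℝ j (fun p : ℝ × E => f p.1 * g p.2) p‖ ≤ ∑ i ∈ Finset.range (j + 1),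
      (j.choose i : ℝ) * |iteratedDeriv i f p.1| * ‖iteratedFDeriv ℝ (j - i) g p.2‖ := by
  have hst : IsOpen (s ×ˢ t) := hs.prod ht
  have hs' : IsOpen ((ContinuousLinearMap.fst ℝ ℝ E) ⁻¹' s) := hs.preimage (by fun_prop)
  have ht' : IsOpen ((ContinuousLinearMap.snd ℝ ℝ E) ⁻¹' t) := ht.preimage (by fun_prop)
  have hF : ∀ i : ℕ, ‖iteratedFDeriv ℝ i (f ∘ ContinuousLinearMap.fst ℝ ℝ E) p‖ ≤
      |iteratedDeriv i f p.1| := by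
    intro i
    have h := (ContinuousLinearMap.fst ℝ ℝ E).iteratedFDerivWithin_comp_right (i := i) hf
      hs.uniqueDiffOn hs'.uniqueDiffOn (x := p) hp.1 (WithTop.coe_le_coe.mpr le_top)
    rw [iteratedFDerivWithin_of_isOpen i hs' (by exact hp.1),
      iteratedFDerivWithin_of_isOpen i hs (by exact hp.1)] at h
    rw [h, ← Real.norm_eq_abs, ← norm_iteratedFDeriv_eq_norm_iteratedDeriv]
    refine (ContinuousMultilinearMap.norm_compContinuousLinearMap_le _ _).trans ?_
    refine mul_le_of_le_one_right (norm_nonneg _) ?_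
    exact Finset.prod_le_one (fun _ _ => norm_nonneg _)
      fun _ _ => ContinuousLinearMap.norm_fst_le ℝ ℝ E
  have hG : ∀ i : ℕ, ‖iteratedFDeriv ℝ i (g ∘ ContinuousLinearMap.snd ℝ ℝ E) p‖ ≤
      ‖iteratedFDeriv ℝ i g p.2‖ := by
    intro i
    have h := (ContinuousLinearMap.snd ℝ ℝ E).iteratedFDerivWithin_comp_right (i := i) hg
      ht.uniqueDiffOn ht'.uniqueDiffOn (x := p) hp.2 (WithTop.coe_le_coe.mpr le_top)
    rw [iteratedFDerivWithin_of_isOpen i ht' (by exact hp.2),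
      iteratedFDerivWithin_of_isOpen i ht (by exact hp.2)] at h
    rw [h]
    refine (ContinuousMultilinearMap.norm_compContinuousLinearMap_le _ _).trans ?_
    refine mul_le_of_le_one_right (norm_nonneg _) ?_
    exact Finset.prod_le_one (fun _ _ => norm_nonneg _)
      fun _ _ => ContinuousLinearMap.norm_snd_le ℝ ℝ E
  have hfc : ContDiffOn ℝ ∞ (f ∘ ContinuousLinearMap.fst ℝ ℝ E) (s ×ˢ t) :=
    hf.comp (ContinuousLinearMap.fst ℝ ℝ E).contDiff.contDiffOn fun q hq => hq.1
  have hgc : ContDiffOn ℝ ∞ (g ∘ ContinuousLinearMap.snd ℝ ℝ E) (s ×ˢ t) :=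
    hg.comp (ContinuousLinearMap.snd ℝ ℝ E).contDiff.contDiffOn fun q hq => hq.2
  have h := norm_iteratedFDerivWithin_mul_le hfc hgc hst.uniqueDiffOn hp (n := j)
    (WithTop.coe_le_coe.mpr le_top)
  simp only [iteratedFDerivWithin_of_isOpen _ hst hp] at h
  refine h.trans (Finset.sum_le_sum fun i _ => ?_)
  gcongr
  · exact hF i
  · exact hG (j - i)

theorem isSmoothOnPos_harmSeries (hn : 1 ≤ n) {B : ℕ → ℝ → ℝ} (hB : ∀ m, TameN m B)
    {g : Sph n → ℝ} (hg : IsSmooth g) :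
    IsSmoothOnPos fun τ => harmSeries (fun k => B k τ) g := by
  obtain ⟨v, hv0, hvs, hv⟩ := exists_harmProj_bounds hn hg
  have hBs : ∀ k, ContDiffOn ℝ ∞ (B k) (Ioi 0) := fun k => by
    rw [contDiffOn_infty]
    exact fun m => (hB (m + 1)).contDiffOn k
  have key : ∀ τ, 0 < τ → ∀ x : Sph n, ContDiffAt ℝ ∞
      (fun p : ℝ × Amb n => radialExt (harmSeries (fun k => B k p.1) g) p.2) (τ, (x : Amb n)) := by
    intro τ hτ x
    have hmem : τ ∈ Ioo (τ / 2) (τ + 1) := ⟨by linarith, by linarith⟩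
    have hxb : (x : Amb n) ∈ Metric.ball (x : Amb n) (1 / 16) :=
      Metric.mem_ball_self (by norm_num)
    set s := Ioo (τ / 2) (τ + 1) ×ˢ Metric.ball (x : Amb n) (1 / 16) with hs
    have hso : IsOpen s := isOpen_Ioo.prod Metric.isOpen_ball
    have hspc : IsPreconnected s := ((convex_Ioo _ _).prod (convex_ball _ _)).isPreconnected
    have hb0 : ∀ y ∈ Metric.ball (x : Amb n) (1 / 16), y ≠ 0 := fun y hy =>
      annulus_subset (ball_subset_annulus x hy)
    have hbd := fun i => (hB i).iteratedDeriv (τ / 2) (τ + 1) (by linarith)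
    choose C m hC0 hC using hbd
    have h1 : ∀ k, ContDiffOn ℝ ∞ (B k) (Ioo (τ / 2) (τ + 1)) := fun k =>
      (hBs k).mono fun σ hσ => lt_trans (by linarith) hσ.1
    have h2 : ∀ k, ContDiffOn ℝ ∞ (radialExt (harmProj k g)) (Metric.ball (x : Amb n) (1 / 16)) :=
      fun k => (isSmooth_harmProj k g).contDiffOn_radialExt.mono fun y hy => hb0 y hy
    -- Leibniz majorant: `i` derivatives fall on `B k` and cost `C i * (k + 1) ^ m i`, the other `j
    -- - i` fall on the harmonic.
    set w : ℕ → ℕ → ℝ := fun j k => ∑ i ∈ Finset.range (j + 1),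
      (j.choose i : ℝ) * C i * (((k : ℝ) + 1) ^ (m i) * v (j - i) k) with hw
    have hws : ∀ j, Summable (w j) := fun j =>
      summable_sum fun i _ => (hvs (j - i) (m i)).mul_left _
    have hwb : ∀ j k, ∀ p ∈ s, ‖iteratedFDeriv ℝ j
        (fun p : ℝ × Amb n => B k p.1 * radialExt (harmProj k g) p.2) p‖ ≤ w j k := by
      intro j k p hp
      refine (norm_iteratedFDeriv_mul_fst_snd_le isOpen_Ioo Metric.isOpen_ball (h1 k) (h2 k) j
        hp).trans (Finset.sum_le_sum fun i _ => ?_)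
      rw [mul_assoc, mul_assoc, ← mul_assoc (C i)]
      refine mul_le_mul_of_nonneg_left ?_ (by positivity)
      exact mul_le_mul (hC i k p.1 ⟨hp.1.1.le, hp.1.2.le⟩)
        (hv _ k p.2 (ball_subset_annulus x hp.2)) (norm_nonneg _)
        (mul_nonneg (hC0 i) (by positivity))
    have hsm : ∀ k, ContDiffOn ℝ ∞
        (fun p : ℝ × Amb n => B k p.1 * radialExt (harmProj k g) p.2) s := fun k =>
      ((h1 k).comp contDiffOn_fst fun q hq => hq.1).mul
        ((h2 k).comp contDiffOn_snd fun q hq => hq.2)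
    have hcd := contDiffOn_tsum_of_isPreconnected hso hspc hsm hws hwb
    have hps : (τ, (x : Amb n)) ∈ s := mk_mem_prod hmem hxb
    have hnhds : s ∈ 𝓝 (τ, (x : Amb n)) := hso.mem_nhds hps
    have hca := hcd.contDiffAt hnhds
    have heq : (fun p : ℝ × Amb n => radialExt (harmSeries (fun k => B k p.1) g) p.2)
        =ᶠ[𝓝 (τ, (x : Amb n))] fun p => ∑' k, B k p.1 * radialExt (harmProj k g) p.2 := by
      filter_upwards [hnhds] with p hp
      exact radialExt_harmSeries _ g (hb0 p.2 hp.2)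
    exact hca.congr_of_eventuallyEq heq
  simpa using isSmoothOnPos_of_contDiffAt key

/-! ### Global solvability of linear ODEs from the initial time -/

/-- Coordinatewise truncation to `[-R, R]`. -/
def clamp {ι : Type*} (R : ℝ) (x : ι → ℝ) : ι → ℝ := fun i => max (-R) (min R (x i))

theorem abs_max_min_sub_le (R a b : ℝ) : |max (-R) (min R a) - max (-R) (min R b)| ≤ |a - b| :=
  (abs_max_sub_max_le_max _ _ _ _).trans (by
    simpa using abs_min_sub_min_le_max R a R b)

theorem lipschitzWith_clamp {ι : Type*} [Fintype ι] (R : ℝ) :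
    LipschitzWith 1 (clamp R : (ι → ℝ) → ι → ℝ) := by
  refine LipschitzWith.of_dist_le_mul fun x y => ?_
  rw [NNReal.coe_one, one_mul, dist_pi_le_iff dist_nonneg]
  intro i
  exact (abs_max_min_sub_le R (x i) (y i)).trans (dist_le_pi_dist x y i)

theorem clamp_eq_self {ι : Type*} [Fintype ι] {R : ℝ} {x : ι → ℝ} (hx : ‖x‖ ≤ R) :
    clamp R x = x := by
  ext i
  have h := abs_le.mp ((norm_le_pi_norm x i).trans hx)
  simp [clamp, h.1, h.2]

theorem norm_clamp_le {ι : Type*} [Fintype ι] {R : ℝ} (hR : 0 ≤ R) (x : ι → ℝ) :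
    ‖clamp R x‖ ≤ R := by
  rw [pi_norm_le_iff_of_nonneg hR]
  intro i
  simp only [clamp, Real.norm_eq_abs, abs_le]
  exact ⟨le_max_left _ _, max_le (by linarith) (min_le_left _ _)⟩

theorem norm_clamp_le_norm {ι : Type*} [Fintype ι] {R : ℝ} (hR : 0 ≤ R) (x : ι → ℝ) :
    ‖clamp R x‖ ≤ ‖x‖ := by
  have h := (lipschitzWith_clamp R).dist_le_mul x 0
  have h0 : clamp R (0 : ι → ℝ) = 0 := clamp_eq_self (by simpa using hR)
  rwa [h0, NNReal.coe_one, one_mul, dist_zero_right, dist_zero_right] at h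

/-- Truncating the argument makes the field bounded, so Picard–Lindelöf works on the whole interval
at once. Gronwall for the truncated equation shows that its solution stays where the truncation is
inactive. -/
theorem exists_linear_ode_Icc {ι : Type*} [Fintype ι] {f : ℝ → (ι → ℝ) → ι → ℝ} {T : ℝ}
    (hT : 0 ≤ T) (hc : ∀ x, ContinuousOn (fun t => f t x) (Icc 0 T)) {K : NNReal}
    (hK : ∀ t ∈ Icc 0 T, LipschitzWith K (f t)) (h0 : ∀ t, f t 0 = 0) (y₀ : ι → ℝ) :
    ∃ y : ℝ → ι → ℝ, y 0 = y₀ ∧ ∀ t ∈ Icc 0 T, HasDerivWithinAt y (f t (y t)) (Icc 0 T) t := by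
  -- `R` is the Gronwall bound for the solution. The truncated field has norm at most `K * R`, hence
  -- the ball of radius `K * R * T` used below.
  obtain ⟨R, hR⟩ : ∃ R : NNReal, (R : ℝ) = ‖y₀‖ * Real.exp (K * T) :=
    ⟨⟨_, by positivity⟩, rfl⟩
  obtain ⟨S, hS⟩ : ∃ S : NNReal, (S : ℝ) = T := ⟨⟨T, hT⟩, rfl⟩
  have hfn : ∀ t ∈ Icc 0 T, ∀ x, ‖f t x‖ ≤ K * ‖x‖ := fun t ht x => by
    simpa [h0 t] using (hK t ht).dist_le_mul x 0
  have hPL : IsPicardLindelof (fun t x => f t (clamp R x)) (⟨0, le_rfl, hT⟩ : Icc 0 T) y₀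
      (K * R * S) 0 (K * R) K :=
    { lipschitzOnWith := fun t ht => by
        have h := ((hK t ht).comp (lipschitzWith_clamp (R : ℝ))).lipschitzOnWith
          (s := Metric.closedBall y₀ (K * R * S : NNReal))
        rw [mul_one] at h
        exact h
      continuousOn := fun x _ => hc _
      norm_le := fun t ht x _ => (hfn t ht _).trans (by
        rw [NNReal.coe_mul]
        gcongr
        exact norm_clamp_le R.2 x)
      mul_max_le := by
        simp [hT, hS] }
  obtain ⟨y, hy0, hy⟩ := hPL.exists_eq_forall_mem_Icc_hasDerivWithinAt₀
  refine ⟨y, hy0, ?_⟩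
  have hb := norm_le_gronwallBound_of_norm_deriv_right_le (f := y) (δ := ‖y₀‖) (K := K) (ε := 0)
    (a := 0) (b := T)
    (fun t ht => (hy t ht).continuousWithinAt)
    (fun t ht => (hy t ⟨ht.1, ht.2.le⟩).mono_of_mem_nhdsWithin
      (mem_nhdsWithin.mpr ⟨Iio T, isOpen_Iio, ht.2, fun s hs => ⟨ht.1.trans hs.2, (mem_Iio.mp hs.1).le⟩⟩))
    (by rw [← hy0]) (fun t ht => by
      rw [add_zero]
      refine (hfn t ⟨ht.1, ht.2.le⟩ _).trans ?_
      gcongr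
      exact norm_clamp_le_norm R.2 _)
  intro t ht
  have hyR : ‖y t‖ ≤ R := by
    refine (hb t ht).trans ?_
    rw [gronwallBound_ε0, sub_zero, hR]
    refine mul_le_mul_of_nonneg_left (Real.exp_le_exp.mpr ?_) (norm_nonneg _)
    exact mul_le_mul_of_nonneg_left ht.2 K.2
  have := hy t ht
  rwa [clamp_eq_self hyR] at this

/-- Solutions on `[0, N]` agree on common intervals by uniqueness. The glued solution uses at time
`t` the interval ending at `⌊t⌋₊ + 1`, strictly beyond `t`, so derivatives are inherited. -/
theorem exists_linear_ode {ι : Type*} [Fintype ι] {f : ℝ → (ι → ℝ) → ι → ℝ}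
    (hc : ∀ x, ContinuousOn (fun t => f t x) (Ici 0))
    (hK : ∀ T, ∃ K : NNReal, ∀ t ∈ Icc 0 T, LipschitzWith K (f t)) (h0 : ∀ t, f t 0 = 0)
    (y₀ : ι → ℝ) :
    ∃ y : ℝ → ι → ℝ, y 0 = y₀ ∧ ∀ t, 0 ≤ t → HasDerivWithinAt y (f t (y t)) (Ici 0) t := by
  have hN : ∀ N : ℕ, ∃ y : ℝ → ι → ℝ, y 0 = y₀ ∧
      ∀ t ∈ Icc (0:ℝ) N, HasDerivWithinAt y (f t (y t)) (Icc (0:ℝ) N) t := fun N => by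
    obtain ⟨K, h⟩ := hK N
    exact exists_linear_ode_Icc (Nat.cast_nonneg N) (fun x => (hc x).mono fun t ht => ht.1) h h0 y₀
  choose Y hY0 hY using hN
  have hder : ∀ N : ℕ, ∀ t ∈ Ico (0:ℝ) N, HasDerivWithinAt (Y N) (f t (Y N t)) (Ici 0) t :=
    fun N t ht => (hY N t ⟨ht.1, ht.2.le⟩).mono_of_mem_nhdsWithin
      (mem_nhdsWithin.mpr ⟨Iio N, isOpen_Iio, ht.2, fun s hs => ⟨hs.2, (mem_Iio.mp hs.1).le⟩⟩)
  have hle : ∀ M N : ℕ, M ≤ N → EqOn (Y M) (Y N) (Icc 0 M) := by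
    intro M N hMN
    obtain ⟨K, h⟩ := hK M
    have hMN' : (M : ℝ) ≤ N := by exact_mod_cast hMN
    refine ODE_solution_unique_of_mem_Icc_right (v := f) (s := fun _ => univ) (K := K)
      (fun t ht => (h t ⟨ht.1, ht.2.le⟩).lipschitzOnWith)
      (fun t ht => (hY M t ht).continuousWithinAt)
      (fun t ht => (hder M t ht).mono (Ici_subset_Ici.mpr ht.1)) (fun _ _ => trivial)
      (fun t ht => ((hY N t ⟨ht.1, ht.2.trans hMN'⟩).continuousWithinAt).mono
        (Icc_subset_Icc_right hMN'))
      (fun t ht => (hder N t ⟨ht.1, ht.2.trans_le hMN'⟩).mono (Ici_subset_Ici.mpr ht.1))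
      (fun _ _ => trivial) (by rw [hY0, hY0])
  have heq : ∀ N : ℕ, ∀ t ∈ Ico (0:ℝ) N, Y (⌊t⌋₊ + 1) t = Y N t := fun N t ht => by
    refine hle _ N ?_ ⟨ht.1, by exact_mod_cast (Nat.lt_floor_add_one t).le⟩
    have : ⌊t⌋₊ < N := (Nat.floor_lt ht.1).mpr ht.2
    omega
  refine ⟨fun t => Y (⌊t⌋₊ + 1) t, by simpa using hY0 1, fun t ht => ?_⟩
  have htN : t ∈ Ico (0:ℝ) (⌊t⌋₊ + 1 : ℕ) := ⟨ht, by exact_mod_cast Nat.lt_floor_add_one t⟩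
  refine (hder _ t htN).congr_of_eventuallyEq ?_ rfl
  have : Ico (0:ℝ) (⌊t⌋₊ + 1 : ℕ) ∈ 𝓝[Ici 0] t :=
    mem_nhdsWithin.mpr ⟨Iio _, isOpen_Iio, htN.2, fun s hs => ⟨hs.2, hs.1⟩⟩
  filter_upwards [this] with s hs using heq _ s hs

/-! ### A differential inequality and logarithmic weights -/

/-- `f y * exp (-K (y - a))` is nonincreasing. Derivatives are needed only in the open interval,
which matters because the modes start at the singular time. -/
theorem le_mul_exp_of_deriv_le {f f' : ℝ → ℝ} {a b K : ℝ} (hf : ContinuousOn f (Icc a b))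
    (hd : ∀ x ∈ Ioo a b, HasDerivAt f (f' x) x) (hb : ∀ x ∈ Ioo a b, f' x ≤ K * f x) {x : ℝ}
    (hx : x ∈ Icc a b) : f x ≤ f a * Real.exp (K * (x - a)) := by
  have hd2 : ∀ y ∈ Ioo a b, HasDerivAt (fun y => f y * Real.exp (-(K * (y - a))))
      (f' y * Real.exp (-(K * (y - a))) + f y * (Real.exp (-(K * (y - a))) * (-(K * 1)))) y :=
    fun y hy => (hd y hy).mul ((((hasDerivAt_id y).sub_const a).const_mul K).neg.exp)
  have hanti : AntitoneOn (fun y => f y * Real.exp (-(K * (y - a)))) (Icc a b) := by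
    refine antitoneOn_of_deriv_nonpos (convex_Icc a b) (hf.mul (by fun_prop)) ?_ ?_
    · rw [interior_Icc]
      exact fun y hy => (hd2 y hy).differentiableAt.differentiableWithinAt
    · rw [interior_Icc]
      intro y hy
      rw [(hd2 y hy).deriv]
      nlinarith [hb y hy, Real.exp_pos (-(K * (y - a)))]
  have h := hanti ⟨le_rfl, hx.1.trans hx.2⟩ hx hx.1
  simp only [sub_self, mul_zero, neg_zero, Real.exp_zero, mul_one] at h
  rw [Real.exp_neg] at h
  rwa [← div_eq_mul_inv, div_le_iff₀ (Real.exp_pos _)] at h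

/-- `τ (log τ)²` equals `4 (√τ log √τ)²`, so everything reduces to continuity of `x log x`. -/
theorem continuousOn_mul_logSq : ContinuousOn (fun τ : ℝ => τ * (1 + |Real.log τ|) ^ 2) (Ici 0) := by
  have h : ContinuousOn (fun τ : ℝ => τ + 2 * |τ * Real.log τ| +
      4 * (√τ * Real.log (√τ)) ^ 2) (Ici 0) := by
    have h1 := Real.continuous_mul_log
    have h2 := Real.continuous_mul_log.comp Real.continuous_sqrt
    have h3 : Continuous (fun τ : ℝ => √τ * Real.log (√τ)) := h2
    exact ((continuous_id.add (continuous_const.mul h1.abs)).add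
      (continuous_const.mul (h3.pow 2))).continuousOn
  refine h.congr fun τ hτ => ?_
  have hτ : 0 ≤ τ := hτ
  simp only [mul_pow, Real.sq_sqrt hτ, Real.log_sqrt hτ, abs_mul, abs_of_nonneg hτ]
  rw [div_pow, ← sq_abs (Real.log τ)]
  ring

theorem tendsto_mul_logSq :
    Tendsto (fun τ : ℝ => τ * (1 + |Real.log τ|) ^ 2) (𝓝[Ici 0] 0) (𝓝 0) := by
  have := continuousOn_mul_logSq 0 (mem_Ici.mpr le_rfl)
  simpa [ContinuousWithinAt] using this

theorem exists_mul_logSq_le (T : ℝ) : ∃ M, 0 ≤ M ∧ ∀ τ ∈ Icc 0 T, τ * (1 + |Real.log τ|) ^ 2 ≤ M := by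
  obtain ⟨M, hM⟩ := (isCompact_Icc (a := (0:ℝ)) (b := T)).exists_bound_of_continuousOn
    (continuousOn_mul_logSq.mono fun τ hτ => hτ.1)
  exact ⟨max M 0, le_max_right _ _, fun τ hτ =>
    (le_abs_self _).trans ((hM τ hτ).trans (le_max_left _ _))⟩

theorem mul_log_le_mul_logSq {τ : ℝ} (hτ : 0 ≤ τ) :
    τ * (1 + |Real.log τ|) ≤ τ * (1 + |Real.log τ|) ^ 2 := by
  have := abs_nonneg (Real.log τ)
  refine mul_le_mul_of_nonneg_left ?_ hτ
  nlinarith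

/-! ### The equations of a single mode in regular variables -/

/-- Coefficients bounded on bounded subintervals of `(0, ∞)`. -/
def BddCoeff (f₁ f₂ f₃ : ℝ → ℝ) : Prop :=
  ∀ T : ℝ, ∃ F, 0 ≤ F ∧ ∀ τ ∈ Ioc 0 T, |f₁ τ| ≤ F ∧ |f₂ τ| ≤ F ∧ |f₃ τ| ≤ F

theorem exists_bound_Ioc {f : ℝ → ℝ} (hf : ContinuousOn f (Ioi 0))
    (h0 : f =O[𝓝[>] 0] (fun _ => (1 : ℝ))) (T : ℝ) : ∃ F, 0 ≤ F ∧ ∀ τ ∈ Ioc 0 T, |f τ| ≤ F := by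
  obtain ⟨C, hC⟩ := h0.bound
  obtain ⟨ε, hε, h⟩ := mem_nhdsGT_iff_exists_Ioo_subset.mp hC
  have hε : 0 < ε := hε
  obtain ⟨D, hD⟩ := (isCompact_Icc (a := ε / 2) (b := T)).exists_bound_of_continuousOn
    (hf.mono fun τ hτ => lt_of_lt_of_le (half_pos hε) hτ.1)
  refine ⟨max 0 (max C D), le_max_left _ _, fun τ hτ => ?_⟩
  rcases lt_or_ge τ (ε / 2) with h1 | h1
  · have := h (⟨hτ.1, by linarith⟩ : τ ∈ Ioo 0 ε)
    simp only [mem_ofPred_eq, Real.norm_eq_abs, abs_one, mul_one] at this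
    exact this.trans ((le_max_left _ _).trans (le_max_right _ _))
  · exact (hD τ ⟨h1, hτ.2⟩).trans ((le_max_right _ _).trans (le_max_right _ _))

theorem bddCoeff_of_isBigO {f₁ f₂ f₃ : ℝ → ℝ} (hf₁ : ContinuousOn f₁ (Ioi 0))
    (hf₂ : ContinuousOn f₂ (Ioi 0)) (hf₃ : ContinuousOn f₃ (Ioi 0))
    (hf : (fun τ => |f₁ τ| + |f₂ τ| + |f₃ τ|) =O[𝓝[>] 0] (fun _ => (1 : ℝ))) :
    BddCoeff f₁ f₂ f₃ := by
  intro T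
  obtain ⟨F, hF0, hF⟩ := exists_bound_Ioc ((hf₁.abs.add hf₂.abs).add hf₃.abs) hf T
  refine ⟨F, hF0, fun τ hτ => ?_⟩
  have h : |f₁ τ| + |f₂ τ| + |f₃ τ| ≤ F := (le_abs_self _).trans (hF τ hτ)
  have h1 := abs_nonneg (f₁ τ)
  have h2 := abs_nonneg (f₂ τ)
  have h3 := abs_nonneg (f₃ τ)
  exact ⟨by linarith, by linarith, by linarith⟩

/-- For a mode `a = b + p log τ` with eigenvalue `lam`, the quantity `τ⁻¹ ∂_τ (τ ∂_τ a)`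
prescribed by the model system. -/
def modeRhs (q : ℝ) (f₁ f₂ f₃ : ℝ → ℝ) (lam τ p b c : ℝ) : ℝ :=
  -(4 * q + 4 * lam / (τ ^ 2 + 1) ^ 2) * (b + p * Real.log τ) + f₁ τ * p
    + f₂ τ * τ ^ 2 * (b + p * Real.log τ) + f₃ τ * c

/-- The system for a mode `(a, c)` in the regular variables `p = τ ∂_τ a`, `b = a - p log τ`. -/
structure IsMode (q : ℝ) (f₁ f₂ f₃ : ℝ → ℝ) (lam : ℝ) (p b c : ℝ → ℝ) : Prop where
  deriv_p : ∀ τ, 0 < τ → HasDerivAt p (τ * modeRhs q f₁ f₂ f₃ lam τ (p τ) (b τ) (c τ)) τ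
  deriv_b : ∀ τ, 0 < τ →
    HasDerivAt b (-(τ * Real.log τ) * modeRhs q f₁ f₂ f₃ lam τ (p τ) (b τ) (c τ)) τ
  deriv_c : ∀ τ, 0 < τ → HasDerivAt c (2 * τ * (b τ + p τ * Real.log τ)) τ
  cont_p : ContinuousOn p (Ici 0)
  cont_b : ContinuousOn b (Ici 0)
  cont_c : ContinuousOn c (Ici 0)

theorem abs_add_mul_log_le (τ p b : ℝ) :
    |b + p * Real.log τ| ≤ (1 + |Real.log τ|) * (|p| + |b|) := by
  have h := abs_add_le b (p * Real.log τ)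
  rw [abs_mul] at h
  nlinarith [abs_nonneg p, abs_nonneg b, abs_nonneg (Real.log τ),
    mul_nonneg (abs_nonneg b) (abs_nonneg (Real.log τ))]

variable {q : ℝ} {f₁ f₂ f₃ : ℝ → ℝ}

/-- The constant is independent of the eigenvalue, which enters only through the factor `1 + lam`;
the coefficient `4 / (τ² + 1)²` is at most four. -/
theorem BddCoeff.modeRhs_le (hF : BddCoeff f₁ f₂ f₃) (q T : ℝ) : ∃ K, 0 ≤ K ∧
    ∀ lam, 0 ≤ lam → ∀ τ ∈ Ioc 0 T, ∀ p b c, |modeRhs q f₁ f₂ f₃ lam τ p b c| ≤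
      K * (1 + lam) * (1 + |Real.log τ|) * (|p| + |b| + |c|) := by
  obtain ⟨F, hF0, hF⟩ := hF T
  refine ⟨4 * |q| + 4 + (F + F * T ^ 2 + F), by positivity, fun lam hl τ hτ p b c => ?_⟩
  obtain ⟨h1, h2, h3⟩ := hF τ hτ
  have hL := abs_nonneg (Real.log τ)
  have hp := abs_nonneg p
  have hb := abs_nonneg b
  have hc := abs_nonneg c
  set N := |p| + |b| + |c| with hN
  set s := 1 + |Real.log τ| with hs
  have hs1 : 1 ≤ s := by linarith
  have hN0 : 0 ≤ N := by positivity
  have ha : |b + p * Real.log τ| ≤ s * N := (abs_add_mul_log_le τ p b).trans (by gcongr; linarith)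
  have hNs : N ≤ s * N := le_mul_of_one_le_left hN0 hs1
  have hsN : 0 ≤ s * N := hN0.trans hNs
  have hw0 : 0 ≤ 4 * lam / (τ ^ 2 + 1) ^ 2 := by positivity
  have hw : 4 * lam / (τ ^ 2 + 1) ^ 2 ≤ 4 * lam := div_le_self (by positivity) (by
    nlinarith [sq_nonneg τ, sq_nonneg (τ ^ 2)])
  have hqw : |-(4 * q + 4 * lam / (τ ^ 2 + 1) ^ 2)| ≤ (4 * |q| + 4) * (1 + lam) := by
    rw [abs_neg]
    refine (abs_add_le _ _).trans ?_
    rw [abs_of_nonneg hw0, abs_mul, abs_of_pos (by norm_num : (0:ℝ) < 4)]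
    nlinarith [mul_nonneg (abs_nonneg q) hl]
  have ht2 : τ ^ 2 ≤ T ^ 2 := pow_le_pow_left₀ hτ.1.le hτ.2 2
  have e1 : |-(4 * q + 4 * lam / (τ ^ 2 + 1) ^ 2) * (b + p * Real.log τ)| ≤
      (4 * |q| + 4) * (1 + lam) * (s * N) := by
    rw [abs_mul]; gcongr
  have e2 : |f₁ τ * p| ≤ F * (s * N) := by
    rw [abs_mul]; gcongr; linarith
  have e3 : |f₂ τ * τ ^ 2 * (b + p * Real.log τ)| ≤ F * T ^ 2 * (s * N) := by
    rw [abs_mul, abs_mul, abs_of_nonneg (sq_nonneg τ)]; gcongr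
  have e4 : |f₃ τ * c| ≤ F * (s * N) := by
    rw [abs_mul]; gcongr; linarith
  have e5 : (F + F * T ^ 2 + F) * (s * N) ≤ (F + F * T ^ 2 + F) * (s * N) * (1 + lam) :=
    le_mul_of_one_le_right (by positivity) (by linarith)
  have e6 := (abs_add_le (-(4 * q + 4 * lam / (τ ^ 2 + 1) ^ 2) * (b + p * Real.log τ) + f₁ τ * p
    + f₂ τ * τ ^ 2 * (b + p * Real.log τ)) (f₃ τ * c)).trans
    (add_le_add_left (abs_add_three _ _ _) _)
  calc _ ≤ _ := e6
    _ ≤ _ := by nlinarith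

/-- This is where the singularity disappears: one logarithm comes from `a = b + p log τ`, another
from the equation for `b`, and the prefactor `τ` beats both. -/
theorem BddCoeff.mode_field_le (hF : BddCoeff f₁ f₂ f₃) (q T : ℝ) : ∃ K, 0 ≤ K ∧
    ∀ lam, 0 ≤ lam → ∀ τ ∈ Ioc 0 T, ∀ p b c : ℝ,
      |τ * modeRhs q f₁ f₂ f₃ lam τ p b c| ≤
        K * (1 + lam) * (τ * (1 + |Real.log τ|) ^ 2) * (|p| + |b| + |c|) ∧
      |-(τ * Real.log τ) * modeRhs q f₁ f₂ f₃ lam τ p b c| ≤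
        K * (1 + lam) * (τ * (1 + |Real.log τ|) ^ 2) * (|p| + |b| + |c|) ∧
      |2 * τ * (b + p * Real.log τ)| ≤
        K * (1 + lam) * (τ * (1 + |Real.log τ|) ^ 2) * (|p| + |b| + |c|) := by
  obtain ⟨K, hK, h⟩ := hF.modeRhs_le q T
  refine ⟨K + 2, by positivity, fun lam hl τ hτ p b c => ?_⟩
  have h1 := h lam hl τ hτ p b c
  have h2 := abs_add_mul_log_le τ p b
  have hL := abs_nonneg (Real.log τ)
  have hτ0 := hτ.1
  set N := |p| + |b| + |c| with hN
  set s := 1 + |Real.log τ| with hs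
  have hs1 : 1 ≤ s := by linarith
  have hN0 : 0 ≤ N := by positivity
  have hss : s ≤ s ^ 2 := by nlinarith
  have hX : 0 ≤ τ * s ^ 2 * N := by positivity
  have h3 : τ * |modeRhs q f₁ f₂ f₃ lam τ p b c| ≤ K * (1 + lam) * (τ * s) * N := by
    calc _ ≤ τ * (K * (1 + lam) * s * N) := by gcongr
      _ = _ := by ring
  have h4 : τ * |Real.log τ| * |modeRhs q f₁ f₂ f₃ lam τ p b c| ≤
      K * (1 + lam) * (τ * s ^ 2) * N := by
    calc _ ≤ τ * s * (K * (1 + lam) * s * N) := by gcongr; linarith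
      _ = _ := by ring
  have h5 : K * (1 + lam) * (τ * s ^ 2) * N ≤ (K + 2) * (1 + lam) * (τ * s ^ 2) * N := by
    gcongr; linarith
  refine ⟨?_, ?_, ?_⟩
  · rw [abs_mul, abs_of_pos hτ0]
    refine (h3.trans ?_).trans h5
    gcongr
  · rw [abs_mul, abs_neg, abs_mul, abs_of_pos hτ0]
    exact h4.trans h5
  · rw [abs_mul, abs_of_pos (by positivity : 0 < 2 * τ)]
    calc 2 * τ * |b + p * Real.log τ| ≤ 2 * τ * (s ^ 2 * N) := by
          gcongr
          refine h2.trans ?_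
          gcongr
          linarith [abs_nonneg c]
      _ = 2 * 1 * (τ * s ^ 2) * N := by ring
      _ ≤ (K + 2) * (1 + lam) * (τ * s ^ 2) * N := by gcongr <;> linarith

theorem IsMode.hasDerivAt_sq {lam : ℝ} {p b c : ℝ → ℝ} (hm : IsMode q f₁ f₂ f₃ lam p b c)
    {τ : ℝ} (hτ : 0 < τ) : HasDerivAt (fun t => p t ^ 2 + b t ^ 2 + c t ^ 2)
      (2 * p τ * (τ * modeRhs q f₁ f₂ f₃ lam τ (p τ) (b τ) (c τ)) +
        2 * b τ * (-(τ * Real.log τ) * modeRhs q f₁ f₂ f₃ lam τ (p τ) (b τ) (c τ)) +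
        2 * c τ * (2 * τ * (b τ + p τ * Real.log τ))) τ := by
  have h := (((hm.deriv_p τ hτ).pow 2).add ((hm.deriv_b τ hτ).pow 2)).add
    ((hm.deriv_c τ hτ).pow 2)
  refine h.congr_deriv ?_
  simp

theorem IsMode.contOn_sq {lam : ℝ} {p b c : ℝ → ℝ} (hm : IsMode q f₁ f₂ f₃ lam p b c) :
    ContinuousOn (fun t => p t ^ 2 + b t ^ 2 + c t ^ 2) (Ici 0) :=
  ((hm.cont_p.pow 2).add (hm.cont_b.pow 2)).add (hm.cont_c.pow 2)

/-! ### Growth of modes is polynomial in the eigenvalue -/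

/-- Growth of modes up to the time scale `1 / (1 + lam)`. -/
theorem BddCoeff.mode_growth_small (hF : BddCoeff f₁ f₂ f₃) (q : ℝ) : ∃ K, 0 ≤ K ∧
    ∀ lam, 0 ≤ lam → ∀ p b c, IsMode q f₁ f₂ f₃ lam p b c → ∀ τ ∈ Icc 0 (1 / (1 + lam)),
      p τ ^ 2 + b τ ^ 2 + c τ ^ 2 ≤ K * (p 0 ^ 2 + b 0 ^ 2 + c 0 ^ 2) := by
  obtain ⟨K, hK, h⟩ := hF.mode_field_le q 1
  obtain ⟨M, hM, hφ⟩ := exists_mul_logSq_le 1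
  refine ⟨Real.exp (6 * K * M), (Real.exp_pos _).le, fun lam hl p b c hm τ hτ => ?_⟩
  have hL : 0 < 1 + lam := by linarith
  have h1L : 1 / (1 + lam) ≤ 1 := by rw [div_le_one hL]; linarith
  -- The factor `6` is `2` from differentiating squares times `3` from `(x + y + z)² ≤ 3 (x² + y² +
  -- z²)`. Over a time at most `1 / (1 + lam)` the exponent is at most `6 * K * M`, independent of
  -- `lam`.
  have hg := le_mul_exp_of_deriv_le (K := 6 * (K * (1 + lam) * M))
    (hm.contOn_sq.mono (fun t ht => ht.1)) (fun t ht => hm.hasDerivAt_sq ht.1) (fun t ht => ?_) hτ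
  · refine hg.trans ?_
    rw [mul_comm]
    refine mul_le_mul_of_nonneg_right (Real.exp_le_exp.mpr ?_) (by positivity)
    rw [sub_zero]
    have h2 : (1 + lam) * τ ≤ 1 := by
      have := (le_div_iff₀ hL).mp hτ.2
      linarith
    have h3 := mul_le_mul_of_nonneg_left h2 (by positivity : 0 ≤ 6 * K * M)
    linarith
  · have ht1 : t ∈ Ioc (0:ℝ) 1 := ⟨ht.1, ht.2.le.trans h1L⟩
    obtain ⟨a1, a2, a3⟩ := h lam hl t ht1 (p t) (b t) (c t)
    have hφt := hφ t ⟨ht1.1.le, ht1.2⟩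
    set P := t * modeRhs q f₁ f₂ f₃ lam t (p t) (b t) (c t)
    set B := -(t * Real.log t) * modeRhs q f₁ f₂ f₃ lam t (p t) (b t) (c t)
    set D := 2 * t * (b t + p t * Real.log t)
    set N := |p t| + |b t| + |c t| with hN
    have hN0 : 0 ≤ N := by positivity
    have hA : K * (1 + lam) * (t * (1 + |Real.log t|) ^ 2) * N ≤ K * (1 + lam) * M * N := by
      gcongr
    have q1 : p t * P ≤ |p t| * (K * (1 + lam) * M * N) :=
      (le_abs_self _).trans (by rw [abs_mul]; gcongr; exact a1.trans hA)
    have q2 : b t * B ≤ |b t| * (K * (1 + lam) * M * N) :=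
      (le_abs_self _).trans (by rw [abs_mul]; gcongr; exact a2.trans hA)
    have q3 : c t * D ≤ |c t| * (K * (1 + lam) * M * N) :=
      (le_abs_self _).trans (by rw [abs_mul]; gcongr; exact a3.trans hA)
    have hNN : N ^ 2 ≤ 3 * (p t ^ 2 + b t ^ 2 + c t ^ 2) := by
      rw [← sq_abs (p t), ← sq_abs (b t), ← sq_abs (c t), hN]
      nlinarith [sq_nonneg (|p t| - |b t|), sq_nonneg (|p t| - |c t|), sq_nonneg (|c t| - |b t|)]
    have hX : 0 ≤ K * (1 + lam) * M := by positivity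
    calc _ ≤ 2 * (K * (1 + lam) * M * N) * N := by
          rw [hN] at q1 q2 q3 ⊢; linarith
      _ = 2 * (K * (1 + lam) * M) * N ^ 2 := by ring
      _ ≤ 2 * (K * (1 + lam) * M) * (3 * (p t ^ 2 + b t ^ 2 + c t ^ 2)) := by gcongr
      _ = _ := by ring

/-- The energy `a'² + (1 + 4 lam / (τ² + 1)²) a² + c²` of a mode. -/
def modeEnergy (lam : ℝ) (p b c : ℝ → ℝ) (τ : ℝ) : ℝ :=
  (p τ / τ) ^ 2 + (1 + 4 * lam / (τ ^ 2 + 1) ^ 2) * (b τ + p τ * Real.log τ) ^ 2 + c τ ^ 2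

theorem IsMode.hasDerivAt_modeEnergy {lam : ℝ} {p b c : ℝ → ℝ}
    (hm : IsMode q f₁ f₂ f₃ lam p b c) {τ : ℝ} (hτ : 0 < τ) :
    HasDerivAt (modeEnergy lam p b c)
      (2 * (p τ / τ) * (modeRhs q f₁ f₂ f₃ lam τ (p τ) (b τ) (c τ) - p τ / τ / τ)
        - 16 * lam * τ / (τ ^ 2 + 1) ^ 3 * (b τ + p τ * Real.log τ) ^ 2
        + (1 + 4 * lam / (τ ^ 2 + 1) ^ 2) * (2 * (b τ + p τ * Real.log τ) * (p τ / τ))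
        + 4 * τ * c τ * (b τ + p τ * Real.log τ)) τ := by
  have hτ' : τ ≠ 0 := hτ.ne'
  have h1 := ((hm.deriv_p τ hτ).div (hasDerivAt_id τ) hτ').pow 2
  have ha := (hm.deriv_b τ hτ).add ((hm.deriv_p τ hτ).mul (Real.hasDerivAt_log hτ'))
  have hd : HasDerivAt (fun t : ℝ => (t ^ 2 + 1) ^ 2) (2 * (τ ^ 2 + 1) * (2 * τ)) τ := by
    have := (((hasDerivAt_id τ).pow 2).add_const 1).pow 2
    exact this.congr_deriv (by simp)
  have hw := ((hasDerivAt_const τ (4 * lam)).div hd (by positivity)).const_add 1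
  have h := (h1.add (hw.mul (ha.pow 2))).add ((hm.deriv_c τ hτ).pow 2)
  refine h.congr_deriv ?_
  simp only [id, Pi.add_apply, Pi.mul_apply, Pi.div_apply, Pi.pow_apply, Nat.add_one_sub_one,
    pow_one, Nat.cast_ofNat]
  generalize modeRhs q f₁ f₂ f₃ lam τ (p τ) (b τ) (c τ) = G
  have h2 : τ ^ 2 + 1 ≠ 0 := by positivity
  field_simp
  ring

/-- With `A = p / τ = a'`, the damping term `-2 A² / τ` and the term from the decreasing wave speed
are nonpositive. The remaining cross terms have coefficients bounded on `(0, T]` without reference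
to `lam`. -/
theorem BddCoeff.modeEnergy_deriv_le (hF : BddCoeff f₁ f₂ f₃) (q T : ℝ) (hT : 0 ≤ T) : ∃ K, 0 ≤ K ∧
    ∀ lam, 0 ≤ lam → ∀ τ ∈ Ioc 0 T, ∀ p a c : ℝ, ∀ G : ℝ,
      G = -(4 * q + 4 * lam / (τ ^ 2 + 1) ^ 2) * a + f₁ τ * p + f₂ τ * τ ^ 2 * a + f₃ τ * c →
      2 * (p / τ) * (G - p / τ / τ) - 16 * lam * τ / (τ ^ 2 + 1) ^ 3 * a ^ 2
        + (1 + 4 * lam / (τ ^ 2 + 1) ^ 2) * (2 * a * (p / τ)) + 4 * τ * c * a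
      ≤ K * ((p / τ) ^ 2 + (1 + 4 * lam / (τ ^ 2 + 1) ^ 2) * a ^ 2 + c ^ 2) := by
  obtain ⟨F, hF0, hF⟩ := hF T
  refine ⟨|1 - 4 * q| + 2 * F * T + F * T ^ 2 + F + 2 * T, by positivity,
    fun lam hl τ hτ p a c G hG => ?_⟩
  obtain ⟨h1, h2, h3⟩ := hF τ hτ
  obtain ⟨A, hA⟩ : ∃ A, A = p / τ := ⟨_, rfl⟩
  have hp : p = τ * A := by rw [hA]; field_simp [hτ.1.ne']
  have hτ0 := hτ.1
  rw [← hA]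
  set w := 4 * lam / (τ ^ 2 + 1) ^ 2 with hw
  have hw0 : 0 ≤ w := by positivity
  have hw' : 0 ≤ 16 * lam * τ / (τ ^ 2 + 1) ^ 3 := by positivity
  have hAt : 0 ≤ A * (A / τ) := by
    have : A * (A / τ) = A ^ 2 / τ := by ring
    rw [this]; positivity
  have hxy : ∀ k C x y : ℝ, |k| ≤ C → 2 * k * (x * y) ≤ C * (x ^ 2 + y ^ 2) := by
    intro k C x y hk
    have e1 : 2 * |x * y| ≤ x ^ 2 + y ^ 2 := by
      rw [abs_mul, ← sq_abs x, ← sq_abs y]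
      nlinarith [sq_nonneg (|x| - |y|)]
    have e2 : k * (x * y) ≤ |k| * |x * y| := (le_abs_self _).trans (abs_mul _ _).le
    nlinarith [mul_le_mul_of_nonneg_right hk (abs_nonneg (x * y)), abs_nonneg k,
      mul_le_mul_of_nonneg_left e1 ((abs_nonneg k).trans hk)]
  have ht2 : τ ^ 2 ≤ T ^ 2 := pow_le_pow_left₀ hτ.1.le hτ.2 2
  have m1 := hxy (1 - 4 * q) _ a A le_rfl
  have m2 := hxy (f₁ τ * τ) (F * T) A A (by
    rw [abs_mul, abs_of_pos hτ0]; exact mul_le_mul h1 hτ.2 hτ0.le hF0)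
  have m3 := hxy (f₂ τ * τ ^ 2) (F * T ^ 2) a A (by
    rw [abs_mul, abs_of_nonneg (sq_nonneg τ)]; exact mul_le_mul h2 ht2 (sq_nonneg _) hF0)
  have m4 := hxy (f₃ τ) F c A h3
  have m5 := hxy τ T a c (by rw [abs_of_pos hτ0]; exact hτ.2)
  set Q := |1 - 4 * q|
  have hQ : 0 ≤ Q := abs_nonneg _
  have k1 : 0 ≤ F * T := by positivity
  have k2 : 0 ≤ F * T ^ 2 := by positivity
  -- The term `-2 w a A` from the equation cancels `2 w a A` from differentiating `w a²`; no other
  -- cross term contains `lam`.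
  have key : 2 * A * (G - A / τ) - 16 * lam * τ / (τ ^ 2 + 1) ^ 3 * a ^ 2
        + (1 + w) * (2 * a * A) + 4 * τ * c * a =
      -2 * (A * (A / τ)) - 16 * lam * τ / (τ ^ 2 + 1) ^ 3 * a ^ 2 + 2 * (1 - 4 * q) * (a * A)
       + 2 * (f₁ τ * τ) * (A * A) + 2 * (f₂ τ * τ ^ 2) * (a * A) + 2 * f₃ τ * (c * A)
       + 2 * (2 * τ * (a * c)) := by
    rw [hG, hp]; ring
  have hw2 : 0 ≤ 16 * lam * τ / (τ ^ 2 + 1) ^ 3 * a ^ 2 := by positivity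
  have hwa : 0 ≤ (Q + 2 * F * T + F * T ^ 2 + F + 2 * T) * (w * a ^ 2) := by positivity
  rw [key]
  nlinarith [mul_nonneg hQ (sq_nonneg c), mul_nonneg k1 (sq_nonneg c), mul_nonneg k1 (sq_nonneg a),
    mul_nonneg k2 (sq_nonneg c), mul_nonneg hF0 (sq_nonneg a), mul_nonneg hT (sq_nonneg A)]

/-- At the switching time `1 / σ = 1 + lam` and `|log σ| ≤ 1 + lam`, so entering the energy costs
two powers from `1 / σ`, or two from the logarithm and one from the wave coefficient. -/
theorem modeEnergy_le_of_eq {lam σ : ℝ} (hl : 0 ≤ lam) (p b c : ℝ → ℝ) (hσ : σ = 1 / (1 + lam)) :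
    modeEnergy lam p b c σ ≤ 10 * (1 + lam) ^ 3 * (p σ ^ 2 + b σ ^ 2 + c σ ^ 2) := by
  have hL1 : 1 ≤ 1 + lam := by linarith
  have hL : 0 < 1 + lam := by linarith
  have e1 : (p σ / σ) ^ 2 = p σ ^ 2 * (1 + lam) ^ 2 := by
    rw [hσ]; field_simp
  have hlog : Real.log σ ^ 2 ≤ (1 + lam) ^ 2 := by
    rw [hσ, one_div, Real.log_inv, neg_sq]
    exact pow_le_pow_left₀ (Real.log_nonneg hL1) ((Real.log_le_sub_one_of_pos hL).trans
      (by linarith)) 2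
  have e2 : (b σ + p σ * Real.log σ) ^ 2 ≤ 2 * (b σ ^ 2 + p σ ^ 2 * (1 + lam) ^ 2) := by
    have := mul_le_mul_of_nonneg_left hlog (sq_nonneg (p σ))
    have := sq_nonneg (b σ - p σ * Real.log σ)
    linarith
  have hw : 1 + 4 * lam / (σ ^ 2 + 1) ^ 2 ≤ 4 * (1 + lam) := by
    have : 4 * lam / (σ ^ 2 + 1) ^ 2 ≤ 4 * lam := div_le_self (by positivity)
      (one_le_pow₀ (by linarith [sq_nonneg σ]))
    linarith
  unfold modeEnergy
  rw [e1]
  generalize 1 + lam = L at *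
  have e3 : (1 + 4 * lam / (σ ^ 2 + 1) ^ 2) * (b σ + p σ * Real.log σ) ^ 2 ≤
      4 * L * (2 * (b σ ^ 2 + p σ ^ 2 * L ^ 2)) :=
    mul_le_mul hw e2 (sq_nonneg _) (by positivity)
  have hL23 : L ^ 2 ≤ L ^ 3 := pow_le_pow_right₀ hL1 (by norm_num)
  have hL13 : L ≤ L ^ 3 := le_self_pow₀ hL1 (by norm_num)
  have hL3 : 1 ≤ L ^ 3 := one_le_pow₀ hL1
  have u1 := mul_le_mul_of_nonneg_left hL23 (sq_nonneg (p σ))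
  have u2 := mul_le_mul_of_nonneg_left hL13 (sq_nonneg (b σ))
  have u3 := mul_le_mul_of_nonneg_left hL3 (sq_nonneg (c σ))
  have u4 : 0 ≤ L ^ 3 * p σ ^ 2 := by positivity
  have u5 : 0 ≤ L ^ 3 * b σ ^ 2 := by positivity
  have u6 : 0 ≤ L ^ 3 * c σ ^ 2 := by positivity
  linarith

/-- Leaving the energy costs nothing in `lam`: `p = τ a'` and `b = a - τ log τ a'`, with `τ log τ`
bounded on `(0, T]`. -/
theorem sq_le_modeEnergy {lam τ T M : ℝ} (hl : 0 ≤ lam) (hτ : 0 < τ) (hT : τ ≤ T)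
    (hM : τ * (1 + |Real.log τ|) ^ 2 ≤ M) (p b c : ℝ → ℝ) :
    p τ ^ 2 + b τ ^ 2 + c τ ^ 2 ≤ (T ^ 2 + 3 + 2 * M ^ 2) * modeEnergy lam p b c τ := by
  obtain ⟨A, hA⟩ : ∃ A, A = p τ / τ := ⟨_, rfl⟩
  have hp : p τ = τ * A := by rw [hA]; field_simp
  obtain ⟨a, ha⟩ : ∃ a, a = b τ + p τ * Real.log τ := ⟨_, rfl⟩
  have hb : b τ = a - τ * Real.log τ * A := by rw [ha, hp]; ring
  have hEn : A ^ 2 + a ^ 2 + c τ ^ 2 ≤ modeEnergy lam p b c τ := by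
    unfold modeEnergy
    rw [← hA, ← ha]
    have : 0 ≤ 4 * lam / (τ ^ 2 + 1) ^ 2 * a ^ 2 := by positivity
    linarith
  have hm1 : (τ * Real.log τ) ^ 2 ≤ M ^ 2 := by
    rw [← sq_abs]
    refine pow_le_pow_left₀ (abs_nonneg _) ?_ 2
    rw [abs_mul, abs_of_pos hτ]
    refine le_trans ?_ ((mul_log_le_mul_logSq hτ.le).trans hM)
    exact mul_le_mul_of_nonneg_left (by linarith) hτ.le
  have ht2 : τ ^ 2 ≤ T ^ 2 := pow_le_pow_left₀ hτ.le hT 2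
  have g1 : p τ ^ 2 ≤ T ^ 2 * A ^ 2 := by
    rw [hp, mul_pow]
    exact mul_le_mul_of_nonneg_right ht2 (sq_nonneg A)
  have g2 : b τ ^ 2 ≤ 2 * a ^ 2 + 2 * M ^ 2 * A ^ 2 := by
    rw [hb]
    have := sq_nonneg (a + τ * Real.log τ * A)
    have := mul_le_mul_of_nonneg_right hm1 (sq_nonneg A)
    linarith
  have k1 : 0 ≤ T ^ 2 * a ^ 2 := by positivity
  have k2 : 0 ≤ T ^ 2 * c τ ^ 2 := by positivity
  have k3 : 0 ≤ M ^ 2 * a ^ 2 := by positivity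
  have k4 : 0 ≤ M ^ 2 * c τ ^ 2 := by positivity
  have k5 := mul_le_mul_of_nonneg_left hEn (by positivity : 0 ≤ T ^ 2 + 3 + 2 * M ^ 2)
  linarith [sq_nonneg A, sq_nonneg a, sq_nonneg (c τ)]

/-- Modes grow at most polynomially in the eigenvalue, locally uniformly in time. -/
theorem BddCoeff.mode_growth (hF : BddCoeff f₁ f₂ f₃) (q T : ℝ) : ∃ K, 0 ≤ K ∧
    ∀ lam, 0 ≤ lam → ∀ p b c, IsMode q f₁ f₂ f₃ lam p b c → ∀ τ ∈ Icc 0 T,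
      p τ ^ 2 + b τ ^ 2 + c τ ^ 2 ≤ K * (1 + lam) ^ 3 * (p 0 ^ 2 + b 0 ^ 2 + c 0 ^ 2) := by
  wlog hT : 0 ≤ T
  · exact ⟨0, le_rfl, fun lam _ p b c _ τ hτ => absurd (hτ.1.trans hτ.2) hT⟩
  obtain ⟨K₁, hK₁, h1⟩ := hF.mode_growth_small q
  obtain ⟨K₂, hK₂, h2⟩ := hF.modeEnergy_deriv_le q T hT
  obtain ⟨M, hM, hφ⟩ := exists_mul_logSq_le T
  set X := Real.exp (K₂ * T) with hX
  have hX0 : 0 < X := Real.exp_pos _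
  refine ⟨K₁ + (T ^ 2 + 3 + 2 * M ^ 2) * (10 * K₁ * X), by positivity,
    fun lam hl p b c hm τ hτ => ?_⟩
  set N₀ := p 0 ^ 2 + b 0 ^ 2 + c 0 ^ 2 with hN₀
  have hN₀' : 0 ≤ N₀ := by positivity
  have hL1 : 1 ≤ 1 + lam := by linarith
  have hL : 0 < 1 + lam := by linarith
  set L := 1 + lam with hLd
  have hL3 : 1 ≤ L ^ 3 := one_le_pow₀ hL1
  have hsplit : (K₁ + (T ^ 2 + 3 + 2 * M ^ 2) * (10 * K₁ * X)) * L ^ 3 * N₀ =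
    K₁ * N₀ * L ^ 3 + (T ^ 2 + 3 + 2 * M ^ 2) * (10 * K₁ * X * L ^ 3 * N₀) := by ring
  rw [hsplit]
  have hY : 0 ≤ (T ^ 2 + 3 + 2 * M ^ 2) * (10 * K₁ * X * L ^ 3 * N₀) := by positivity
  have hY' : 0 ≤ K₁ * N₀ * L ^ 3 := by positivity
  rcases le_total τ (1 / L) with hs | hs
  · have := h1 lam hl p b c hm τ ⟨hτ.1, hs⟩
    have h3 : K₁ * N₀ ≤ K₁ * N₀ * L ^ 3 := le_mul_of_one_le_right (by positivity) hL3
    linarith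
  -- Beyond `1 / L`, run the energy estimate from that time on, starting from the bound already
  -- available there.
  · have hσ : 0 < 1 / L := by positivity
    set σ := 1 / L with hσd
    have hτ0 : 0 < τ := hσ.trans_le hs
    have hcont : ContinuousOn (modeEnergy lam p b c) (Icc σ T) := fun t ht =>
      (hm.hasDerivAt_modeEnergy (hσ.trans_le ht.1)).continuousAt.continuousWithinAt
    have hE := le_mul_exp_of_deriv_le (K := K₂) hcont
      (fun t ht => hm.hasDerivAt_modeEnergy (hσ.trans ht.1))
      (fun t ht => h2 lam hl t ⟨hσ.trans ht.1, ht.2.le⟩ (p t) (b t + p t * Real.log t) (c t) _ rfl)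
      (x := τ) ⟨hs, hτ.2⟩
    have hE1 := modeEnergy_le_of_eq hl p b c hσd
    have hN1 := h1 lam hl p b c hm σ ⟨hσ.le, le_rfl⟩
    have hE2 : modeEnergy lam p b c τ ≤ 10 * K₁ * X * L ^ 3 * N₀ := by
      have h0 : 0 ≤ modeEnergy lam p b c σ := by unfold modeEnergy; positivity
      calc _ ≤ _ := hE
        _ ≤ modeEnergy lam p b c σ * X := by
            refine mul_le_mul_of_nonneg_left (Real.exp_le_exp.mpr ?_) h0
            exact mul_le_mul_of_nonneg_left (by linarith [hτ.2]) hK₂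
        _ ≤ 10 * L ^ 3 * (K₁ * N₀) * X := by
            refine mul_le_mul_of_nonneg_right (hE1.trans ?_) hX0.le
            gcongr
        _ = _ := by ring
    have hN := sq_le_modeEnergy hl hτ0 hτ.2 (hφ τ hτ) p b c
    have := mul_le_mul_of_nonneg_left hE2 (by positivity : 0 ≤ T ^ 2 + 3 + 2 * M ^ 2)
    linarith

/-! ### Existence, uniqueness and initial rates of modes -/

theorem BddCoeff.exists_mode (hF : BddCoeff f₁ f₂ f₃) (hf₁ : ContinuousOn f₁ (Ioi 0))
    (hf₂ : ContinuousOn f₂ (Ioi 0)) (hf₃ : ContinuousOn f₃ (Ioi 0)) (q : ℝ) {lam : ℝ}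
    (hl : 0 ≤ lam) (o h c₀ : ℝ) : ∃ p b c, IsMode q f₁ f₂ f₃ lam p b c ∧
      p 0 = o ∧ b 0 = h ∧ c 0 = c₀ := by
  set f : ℝ → (Fin 3 → ℝ) → Fin 3 → ℝ := fun t y =>
    ![t * modeRhs q f₁ f₂ f₃ lam t (y 0) (y 1) (y 2),
      -(t * Real.log t) * modeRhs q f₁ f₂ f₃ lam t (y 0) (y 1) (y 2),
      2 * t * (y 1 + y 0 * Real.log t)] with hf
  have h0 : ∀ t, f t 0 = 0 := fun t => by
    ext i; fin_cases i <;> simp [hf, modeRhs]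
  have hsub : ∀ t x y, f t x - f t y = f t (x - y) := fun t x y => by
    ext i; fin_cases i <;> simp [hf, modeRhs] <;> ring
  -- Every component carries a factor `t`, so the field is zero at `t = 0` whatever the values of
  -- the coefficients and of `Real.log` there. Continuity at `0` follows from the bound `t (1 + |log
  -- t|)²`.
  have hz : ∀ y, f 0 y = 0 := fun y => by
    ext i; fin_cases i <;> simp [hf]
  have hbd : ∀ T : ℝ, ∃ K, 0 ≤ K ∧ ∀ t ∈ Icc 0 T, ∀ y,
      ‖f t y‖ ≤ K * (t * (1 + |Real.log t|) ^ 2) * ‖y‖ := by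
    intro T
    obtain ⟨K, hK, hb⟩ := hF.mode_field_le q T
    refine ⟨3 * (K * (1 + lam)), by positivity, fun t ht y => ?_⟩
    rcases ht.1.eq_or_lt with rfl | ht0
    · simp [hz]
    · obtain ⟨a1, a2, a3⟩ := hb lam hl t ⟨ht0, ht.2⟩ (y 0) (y 1) (y 2)
      have hs : |y 0| + |y 1| + |y 2| ≤ 3 * ‖y‖ := by
        have := norm_le_pi_norm y 0
        have := norm_le_pi_norm y 1
        have := norm_le_pi_norm y 2
        simp only [Real.norm_eq_abs] at *
        linarith
      have hX : K * (1 + lam) * (t * (1 + |Real.log t|) ^ 2) * (|y 0| + |y 1| + |y 2|) ≤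
          3 * (K * (1 + lam)) * (t * (1 + |Real.log t|) ^ 2) * ‖y‖ := by
        calc _ ≤ K * (1 + lam) * (t * (1 + |Real.log t|) ^ 2) * (3 * ‖y‖) := by gcongr
          _ = _ := by ring
      rw [pi_norm_le_iff_of_nonneg (by positivity)]
      intro i
      fin_cases i
      · exact a1.trans hX
      · exact a2.trans hX
      · exact a3.trans hX
  have hc : ∀ y, ContinuousOn (fun t => f t y) (Ici 0) := by
    intro y t ht
    rcases (mem_Ici.mp ht).eq_or_lt with rfl | ht0
    · obtain ⟨K, hK, hb⟩ := hbd 1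
      rw [ContinuousWithinAt, hz, tendsto_zero_iff_norm_tendsto_zero]
      have hlim : Tendsto (fun t : ℝ => K * (t * (1 + |Real.log t|) ^ 2) * ‖y‖)
          (𝓝[Ici 0] 0) (𝓝 0) := by
        simpa using (tendsto_mul_logSq.const_mul K).mul_const ‖y‖
      refine squeeze_zero' (Eventually.of_forall fun t => norm_nonneg _) ?_ hlim
      have : Icc (0:ℝ) 1 ∈ 𝓝[Ici 0] (0:ℝ) :=
        mem_nhdsWithin.mpr ⟨Iio 1, isOpen_Iio, by simp, fun s hs => ⟨hs.2, (mem_Iio.mp hs.1).le⟩⟩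
      filter_upwards [this] with t ht using hb t ht y
    · have hlog : ContinuousAt Real.log t := Real.continuousAt_log ht0.ne'
      have g1 := hf₁.continuousAt (Ioi_mem_nhds ht0)
      have g2 := hf₂.continuousAt (Ioi_mem_nhds ht0)
      have g3 := hf₃.continuousAt (Ioi_mem_nhds ht0)
      have hw : ContinuousAt (fun t : ℝ => 4 * lam / (t ^ 2 + 1) ^ 2) t :=
        ContinuousAt.div (by fun_prop) (by fun_prop) (by positivity)
      have hG : ContinuousAt (fun t => modeRhs q f₁ f₂ f₃ lam t (y 0) (y 1) (y 2)) t := by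
        unfold modeRhs
        fun_prop
      apply ContinuousAt.continuousWithinAt
      rw [continuousAt_pi]
      intro i
      fin_cases i
      · exact continuousAt_id.mul hG
      · exact (continuousAt_id.mul hlog).neg.mul hG
      · exact (continuousAt_const.mul continuousAt_id).mul
          (continuousAt_const.add (continuousAt_const.mul hlog))
  have hK : ∀ T, ∃ K : NNReal, ∀ t ∈ Icc 0 T, LipschitzWith K (f t) := by
    intro T
    obtain ⟨K, hK, hb⟩ := hbd T
    obtain ⟨M, hM, hφ⟩ := exists_mul_logSq_le T
    refine ⟨⟨K * M, by positivity⟩, fun t ht => LipschitzWith.of_dist_le_mul fun x y => ?_⟩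
    rw [dist_eq_norm, dist_eq_norm, hsub]
    refine (hb t ht _).trans ?_
    have := mul_le_mul_of_nonneg_left (hφ t ht) hK
    exact mul_le_mul_of_nonneg_right this (norm_nonneg _)
  obtain ⟨y, hy0, hy⟩ := exists_linear_ode hc hK h0 ![o, h, c₀]
  have hyi : ∀ i t, 0 ≤ t → HasDerivWithinAt (fun s => y s i) (f t (y t) i) (Ici 0) t :=
    fun i t ht => hasDerivWithinAt_pi.mp (hy t ht) i
  refine ⟨fun t => y t 0, fun t => y t 1, fun t => y t 2, ?_, by simp [hy0], by simp [hy0],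
    by simp [hy0]⟩
  exact
    { deriv_p := fun τ hτ => (hyi 0 τ hτ.le).hasDerivAt (Ici_mem_nhds hτ)
      deriv_b := fun τ hτ => (hyi 1 τ hτ.le).hasDerivAt (Ici_mem_nhds hτ)
      deriv_c := fun τ hτ => (hyi 2 τ hτ.le).hasDerivAt (Ici_mem_nhds hτ)
      cont_p := fun τ hτ => (hyi 0 τ hτ).continuousWithinAt
      cont_b := fun τ hτ => (hyi 1 τ hτ).continuousWithinAt
      cont_c := fun τ hτ => (hyi 2 τ hτ).continuousWithinAt }

theorem IsMode.eq_zero (hF : BddCoeff f₁ f₂ f₃) {lam : ℝ} (hl : 0 ≤ lam) {p b c : ℝ → ℝ}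
    (hm : IsMode q f₁ f₂ f₃ lam p b c) (hp : p 0 = 0) (hb : b 0 = 0) (hc : c 0 = 0) {τ : ℝ}
    (hτ : 0 ≤ τ) : p τ = 0 ∧ b τ = 0 ∧ c τ = 0 := by
  obtain ⟨K, -, h⟩ := hF.mode_growth q τ
  have h := h lam hl p b c hm τ ⟨hτ, le_rfl⟩
  simp only [hp, hb, hc, ne_eq, OfNat.ofNat_ne_zero, not_false_eq_true, zero_pow, add_zero,
    mul_zero] at h
  have h1 := sq_nonneg (p τ)
  have h2 := sq_nonneg (b τ)
  have h3 := sq_nonneg (c τ)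
  exact ⟨pow_eq_zero_iff two_ne_zero |>.mp (by linarith),
    pow_eq_zero_iff two_ne_zero |>.mp (by linarith),
    pow_eq_zero_iff two_ne_zero |>.mp (by linarith)⟩

theorem BddCoeff.mode_abs_le (hF : BddCoeff f₁ f₂ f₃) (q T : ℝ) : ∃ K, 0 ≤ K ∧
    ∀ lam, 0 ≤ lam → ∀ p b c, IsMode q f₁ f₂ f₃ lam p b c → ∀ τ ∈ Icc 0 T,
      |p τ| + |b τ| + |c τ| ≤ K * (1 + lam) ^ 3 * (1 + (p 0 ^ 2 + b 0 ^ 2 + c 0 ^ 2)) := by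
  obtain ⟨K, hK, h⟩ := hF.mode_growth q T
  refine ⟨K + 2, by positivity, fun lam hl p b c hm τ hτ => ?_⟩
  have h := h lam hl p b c hm τ hτ
  set N₀ := p 0 ^ 2 + b 0 ^ 2 + c 0 ^ 2 with hN₀
  have hN₀' : 0 ≤ N₀ := by positivity
  have hL : (1:ℝ) ≤ (1 + lam) ^ 3 := one_le_pow₀ (by linarith)
  generalize (1 + lam) ^ 3 = L at *
  have e : ∀ x : ℝ, 2 * |x| ≤ 1 + x ^ 2 := fun x => by
    nlinarith [sq_nonneg (|x| - 1), sq_abs x]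
  have := e (p τ)
  have := e (b τ)
  have := e (c τ)
  have h1 : 0 ≤ K * L := by positivity
  have h2 : 0 ≤ K * L * N₀ := by positivity
  have h3 : 0 ≤ L * N₀ := by positivity
  nlinarith

/-- Writing `s = τ u` with `u ≤ 1` splits the logarithm, so these weights are increasing up to a
constant. The mean value theorem in `BddCoeff.mode_rate` yields an unknown intermediate time that
has to be replaced by `τ`. -/
theorem mul_log_pow_le {M : ℝ} (hM : ∀ u ∈ Icc (0:ℝ) 1, u * (1 + |Real.log u|) ^ 2 ≤ M) {s τ : ℝ}
    (hs : 0 < s) (hsτ : s ≤ τ) {j : ℕ} (hj : j ≤ 2) :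
    s * (1 + |Real.log s|) ^ j ≤ M * (τ * (1 + |Real.log τ|) ^ j) := by
  have hτ : 0 < τ := hs.trans_le hsτ
  have hu0 : 0 < s / τ := by positivity
  have hu1 : s / τ ≤ 1 := (div_le_one hτ).mpr hsτ
  have h1 := hM (s / τ) ⟨hu0.le, hu1⟩
  have hlog : Real.log s = Real.log τ + Real.log (s / τ) := by
    rw [← Real.log_mul hτ.ne' hu0.ne']
    congr 1
    field_simp
  have h2 : 1 + |Real.log s| ≤ (1 + |Real.log τ|) * (1 + |Real.log (s / τ)|) := by
    have := abs_add_le (Real.log τ) (Real.log (s / τ))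
    rw [← hlog] at this
    have := mul_nonneg (abs_nonneg (Real.log τ)) (abs_nonneg (Real.log (s / τ)))
    linarith
  have h3 : s / τ * (1 + |Real.log (s / τ)|) ^ j ≤ M := by
    refine le_trans ?_ h1
    gcongr
    linarith [abs_nonneg (Real.log (s / τ))]
  calc s * (1 + |Real.log s|) ^ j
      ≤ s * ((1 + |Real.log τ|) * (1 + |Real.log (s / τ)|)) ^ j := by gcongr
    _ = s / τ * (1 + |Real.log (s / τ)|) ^ j * (τ * (1 + |Real.log τ|) ^ j) := by
        rw [mul_pow]; field_simp
    _ ≤ _ := by gcongr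

/-- Apply the mean value theorem on `[0, τ]` to `p` and `b`. The eigenvalue enters with power `3`
from the growth of the mode and `1` from the right-hand side. -/
theorem BddCoeff.mode_rate (hF : BddCoeff f₁ f₂ f₃) (q T : ℝ) : ∃ K, 0 ≤ K ∧
    ∀ lam, 0 ≤ lam → ∀ p b c, IsMode q f₁ f₂ f₃ lam p b c → ∀ τ ∈ Ioc 0 T,
      |p τ - p 0| ≤ K * (1 + lam) ^ 4 * (1 + (p 0 ^ 2 + b 0 ^ 2 + c 0 ^ 2)) *
        (τ * (τ * (1 + |Real.log τ|))) ∧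
      |b τ - b 0| ≤ K * (1 + lam) ^ 4 * (1 + (p 0 ^ 2 + b 0 ^ 2 + c 0 ^ 2)) *
        (τ * (τ * (1 + |Real.log τ|) ^ 2)) := by
  obtain ⟨K₁, hK₁, h1⟩ := hF.mode_abs_le q T
  obtain ⟨K₂, hK₂, h2⟩ := hF.modeRhs_le q T
  obtain ⟨M, hM, hφ⟩ := exists_mul_logSq_le 1
  refine ⟨K₂ * K₁ * M, by positivity, fun lam hl p b c hm τ hτ => ?_⟩
  set N₀ := 1 + (p 0 ^ 2 + b 0 ^ 2 + c 0 ^ 2) with hN₀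
  have hN₀' : 0 ≤ N₀ := by positivity
  have hG : ∀ s ∈ Ioo 0 τ, |modeRhs q f₁ f₂ f₃ lam s (p s) (b s) (c s)| ≤
      K₂ * K₁ * (1 + lam) ^ 4 * N₀ * (1 + |Real.log s|) := fun s hs => by
    have hsT : s ≤ T := hs.2.le.trans hτ.2
    calc _ ≤ _ := h2 lam hl s ⟨hs.1, hsT⟩ (p s) (b s) (c s)
      _ ≤ K₂ * (1 + lam) * (1 + |Real.log s|) * (K₁ * (1 + lam) ^ 3 * N₀) := by
          gcongr
          exact h1 lam hl p b c hm s ⟨hs.1.le, hsT⟩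
      _ = _ := by ring
  have hsub : Icc 0 τ ⊆ Ici (0:ℝ) := fun s hs => hs.1
  constructor
  · obtain ⟨s, hs, he⟩ := exists_hasDerivAt_eq_slope p _ hτ.1 (hm.cont_p.mono hsub)
      fun s hs => hm.deriv_p s hs.1
    rw [sub_zero, eq_div_iff hτ.1.ne'] at he
    rw [← he, abs_mul, abs_mul, abs_of_pos hτ.1, abs_of_pos hs.1]
    calc _ ≤ s * (K₂ * K₁ * (1 + lam) ^ 4 * N₀ * (1 + |Real.log s|)) * τ := by
          gcongr
          · exact hτ.1.le
          · exact hs.1.le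
          · exact hG s hs
      _ = K₂ * K₁ * (1 + lam) ^ 4 * N₀ * τ * (s * (1 + |Real.log s|) ^ 1) := by ring
      _ ≤ K₂ * K₁ * (1 + lam) ^ 4 * N₀ * τ * (M * (τ * (1 + |Real.log τ|) ^ 1)) := by
          have := mul_log_pow_le hφ hs.1 hs.2.le (j := 1) (by norm_num)
          have := hτ.1
          gcongr
      _ = _ := by ring
  · obtain ⟨s, hs, he⟩ := exists_hasDerivAt_eq_slope b _ hτ.1 (hm.cont_b.mono hsub)
      fun s hs => hm.deriv_b s hs.1
    rw [sub_zero, eq_div_iff hτ.1.ne'] at he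
    rw [← he, abs_mul, abs_mul, abs_neg, abs_mul, abs_of_pos hτ.1, abs_of_pos hs.1]
    calc _ ≤ s * (1 + |Real.log s|) * (K₂ * K₁ * (1 + lam) ^ 4 * N₀ * (1 + |Real.log s|)) * τ := by
          have := hτ.1
          have := hs.1
          gcongr
          · linarith
          · exact hG s hs
      _ = K₂ * K₁ * (1 + lam) ^ 4 * N₀ * τ * (s * (1 + |Real.log s|) ^ 2) := by ring
      _ ≤ K₂ * K₁ * (1 + lam) ^ 4 * N₀ * τ * (M * (τ * (1 + |Real.log τ|) ^ 2)) := by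
          have := mul_log_pow_le hφ hs.1 hs.2.le (j := 2) le_rfl
          have := hτ.1
          gcongr
      _ = _ := by ring

/-! ### Summing the modes to a solution -/

/-- Modes for all eigenvalues of the sphere with the same initial data. -/
structure IsModeFamily (n : ℕ) (q : ℝ) (f₁ f₂ f₃ : ℝ → ℝ) (o h c₀ : ℝ)
    (p b c : ℕ → ℝ → ℝ) : Prop where
  mode : ∀ k, IsMode q f₁ f₂ f₃ (eig n k) (p k) (b k) (c k)
  init_p : ∀ k, p k 0 = o
  init_b : ∀ k, b k 0 = h
  init_c : ∀ k, c k 0 = c₀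

theorem BddCoeff.exists_modeFamily (hF : BddCoeff f₁ f₂ f₃) (hf₁ : ContinuousOn f₁ (Ioi 0))
    (hf₂ : ContinuousOn f₂ (Ioi 0)) (hf₃ : ContinuousOn f₃ (Ioi 0)) (n : ℕ) (q o h c₀ : ℝ) :
    ∃ p b c, IsModeFamily n q f₁ f₂ f₃ o h c₀ p b c := by
  choose p b c hm hp hb hc using fun k =>
    hF.exists_mode hf₁ hf₂ hf₃ q (eig_nonneg n k) o h c₀
  exact ⟨p, b, c, hm, hp, hb, hc⟩

variable {o h c₀ : ℝ} {p b c : ℕ → ℝ → ℝ}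

theorem one_add_eig_pow_le (n k j : ℕ) :
    (1 + eig n k) ^ j ≤ ((n : ℝ) + 2) ^ j * ((k : ℝ) + 1) ^ (2 * j) := by
  rw [pow_mul, ← mul_pow]
  refine pow_le_pow_left₀ (by linarith [eig_nonneg n k]) ?_ j
  have h1 := eig_le n k
  have h2 : (1:ℝ) ≤ ((k : ℝ) + 1) ^ 2 := one_le_pow₀ (by linarith [(Nat.cast_nonneg k : (0:ℝ) ≤ k)])
  linarith

theorem IsModeFamily.abs_le (hF : BddCoeff f₁ f₂ f₃)
    (hm : IsModeFamily n q f₁ f₂ f₃ o h c₀ p b c) (T : ℝ) : ∃ (C : ℝ) (m : ℕ), 0 ≤ C ∧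
      ∀ k, ∀ τ ∈ Icc 0 T, |p k τ| + |b k τ| + |c k τ| ≤ C * ((k : ℝ) + 1) ^ m := by
  obtain ⟨K, hK, hb⟩ := hF.mode_abs_le q T
  refine ⟨K * ((n : ℝ) + 2) ^ 3 * (1 + (o ^ 2 + h ^ 2 + c₀ ^ 2)), 2 * 3, by positivity,
    fun k τ hτ => ?_⟩
  have := hb _ (eig_nonneg n k) _ _ _ (hm.mode k) τ hτ
  rw [hm.init_p, hm.init_b, hm.init_c] at this
  refine this.trans ?_
  calc _ ≤ K * (((n : ℝ) + 2) ^ 3 * ((k : ℝ) + 1) ^ (2 * 3)) * (1 + (o ^ 2 + h ^ 2 + c₀ ^ 2)) := by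
        gcongr
        exact one_add_eig_pow_le n k 3
    _ = _ := by ring

theorem IsModeFamily.rate (hF : BddCoeff f₁ f₂ f₃)
    (hm : IsModeFamily n q f₁ f₂ f₃ o h c₀ p b c) (T : ℝ) : ∃ (C : ℝ) (m : ℕ), 0 ≤ C ∧
      ∀ k, ∀ τ ∈ Ioc 0 T,
        |p k τ - o| ≤ C * ((k : ℝ) + 1) ^ m * (τ * (τ * (1 + |Real.log τ|))) ∧
        |b k τ - h| ≤ C * ((k : ℝ) + 1) ^ m * (τ * (τ * (1 + |Real.log τ|) ^ 2)) := by
  obtain ⟨K, hK, hb⟩ := hF.mode_rate q T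
  refine ⟨K * ((n : ℝ) + 2) ^ 4 * (1 + (o ^ 2 + h ^ 2 + c₀ ^ 2)), 2 * 4, by positivity,
    fun k τ hτ => ?_⟩
  have := hb _ (eig_nonneg n k) _ _ _ (hm.mode k) τ hτ
  rw [hm.init_p, hm.init_b, hm.init_c] at this
  have e : K * (1 + eig n k) ^ 4 * (1 + (o ^ 2 + h ^ 2 + c₀ ^ 2)) ≤
      K * ((n : ℝ) + 2) ^ 4 * (1 + (o ^ 2 + h ^ 2 + c₀ ^ 2)) * ((k : ℝ) + 1) ^ (2 * 4) := by
    calc _ ≤ K * (((n : ℝ) + 2) ^ 4 * ((k : ℝ) + 1) ^ (2 * 4)) *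
          (1 + (o ^ 2 + h ^ 2 + c₀ ^ 2)) := by
          gcongr
          exact one_add_eig_pow_le n k 4
      _ = _ := by ring
  have hτ0 := hτ.1
  exact ⟨this.1.trans (by gcongr), this.2.trans (by gcongr)⟩

/-- Bootstrap through the ODE: the derivatives of `p`, `b`, `c` are polynomial expressions in `p`,
`b`, `c`, the eigenvalue and smooth functions of `τ`, so tameness of order `m` gives order `m + 1`.
-/
theorem IsModeFamily.tameN (hF : BddCoeff f₁ f₂ f₃)
    (hf₁ : ContDiffOn ℝ ∞ f₁ (Ioi 0)) (hf₂ : ContDiffOn ℝ ∞ f₂ (Ioi 0))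
    (hf₃ : ContDiffOn ℝ ∞ f₃ (Ioi 0)) (hm : IsModeFamily n q f₁ f₂ f₃ o h c₀ p b c) (m : ℕ) :
    TameN m p ∧ TameN m b ∧ TameN m c := by
  have hbd : LocPolyBdd p ∧ LocPolyBdd b ∧ LocPolyBdd c := by
    refine ⟨fun s T hs => ?_, fun s T hs => ?_, fun s T hs => ?_⟩ <;>
    · obtain ⟨C, m, hC, hb⟩ := hm.abs_le hF T
      refine ⟨C, m, hC, fun k τ hτ => le_trans ?_ (hb k τ ⟨hs.le.trans hτ.1, hτ.2⟩)⟩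
      linarith [abs_nonneg (p k τ), abs_nonneg (b k τ), abs_nonneg (c k τ)]
  induction m with
  | zero => exact hbd
  | succ m ih =>
    obtain ⟨hp, hb, hc⟩ := ih
    have hlog : TameN m fun _ => Real.log := tameN_of_contDiffOn
      (Real.contDiffOn_log.mono fun τ hτ => (ne_of_gt hτ))
    have hid : TameN m fun _ τ => τ := tameN_of_contDiffOn contDiffOn_id
    have ha : TameN m fun k τ => b k τ + p k τ * Real.log τ := hb.add (hp.mul hlog)
    have hw : TameN m fun _ τ => -4 / (τ ^ 2 + 1) ^ 2 := tameN_of_contDiffOn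
      (ContDiff.contDiffOn (contDiff_const.div (by fun_prop) fun τ => by positivity))
    have hG : TameN m fun k τ => modeRhs q f₁ f₂ f₃ (eig n k) τ (p k τ) (b k τ) (c k τ) := by
      have := (((((tameN_const m (-4 * q)).add ((tameN_eig n m).mul hw)).mul ha).add
        ((tameN_of_contDiffOn hf₁).mul hp)).add
        (((tameN_of_contDiffOn hf₂).mul (hid.mul hid)).mul ha)).add
        ((tameN_of_contDiffOn hf₃).mul hc)
      convert this using 3 with k τ
      rw [modeRhs]
      ring
    refine ⟨⟨hbd.1, _, fun k => (hm.mode k).deriv_p, hid.mul hG⟩,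
      ⟨hbd.2.1, _, fun k => (hm.mode k).deriv_b, ?_⟩, ⟨hbd.2.2, _, fun k => (hm.mode k).deriv_c, ?_⟩⟩
    · have := ((tameN_const m (-1)).mul (hid.mul hlog)).mul hG
      convert this using 3 with k τ
      ring
    · exact ((tameN_const m 2).mul hid).mul ha

/-- A continuous function whose derivative has a limit at the endpoint is one-sidedly differentiable
there. -/
theorem hasDerivWithinAt_Ici_zero {f f' : ℝ → ℝ} (hf : ContinuousOn f (Ici 0))
    (hd : ∀ τ, 0 < τ → HasDerivAt f (f' τ) τ) (hf' : ContinuousOn f' (Ici 0)) {τ : ℝ}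
    (hτ : 0 ≤ τ) : HasDerivWithinAt f (f' τ) (Ici 0) τ := by
  rcases hτ.eq_or_lt with rfl | hτ
  · refine hasDerivWithinAt_Ici_of_tendsto_deriv (s := Ioi 0)
      (fun τ hτ => (hd τ hτ).differentiableAt.differentiableWithinAt)
      ((hf 0 (mem_Ici.mpr le_rfl)).mono Ioi_subset_Ici_self) self_mem_nhdsWithin ?_
    have h := (hf' 0 (mem_Ici.mpr le_rfl)).mono Ioi_subset_Ici_self
    refine Tendsto.congr' ?_ h
    filter_upwards [self_mem_nhdsWithin] with τ hτ using (hd τ hτ).deriv.symm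
  · exact (hd τ hτ).hasDerivWithinAt

theorem harmSeries_sub (hn : 1 ≤ n) {A B : ℕ → ℝ} (hA : PolyGrowth A) (hB : PolyGrowth B)
    {g : Sph n → ℝ} (hg : IsSmooth g) (x : Sph n) :
    harmSeries A g x - harmSeries B g x = harmSeries (fun k => A k - B k) g x := by
  have := (summable_harmSeries hn hA hg x).hasSum.sub (summable_harmSeries hn hB hg x).hasSum
  rw [harmSeries, harmSeries, ← this.tsum_eq, harmSeries]
  exact tsum_congr fun k => by ring

theorem harmSeries_div (B : ℕ → ℝ) (g : Sph n → ℝ) (r : ℝ) (x : Sph n) :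
    harmSeries B g x / r = harmSeries (fun k => B k / r) g x := by
  rw [harmSeries, harmSeries, ← tsum_div_const]
  exact tsum_congr fun k => by ring

theorem harmSeries_const (hn : 1 ≤ n) {g : Sph n → ℝ} (hg : IsSmooth g) (r : ℝ) (x : Sph n) :
    harmSeries (fun _ => r) g x = r * g x :=
  ((hasSum_harmProj hn hg x).mul_left r).tsum_eq

theorem PolyGrowth.const (r : ℝ) : PolyGrowth fun _ => r := ⟨|r|, 0, fun k => by simp⟩

theorem PolyGrowth.sub {A B : ℕ → ℝ} (hA : PolyGrowth A) (hB : PolyGrowth B) :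
    PolyGrowth fun k => A k - B k := by
  obtain ⟨C, m, hC⟩ := hA
  obtain ⟨D, l, hD⟩ := hB
  have hC0 : 0 ≤ C := by simpa using (abs_nonneg _).trans (hC 0)
  have hD0 : 0 ≤ D := by simpa using (abs_nonneg _).trans (hD 0)
  refine ⟨C + D, m + l, fun k => ?_⟩
  have hk1 : (1:ℝ) ≤ (k : ℝ) + 1 := by linarith [(Nat.cast_nonneg k : (0:ℝ) ≤ k)]
  calc |A k - B k| ≤ |A k| + |B k| := abs_sub _ _
    _ ≤ C * ((k : ℝ) + 1) ^ m + D * ((k : ℝ) + 1) ^ l := add_le_add (hC k) (hD k)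
    _ ≤ C * ((k : ℝ) + 1) ^ (m + l) + D * ((k : ℝ) + 1) ^ (m + l) := by
        gcongr <;> first | exact hk1 | omega
    _ = _ := by ring

theorem PolyGrowth.div_const {A : ℕ → ℝ} (hA : PolyGrowth A) (r : ℝ) :
    PolyGrowth fun k => A k / r := by
  obtain ⟨C, m, hC⟩ := hA
  refine ⟨C / |r|, m, fun k => ?_⟩
  rw [abs_div, div_mul_eq_mul_div]
  exact div_le_div_of_nonneg_right (hC k) (abs_nonneg r)

/-- Each multiplier is `C¹` up to zero, and the mean value inequality bounds its difference
quotients by the same polynomial as its derivative, so dominated convergence holds in every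
seminorm. -/
theorem isC1Curve_harmSeries (hn : 1 ≤ n) {g : Sph n → ℝ} (hg : IsSmooth g) {U V : ℕ → ℝ → ℝ}
    (hU : ∀ k, ContinuousOn (U k) (Ici 0)) (hd : ∀ k, ∀ τ, 0 < τ → HasDerivAt (U k) (V k τ) τ)
    (hV : ∀ k, ContinuousOn (V k) (Ici 0))
    (hVb : ∀ T : ℝ, ∃ (C : ℝ) (m : ℕ), ∀ k, ∀ τ ∈ Icc 0 T, |V k τ| ≤ C * ((k : ℝ) + 1) ^ m)
    (hUb : ∀ τ, 0 ≤ τ → PolyGrowth fun k => U k τ) :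
    IsC1Curve fun τ => harmSeries (fun k => U k τ) g := by
  have hVb' : ∀ τ, 0 ≤ τ → PolyGrowth fun k => V k τ := fun τ hτ => by
    obtain ⟨C, m, h⟩ := hVb τ
    exact ⟨C, m, fun k => h k τ ⟨hτ, le_rfl⟩⟩
  have hD : ∀ k, ∀ τ, 0 ≤ τ → HasDerivWithinAt (U k) (V k τ) (Ici 0) τ := fun k τ hτ =>
    hasDerivWithinAt_Ici_zero (hU k) (hd k) (hV k) hτ
  refine ⟨fun τ hτ => isSmooth_harmSeries hn (hUb τ hτ) hg, fun τ => harmSeries (fun k => V k τ) g,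
    fun τ hτ => isSmooth_harmSeries hn (hVb' τ hτ) hg, fun j τ₀ hτ₀ => ?_⟩
  obtain ⟨C, m, hC⟩ := hVb (τ₀ + 1)
  have h0mem : τ₀ ∈ Icc 0 (τ₀ + 1) := ⟨hτ₀, by linarith⟩
  have hnear : Icc 0 (τ₀ + 1) ∈ 𝓝[Ici 0] τ₀ := mem_nhdsWithin.mpr
    ⟨Iio (τ₀ + 1), isOpen_Iio, by simp, fun s hs => ⟨hs.2, (mem_Iio.mp hs.1).le⟩⟩
  have hnear' : Icc 0 (τ₀ + 1) ∈ 𝓝[Ici 0 \ {τ₀}] τ₀ := nhdsWithin_mono _ sdiff_subset hnear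
  constructor
  -- The bound `2 * C` counts the difference quotient and the value of the derivative at `τ₀`.
  · have key := tendsto_seminormC_harmSeries hn hg j (l := 𝓝[Ici 0 \ {τ₀}] τ₀)
      (B := fun τ k => (U k τ - U k τ₀) / (τ - τ₀) - V k τ₀) (C := 2 * C) (m := m) ?_ ?_
    · refine key.congr' ?_
      filter_upwards [self_mem_nhdsWithin] with τ hτ
      congr 1
      ext x
      rw [harmSeries_sub hn (hUb τ hτ.1) (hUb τ₀ hτ₀) hg, harmSeries_div,
        harmSeries_sub hn (((hUb τ hτ.1).sub (hUb τ₀ hτ₀)).div_const _) (hVb' τ₀ hτ₀) hg]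
    · filter_upwards [hnear', self_mem_nhdsWithin] with τ hτ hτ2 k
      have hne : τ - τ₀ ≠ 0 := sub_ne_zero.mpr hτ2.2
      have h1 := (convex_Icc 0 (τ₀ + 1)).norm_image_sub_le_of_norm_hasDerivWithin_le
        (fun s hs => (hD k s hs.1).mono (fun t ht => ht.1)) (fun s hs => hC k s hs) h0mem hτ
      have h2 : |(U k τ - U k τ₀) / (τ - τ₀)| ≤ C * ((k : ℝ) + 1) ^ m := by
        rw [abs_div, div_le_iff₀ (abs_pos.mpr hne)]
        exact h1
      calc _ ≤ _ := abs_sub _ _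
        _ ≤ _ := add_le_add h2 (hC k τ₀ h0mem)
        _ = _ := by ring
    · intro k
      have h1 := hasDerivWithinAt_iff_tendsto_slope.mp (hD k τ₀ hτ₀)
      have h2 := h1.sub_const (V k τ₀)
      rw [sub_self] at h2
      refine h2.congr fun τ => ?_
      rw [slope_def_field]
  · have key := tendsto_seminormC_harmSeries hn hg j (l := 𝓝[Ici 0] τ₀)
      (B := fun τ k => V k τ - V k τ₀) (C := 2 * C) (m := m) ?_ ?_
    · refine key.congr' ?_
      filter_upwards [self_mem_nhdsWithin] with τ hτ
      congr 1
      ext x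
      rw [harmSeries_sub hn (hVb' τ hτ) (hVb' τ₀ hτ₀) hg]
    · filter_upwards [hnear] with τ hτ k
      calc _ ≤ _ := abs_sub _ _
        _ ≤ _ := add_le_add (hC k τ hτ) (hC k τ₀ h0mem)
        _ = _ := by ring
    · intro k
      have h2 := (hV k τ₀ hτ₀).tendsto.sub_const (V k τ₀)
      rwa [sub_self] at h2

/-- The equation for `b` is chosen so that the two logarithmic terms cancel. -/
theorem IsMode.hasDerivAt_a {lam : ℝ} {p b c : ℝ → ℝ} (hm : IsMode q f₁ f₂ f₃ lam p b c) {τ : ℝ}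
    (hτ : 0 < τ) : HasDerivAt (fun t => b t + p t * Real.log t) (p τ / τ) τ := by
  have h := (hm.deriv_b τ hτ).add ((hm.deriv_p τ hτ).mul (Real.hasDerivAt_log hτ.ne'))
  refine h.congr_deriv ?_
  ring

theorem IsMode.hasDerivAt_da {lam : ℝ} {p b c : ℝ → ℝ} (hm : IsMode q f₁ f₂ f₃ lam p b c) {τ : ℝ}
    (hτ : 0 < τ) : HasDerivAt (fun t => p t / t)
      (modeRhs q f₁ f₂ f₃ lam τ (p τ) (b τ) (c τ) - 1 / τ * (p τ / τ)) τ := by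
  have h := (hm.deriv_p τ hτ).div (hasDerivAt_id τ) hτ.ne'
  refine h.congr_deriv ?_
  simp only [id]
  have := hτ.ne'
  field_simp

theorem IsMode.hasDerivAt_regular {lam : ℝ} {p b c : ℝ → ℝ} (hm : IsMode q f₁ f₂ f₃ lam p b c)
    (o h : ℝ) {τ : ℝ} (hτ : 0 < τ) :
    HasDerivAt (fun t => (b t - h) + (p t - o) * Real.log t) ((p τ - o) / τ) τ := by
  have h := ((hm.deriv_b τ hτ).sub_const h).add
    (((hm.deriv_p τ hτ).sub_const o).mul (Real.hasDerivAt_log hτ.ne'))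
  refine h.congr_deriv ?_
  ring

theorem IsModeFamily.regular_le (hF : BddCoeff f₁ f₂ f₃)
    (hm : IsModeFamily n q f₁ f₂ f₃ o h c₀ p b c) (T : ℝ) : ∃ (C : ℝ) (m : ℕ), 0 ≤ C ∧
      ∀ k, ∀ τ ∈ Icc 0 T,
        |(b k τ - h) + (p k τ - o) * Real.log τ| ≤
          C * (τ * (τ * (1 + |Real.log τ|) ^ 2)) * ((k : ℝ) + 1) ^ m ∧
        |(p k τ - o) / τ| ≤ C * (τ * (1 + |Real.log τ|)) * ((k : ℝ) + 1) ^ m := by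
  obtain ⟨C, m, hC, hr⟩ := hm.rate hF T
  refine ⟨2 * C, m, by positivity, fun k τ hτ => ?_⟩
  -- At `τ = 0` the conventions `log 0 = 0` and `x / 0 = 0` agree with the limits, so the bounds
  -- hold up to the endpoint.
  rcases hτ.1.eq_or_lt with rfl | hτ0
  · simp [hm.init_b]
  · obtain ⟨h1, h2⟩ := hr k τ ⟨hτ0, hτ.2⟩
    have hL := abs_nonneg (Real.log τ)
    constructor
    · have h3 : |(p k τ - o) * Real.log τ| ≤
          C * ((k : ℝ) + 1) ^ m * (τ * (τ * (1 + |Real.log τ|) ^ 2)) := by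
        rw [abs_mul]
        calc _ ≤ C * ((k : ℝ) + 1) ^ m * (τ * (τ * (1 + |Real.log τ|))) * (1 + |Real.log τ|) := by
              gcongr
              linarith
          _ = _ := by ring
      calc _ ≤ _ := abs_add_le _ _
        _ ≤ _ := add_le_add h2 h3
        _ = _ := by ring
    · rw [abs_div, abs_of_pos hτ0, div_le_iff₀ hτ0]
      refine h1.trans ?_
      have : 0 ≤ C * ((k : ℝ) + 1) ^ m * (τ * (τ * (1 + |Real.log τ|))) := by positivity
      linarith

theorem continuousOn_of_abs_le {f φ : ℝ → ℝ} (hf : ContinuousOn f (Ioi 0)) {T : ℝ} (hT : 0 < T)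
    (h : ∀ τ ∈ Icc 0 T, |f τ| ≤ φ τ) (hφ : Tendsto φ (𝓝[Ici 0] 0) (𝓝 0)) (h0 : f 0 = 0) :
    ContinuousOn f (Ici 0) := by
  intro τ hτ
  rcases (mem_Ici.mp hτ).eq_or_lt with rfl | hτ
  · rw [ContinuousWithinAt, h0, tendsto_zero_iff_norm_tendsto_zero]
    refine squeeze_zero' (Eventually.of_forall fun t => norm_nonneg _) ?_ hφ
    have : Icc (0:ℝ) T ∈ 𝓝[Ici 0] (0:ℝ) :=
      mem_nhdsWithin.mpr ⟨Iio T, isOpen_Iio, hT, fun s hs => ⟨hs.2, (mem_Iio.mp hs.1).le⟩⟩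
    filter_upwards [this] with t ht using h t ht
  · exact (hf.continuousAt (Ioi_mem_nhds hτ)).continuousWithinAt

theorem isC1Curve_regular (hn : 1 ≤ n) (hF : BddCoeff f₁ f₂ f₃)
    (hm : IsModeFamily n q f₁ f₂ f₃ o h c₀ p b c) {g : Sph n → ℝ} (hg : IsSmooth g) :
    IsC1Curve fun τ => harmSeries (fun k => (b k τ - h) + (p k τ - o) * Real.log τ) g := by
  obtain ⟨C₁, m₁, hC₁, h1⟩ := hm.regular_le hF 1
  have hlog : ContinuousOn Real.log (Ioi 0) :=
    Real.continuousOn_log.mono fun τ hτ => (ne_of_gt hτ)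
  have hφ : ∀ C r : ℝ, Tendsto (fun τ => C * (τ * (1 + |Real.log τ|) ^ 2) * r)
      (𝓝[Ici 0] 0) (𝓝 0) := fun C r => by
    simpa using (tendsto_mul_logSq.const_mul C).mul_const r
  have hs : ∀ τ : ℝ, 0 ≤ τ → 0 ≤ τ * (1 + |Real.log τ|) ^ 2 := fun τ hτ => by positivity
  refine isC1Curve_harmSeries hn hg (V := fun k τ => (p k τ - o) / τ) (fun k => ?_)
    (fun k τ hτ => (hm.mode k).hasDerivAt_regular o h hτ) (fun k => ?_) (fun T => ?_) (fun τ hτ => ?_)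
  · refine continuousOn_of_abs_le (fun τ hτ => ((hm.mode k).hasDerivAt_regular o h
      hτ).continuousAt.continuousWithinAt) one_pos (fun τ hτ => (h1 k τ hτ).1.trans ?_)
      (hφ C₁ (((k : ℝ) + 1) ^ m₁)) (by simp [hm.init_b])
    exact mul_le_mul_of_nonneg_right (mul_le_mul_of_nonneg_left
      (mul_le_of_le_one_left (hs τ hτ.1) hτ.2) hC₁) (by positivity)
  · refine continuousOn_of_abs_le ?_ one_pos (fun τ hτ => (h1 k τ hτ).2.trans ?_)
      (hφ C₁ (((k : ℝ) + 1) ^ m₁)) (by simp)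
    · exact (((hm.mode k).cont_p.mono Ioi_subset_Ici_self).sub continuousOn_const).div
        continuousOn_id fun τ hτ => (ne_of_gt hτ)
    · have := mul_log_le_mul_logSq hτ.1
      gcongr
  · obtain ⟨C, m, hC, h2⟩ := hm.regular_le hF T
    obtain ⟨M, hM, hφ⟩ := exists_mul_logSq_le T
    refine ⟨C * M, m, fun k τ hτ => (h2 k τ hτ).2.trans ?_⟩
    have := (mul_log_le_mul_logSq hτ.1).trans (hφ τ hτ)
    gcongr
  · obtain ⟨C, m, hC, h2⟩ := hm.regular_le hF τ
    exact ⟨_, m, fun k => (h2 k τ ⟨hτ, le_rfl⟩).1⟩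

theorem IsModeFamily.abs_a_le (hF : BddCoeff f₁ f₂ f₃)
    (hm : IsModeFamily n q f₁ f₂ f₃ o h c₀ p b c) (T : ℝ) : ∃ (C : ℝ) (m : ℕ), 0 ≤ C ∧
      ∀ k, ∀ τ ∈ Icc 0 T, |2 * τ * (b k τ + p k τ * Real.log τ)| ≤
        C * (τ * (1 + |Real.log τ|) ^ 2) * ((k : ℝ) + 1) ^ m := by
  obtain ⟨C, m, hC, hb⟩ := hm.abs_le hF T
  refine ⟨2 * C, m, by positivity, fun k τ hτ => ?_⟩
  have h1 := abs_add_mul_log_le τ (p k τ) (b k τ)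
  have h2 := hb k τ hτ
  have hτ0 := hτ.1
  have hL := abs_nonneg (Real.log τ)
  have h3 : |p k τ| + |b k τ| ≤ C * ((k : ℝ) + 1) ^ m := by linarith [abs_nonneg (c k τ)]
  rw [abs_mul, abs_of_nonneg (by positivity : 0 ≤ 2 * τ)]
  calc _ ≤ 2 * τ * ((1 + |Real.log τ|) * (C * ((k : ℝ) + 1) ^ m)) := by
        gcongr
        exact h1.trans (by gcongr)
    _ = 2 * C * (τ * (1 + |Real.log τ|)) * ((k : ℝ) + 1) ^ m := by ring
    _ ≤ _ := by
        have := mul_log_le_mul_logSq hτ0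
        gcongr

theorem isC1Curve_chi (hn : 1 ≤ n) (hF : BddCoeff f₁ f₂ f₃)
    (hm : IsModeFamily n q f₁ f₂ f₃ o h c₀ p b c) {g : Sph n → ℝ} (hg : IsSmooth g) :
    IsC1Curve fun τ => harmSeries (fun k => c k τ) g := by
  obtain ⟨C₁, m₁, hC₁, h1⟩ := hm.abs_a_le hF 1
  have hφ : ∀ C r : ℝ, Tendsto (fun τ => C * (τ * (1 + |Real.log τ|) ^ 2) * r)
      (𝓝[Ici 0] 0) (𝓝 0) := fun C r => by
    simpa using (tendsto_mul_logSq.const_mul C).mul_const r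
  refine isC1Curve_harmSeries hn hg (V := fun k τ => 2 * τ * (b k τ + p k τ * Real.log τ))
    (fun k => (hm.mode k).cont_c) (fun k => (hm.mode k).deriv_c) (fun k => ?_) (fun T => ?_)
    (fun τ hτ => ?_)
  · refine continuousOn_of_abs_le ?_ one_pos (h1 k) (hφ C₁ (((k : ℝ) + 1) ^ m₁)) (by simp)
    exact (by fun_prop : Continuous fun τ : ℝ => 2 * τ).continuousOn.mul fun τ hτ =>
      ((hm.mode k).hasDerivAt_a hτ).continuousAt.continuousWithinAt
  · obtain ⟨C, m, hC, h2⟩ := hm.abs_a_le hF T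
    obtain ⟨M, hM, hφ⟩ := exists_mul_logSq_le T
    refine ⟨C * M, m, fun k τ hτ => (h2 k τ hτ).trans ?_⟩
    have := hφ τ hτ
    gcongr
  · obtain ⟨C, m, hC, h2⟩ := hm.abs_le hF τ
    refine ⟨C, m, fun k => le_trans ?_ (h2 k τ ⟨hτ, le_rfl⟩)⟩
    linarith [abs_nonneg (p k τ), abs_nonneg (b k τ)]

/-- Near zero `1 + |log τ|` is at most `2 |log τ|`, which converts the weights used for the modes
into those of the asymptotic expansions. -/
theorem eventually_one_le_abs_log : ∀ᶠ τ : ℝ in 𝓝[>] 0, τ ∈ Ioc 0 1 ∧ 1 ≤ |Real.log τ| := by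
  filter_upwards [Ioo_mem_nhdsGT (Real.exp_pos (-1))] with τ hτ
  have h1 : Real.log τ ≤ -1 := by
    have := Real.log_le_log hτ.1 hτ.2.le
    rwa [Real.log_exp] at this
  refine ⟨⟨hτ.1, hτ.2.le.trans (by rw [Real.exp_le_one_iff]; norm_num)⟩, ?_⟩
  rw [abs_of_nonpos (by linarith)]
  linarith

/-- All modes start from the same three numbers; the dependence on `x` sits entirely in the
projections of `g`. Hence the data obtained are constant multiples of one function. -/
theorem isSmoothSolution_of_modeFamily (hn : 1 ≤ n) (hf₁ : ContDiffOn ℝ ∞ f₁ (Ioi 0))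
    (hf₂ : ContDiffOn ℝ ∞ f₂ (Ioi 0)) (hf₃ : ContDiffOn ℝ ∞ f₃ (Ioi 0)) (hF : BddCoeff f₁ f₂ f₃)
    (hm : IsModeFamily n q f₁ f₂ f₃ o h c₀ p b c) {g : Sph n → ℝ} (hg : IsSmooth g) :
    IsSmoothSolution q f₁ f₂ f₃ (fun x => c₀ * g x) (fun x => o * g x) (fun x => h * g x)
      (fun τ => harmSeries (fun k => b k τ + p k τ * Real.log τ) g)
      (fun τ => harmSeries (fun k => c k τ) g) := by
  have hT := hm.tameN hF hf₁ hf₂ hf₃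
  have hlog : ∀ m, TameN m fun _ => Real.log := fun m => tameN_of_contDiffOn
    (Real.contDiffOn_log.mono fun τ hτ => (ne_of_gt hτ))
  have hinv : ∀ m, TameN m fun _ τ => τ⁻¹ := fun m => tameN_of_contDiffOn
    (contDiffOn_id.inv fun τ hτ => (ne_of_gt hτ))
  have ha : ∀ m, TameN m fun k τ => b k τ + p k τ * Real.log τ := fun m =>
    (hT m).2.1.add ((hT m).1.mul (hlog m))
  have hda : LocPolyBdd fun k τ => p k τ / τ := by
    simpa only [div_eq_mul_inv] using ((hT 0).1.mul (hinv 0)).locPolyBdd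
  have hw : TameN 0 fun _ τ => -4 / (τ ^ 2 + 1) ^ 2 := tameN_of_contDiffOn
    (ContDiff.contDiffOn (contDiff_const.div (by fun_prop) fun τ => by positivity))
  have hid : TameN 0 fun _ τ => τ := tameN_of_contDiffOn contDiffOn_id
  have hdda : LocPolyBdd fun k τ => modeRhs q f₁ f₂ f₃ (eig n k) τ (p k τ) (b k τ) (c k τ)
      - 1 / τ * (p k τ / τ) := by
    have := ((((((tameN_const 0 (-4 * q)).add ((tameN_eig n 0).mul hw)).mul (ha 0)).add
      ((tameN_of_contDiffOn hf₁).mul (hT 0).1)).add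
      (((tameN_of_contDiffOn hf₂).mul (hid.mul hid)).mul (ha 0))).add
      ((tameN_of_contDiffOn hf₃).mul (hT 0).2.2)).add
      (((tameN_const 0 (-1)).mul ((hinv 0).mul (hinv 0))).mul (hT 0).1)
    convert this.locPolyBdd using 2 with k τ
    ext τ
    rw [modeRhs]
    ring
  have hd1 : ∀ τ, 0 < τ → ∀ x, HasDerivAt
      (fun s => harmSeries (fun k => b k s + p k s * Real.log s) g x)
      (harmSeries (fun k => p k τ / τ) g x) τ := fun τ hτ x =>
    hasDerivAt_harmSeries hn (ha 0).locPolyBdd hda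
      (fun k τ hτ => (hm.mode k).hasDerivAt_a hτ) hg x hτ
  have hd2 : ∀ τ, 0 < τ → ∀ x, HasDerivAt
      (fun s => harmSeries (fun k => p k s / s) g x)
      (harmSeries (fun k => modeRhs q f₁ f₂ f₃ (eig n k) τ (p k τ) (b k τ) (c k τ)
        - 1 / τ * (p k τ / τ)) g x) τ := fun τ hτ x =>
    hasDerivAt_harmSeries hn hda hdda (fun k τ hτ => (hm.mode k).hasDerivAt_da hτ) hg x hτ
  have hd3 : ∀ τ, 0 < τ → ∀ x, HasDerivAt (fun s => harmSeries (fun k => c k s) g x)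
      (harmSeries (fun k => 2 * τ * (b k τ + p k τ * Real.log τ)) g x) τ := fun τ hτ x =>
    hasDerivAt_harmSeries hn (hT 0).2.2.locPolyBdd
      (((tameN_const 0 2).mul hid).mul (ha 0)).locPolyBdd (fun k => (hm.mode k).deriv_c) hg x hτ
  set α : ℝ → Sph n → ℝ := fun τ => harmSeries (fun k => b k τ + p k τ * Real.log τ) g with hα
  set χ : ℝ → Sph n → ℝ := fun τ => harmSeries (fun k => c k τ) g with hχ
  have hdα : ∀ τ, 0 < τ → ∀ x, dτ α τ x = harmSeries (fun k => p k τ / τ) g x := fun τ hτ x =>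
    (hd1 τ hτ x).deriv
  have hddα : ∀ τ, 0 < τ → ∀ x, dτ (dτ α) τ x = harmSeries (fun k =>
      modeRhs q f₁ f₂ f₃ (eig n k) τ (p k τ) (b k τ) (c k τ) - 1 / τ * (p k τ / τ)) g x := by
    intro τ hτ x
    have he : (fun s => dτ α s x) =ᶠ[𝓝 τ] fun s => harmSeries (fun k => p k s / s) g x := by
      filter_upwards [Ioi_mem_nhds hτ] with s hs using hdα s hs x
    exact ((hd2 τ hτ x).congr_of_eventuallyEq he).deriv
  have hag : ∀ τ, 0 < τ → PolyGrowth fun k => b k τ + p k τ * Real.log τ := fun τ hτ =>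
    (ha 0).locPolyBdd.polyGrowth hτ
  have hconst : ∀ r : ℝ, PolyGrowth fun _ => r := PolyGrowth.const
  obtain ⟨C, m, hC, hreg⟩ := hm.regular_le hF 1
  have hu : ∀ τ, 0 < τ → ∀ x, harmSeries (fun k => (b k τ - h) + (p k τ - o) * Real.log τ) g x =
      α τ x - (o * g x * Real.log τ + h * g x) := by
    intro τ hτ x
    have := harmSeries_sub hn (hag τ hτ) (hconst (o * Real.log τ + h)) hg x
    rw [harmSeries_const hn hg] at this
    rw [show o * g x * Real.log τ + h * g x = (o * Real.log τ + h) * g x by ring]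
    simp only [hα]
    rw [this]
    congr 1
    ext k
    ring
  refine
    { smooth_α := isSmoothOnPos_harmSeries hn ha hg
      smooth_χ := isSmoothOnPos_harmSeries hn (fun m => (hT m).2.2) hg
      eq_α := ?_
      eq_χ := ?_
      regular_α := ⟨_, isC1Curve_regular hn hF hm hg, fun τ hτ x => ?_⟩
      regular_χ := isC1Curve_chi hn hF hm hg
      initial_χ := ?_
      expansion_α := fun j => ?_
      expansion_dα := fun j => ?_ }
  · intro τ hτ x
    rw [hddα τ hτ x, hdα τ hτ x, sphLaplacian_harmSeries hn (hag τ hτ) hg]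
    have s1 := (summable_harmSeries hn (hda.polyGrowth hτ) hg x).hasSum
    have s2 := (summable_harmSeries hn (hag τ hτ) hg x).hasSum
    have s3 := (summable_harmSeries hn ((((tameN_const 0 (-1)).mul (tameN_eig n 0)).mul
      (ha 0)).locPolyBdd.polyGrowth hτ) hg x).hasSum
    have s4 := (summable_harmSeries hn ((hT 0).2.2.locPolyBdd.polyGrowth hτ) hg x).hasSum
    have s5 := (((((s1.mul_left (f₁ τ * τ)).add (s2.mul_left (f₂ τ * τ ^ 2))).add
      (s4.mul_left (f₃ τ))).sub (s1.mul_left (1 / τ))).sub (s2.mul_left (4 * q))).add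
      (s3.mul_left (4 / (τ ^ 2 + 1) ^ 2))
    have e0 : harmSeries (fun k => -eig n k * (b k τ + p k τ * Real.log τ)) g x =
        harmSeries (fun k => -1 * eig n k * (b k τ + p k τ * Real.log τ)) g x := by
      congr 1; ext k; ring
    -- The mode equation, multiplied by the `k`-th projection of `g` and summed over `k`, is the
    -- partial differential equation.
    have s6 := s5.congr_fun (g := fun k => (modeRhs q f₁ f₂ f₃ (eig n k) τ (p k τ) (b k τ) (c k τ)
      - 1 / τ * (p k τ / τ)) * harmProj k g x) fun k => by
        simp only [modeRhs]; field_simp; ring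
    rw [e0]
    simp only [hα, hχ, harmSeries]
    rw [s6.tsum_eq]
    ring
  · intro τ hτ x
    rw [dτ, (hd3 τ hτ x).deriv]
    simp only [hα, harmSeries]
    rw [← tsum_mul_left]
    exact tsum_congr fun k => by ring
  · rw [hu τ hτ x]
    ring
  · ext x
    simp only [hχ, hm.init_c]
    exact harmSeries_const hn hg c₀ x
  · obtain ⟨D, hD, hDb⟩ := exists_seminormC_harmSeries_le hn hg j m
    refine IsBigO.of_bound (4 * C * D) ?_
    filter_upwards [eventually_one_le_abs_log] with τ ⟨hτ, hl⟩
    have he : (fun x => α τ x - (o * g x * Real.log τ + h * g x)) =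
        harmSeries (fun k => (b k τ - h) + (p k τ - o) * Real.log τ) g := by
      ext x; exact (hu τ hτ.1 x).symm
    rw [he, Real.norm_of_nonneg (seminormC_nonneg _ _), Real.norm_of_nonneg (by positivity)]
    refine (hDb _ _ fun k => (hreg k τ ⟨hτ.1.le, hτ.2⟩).1).trans ?_
    have h2 : (1 + |Real.log τ|) ^ 2 ≤ (2 * |Real.log τ|) ^ 2 :=
      pow_le_pow_left₀ (by positivity) (by linarith) 2
    calc _ ≤ C * (τ * (τ * (2 * |Real.log τ|) ^ 2)) * D := by
          have := hτ.1
          gcongr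
      _ = _ := by ring
  · obtain ⟨D, hD, hDb⟩ := exists_seminormC_harmSeries_le hn hg j m
    refine IsBigO.of_bound (2 * C * D) ?_
    filter_upwards [eventually_one_le_abs_log] with τ ⟨hτ, hl⟩
    have he : (fun x => dτ α τ x - o * g x / τ) =
        harmSeries (fun k => (p k τ - o) / τ) g := by
      ext x
      have h1 := harmSeries_sub hn (hda.polyGrowth hτ.1) (hconst (o / τ)) hg x
      rw [harmSeries_const hn hg] at h1
      rw [hdα τ hτ.1, show o * g x / τ = o / τ * g x by ring, h1]
      congr 1
      ext k
      ring
    rw [he, Real.norm_of_nonneg (seminormC_nonneg _ _), Real.norm_of_nonneg (by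
      have := hτ.1
      positivity)]
    refine (hDb _ _ fun k => (hreg k τ ⟨hτ.1.le, hτ.2⟩).2).trans ?_
    have h2 : 1 + |Real.log τ| ≤ 2 * |Real.log τ| ^ 2 := by nlinarith
    calc _ ≤ C * (τ * (2 * |Real.log τ| ^ 2)) * D := by
          have := hτ.1
          gcongr
      _ = _ := by ring

/-! ### Linearity of the system and existence for general data -/

/-- The linear combination `r f + g` of functions on the sphere. -/
def lincomb (r : ℝ) (f g : Sph n → ℝ) : Sph n → ℝ := fun x => r * f x + g x

theorem IsSmooth.lincomb {f g : Sph n → ℝ} (hf : IsSmooth f) (hg : IsSmooth g) (r : ℝ) :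
    IsSmooth (lincomb r f g) := by
  have h : ContMDiff (𝓡 n) 𝓘(ℝ, ℝ) ∞ (fun x => r * f x) :=
    ContMDiff.smul (contMDiff_const : ContMDiff (𝓡 n) 𝓘(ℝ, ℝ) ∞ fun _ : Sph n => r) hf
  exact ContMDiff.add h hg

theorem radialExt_lincomb (r : ℝ) (f g : Sph n → ℝ) :
    radialExt (lincomb r f g) = r • radialExt f + radialExt g := by
  ext y
  by_cases hy : y = 0
  · simp [radialExt, hy]
  · simp only [Pi.add_apply, Pi.smul_apply, smul_eq_mul, radialExt_eq _ hy, lincomb]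

theorem IsSmooth.contDiffAt_radialExt {f : Sph n → ℝ} (hf : IsSmooth f) (x : Sph n) {m : WithTop ℕ∞}
    (hm : m ≤ ∞) : ContDiffAt ℝ m (radialExt f) (x : Amb n) :=
  (hf.contDiffOn_radialExt.contDiffAt (isOpen_punct.mem_nhds (coe_sph_ne_zero x))).of_le hm

theorem sphLaplacian_lincomb {f g : Sph n → ℝ} (hf : IsSmooth f) (hg : IsSmooth g) (r : ℝ)
    (x : Sph n) :
    sphLaplacian (lincomb r f g) x = r * sphLaplacian f x + sphLaplacian g x := by
  have h2 : (2 : WithTop ℕ∞) ≤ ∞ := WithTop.coe_le_coe.mpr le_top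
  have h1 := hf.contDiffAt_radialExt x h2
  have h1' : ContDiffAt ℝ 2 (r • radialExt f) (x : Amb n) := h1.const_smul r
  rw [sphLaplacian, radialExt_lincomb,
    ContDiffAt.laplacian_add h1' (hg.contDiffAt_radialExt x h2),
    InnerProductSpace.laplacian_smul r h1]
  rfl

/-- Without boundedness the real supremum in `seminormC` would default to zero and control nothing;
for smooth functions compactness of the sphere provides it. -/
theorem bddAbove_seminormC (k : ℕ) {f : Sph n → ℝ} (hf : IsSmooth f) :
    BddAbove (range fun x : Sph n => ‖iteratedFDeriv ℝ k (radialExt f) (x : Amb n)‖) := by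
  have h1 : ContinuousOn (iteratedFDeriv ℝ k (radialExt f)) {0}ᶜ := by
    refine (hf.contDiffOn_radialExt.continuousOn_iteratedFDerivWithin (m := k)
      (WithTop.coe_le_coe.mpr le_top) isOpen_punct.uniqueDiffOn).congr fun y hy => ?_
    rw [iteratedFDerivWithin_of_isOpen k isOpen_punct hy]
  have h2 : Continuous fun x : Sph n => ‖iteratedFDeriv ℝ k (radialExt f) (x : Amb n)‖ :=
    (h1.comp_continuous continuous_subtype_val coe_sph_ne_zero).norm
  exact (isCompact_range h2).bddAbove

theorem seminormC_lincomb_le (k : ℕ) {f g : Sph n → ℝ} (hf : IsSmooth f) (hg : IsSmooth g)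
    (r : ℝ) : seminormC k (lincomb r f g) ≤ |r| * seminormC k f + seminormC k g := by
  refine ciSup_le fun x => ?_
  have hk : (k : WithTop ℕ∞) ≤ ∞ := WithTop.coe_le_coe.mpr le_top
  have h1 := hf.contDiffAt_radialExt x hk
  have h2 := hg.contDiffAt_radialExt x hk
  have h1' : ContDiffAt ℝ k (r • radialExt f) (x : Amb n) := h1.const_smul r
  rw [radialExt_lincomb, iteratedFDeriv_add_apply h1' h2,
    iteratedFDeriv_const_smul_apply h1]
  refine (norm_add_le _ _).trans (add_le_add ?_ (le_ciSup (bddAbove_seminormC k hg) x))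
  rw [norm_smul, Real.norm_eq_abs]
  exact mul_le_mul_of_nonneg_left (le_ciSup (bddAbove_seminormC k hf) x) (abs_nonneg r)

theorem abs_le_seminormC_zero {f : Sph n → ℝ} (hf : IsSmooth f) (x : Sph n) :
    |f x| ≤ seminormC 0 f := by
  have := le_ciSup (bddAbove_seminormC 0 hf) x
  rwa [norm_iteratedFDeriv_zero, radialExt_coe] at this

theorem tendsto_seminormC_lincomb {l : Filter ℝ} {k : ℕ} {f g : ℝ → Sph n → ℝ}
    (hf : ∀ᶠ τ in l, IsSmooth (f τ)) (hg : ∀ᶠ τ in l, IsSmooth (g τ)) (r : ℝ)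
    (h1 : Tendsto (fun τ => seminormC k (f τ)) l (𝓝 0))
    (h2 : Tendsto (fun τ => seminormC k (g τ)) l (𝓝 0)) :
    Tendsto (fun τ => seminormC k (lincomb r (f τ) (g τ))) l (𝓝 0) := by
  have h3 := (h1.const_mul |r|).add h2
  rw [mul_zero, add_zero] at h3
  refine squeeze_zero' (Eventually.of_forall fun τ => seminormC_nonneg _ _) ?_ h3
  filter_upwards [hf, hg] with τ hfτ hgτ using seminormC_lincomb_le k hfτ hgτ r

theorem isBigO_seminormC_lincomb {l : Filter ℝ} {k : ℕ} {f g : ℝ → Sph n → ℝ} {φ : ℝ → ℝ}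
    (hf : ∀ᶠ τ in l, IsSmooth (f τ)) (hg : ∀ᶠ τ in l, IsSmooth (g τ)) (r : ℝ)
    (h1 : (fun τ => seminormC k (f τ)) =O[l] φ) (h2 : (fun τ => seminormC k (g τ)) =O[l] φ) :
    (fun τ => seminormC k (lincomb r (f τ) (g τ))) =O[l] φ := by
  refine IsBigO.trans (IsBigO.of_bound 1 ?_) ((h1.const_mul_left |r|).add h2)
  filter_upwards [hf, hg] with τ hfτ hgτ
  rw [one_mul, Real.norm_of_nonneg (seminormC_nonneg _ _)]
  exact (seminormC_lincomb_le k hfτ hgτ r).trans (le_abs_self _)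

theorem IsC1Curve.lincomb {u w : ℝ → Sph n → ℝ} (hu : IsC1Curve u) (hw : IsC1Curve w) (r : ℝ) :
    IsC1Curve fun τ => lincomb r (u τ) (w τ) := by
  obtain ⟨hus, v, hvs, hv⟩ := hu
  obtain ⟨hws, z, hzs, hz⟩ := hw
  refine ⟨fun τ hτ => (hus τ hτ).lincomb (hws τ hτ) r, fun τ => ModelSystem.lincomb r (v τ) (z τ),
    fun τ hτ => (hvs τ hτ).lincomb (hzs τ hτ) r, fun k τ₀ hτ₀ => ?_⟩
  have hq : ∀ {f g : ℝ → Sph n → ℝ}, (∀ τ, 0 ≤ τ → IsSmooth (f τ)) →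
      (∀ τ, 0 ≤ τ → IsSmooth (g τ)) → ∀ τ, 0 ≤ τ →
      IsSmooth fun x => (f τ x - f τ₀ x) / (τ - τ₀) - g τ₀ x := by
    intro f g hf hg τ hτ
    -- The inner combination with coefficient `-2` is `-g`, since `-2 g + g = -g`.
    have h := ((hf τ hτ).sub (hf τ₀ hτ₀)).lincomb ((hg τ₀ hτ₀).lincomb (hg τ₀ hτ₀) (-2))
      (τ - τ₀)⁻¹
    convert h using 1
    ext x
    simp only [ModelSystem.lincomb, Pi.sub_apply]
    ring
  constructor
  · have h := tendsto_seminormC_lincomb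
      (eventually_mem_nhdsWithin.mono fun τ hτ => hq hus hvs τ hτ.1)
      (eventually_mem_nhdsWithin.mono fun τ hτ => hq hws hzs τ hτ.1) r (hv k τ₀ hτ₀).1 (hz k τ₀ hτ₀).1
    refine h.congr fun τ => ?_
    congr 1
    ext x
    simp only [ModelSystem.lincomb]
    ring
  · have h := tendsto_seminormC_lincomb
      (eventually_mem_nhdsWithin.mono fun τ hτ => (hvs τ hτ).sub (hvs τ₀ hτ₀))
      (eventually_mem_nhdsWithin.mono fun τ hτ => (hzs τ hτ).sub (hzs τ₀ hτ₀)) r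
      (hv k τ₀ hτ₀).2 (hz k τ₀ hτ₀).2
    refine h.congr fun τ => ?_
    congr 1
    ext x
    simp only [ModelSystem.lincomb, Pi.sub_apply]
    ring

theorem IsSmoothOnPos.lincomb {u w : ℝ → Sph n → ℝ} (hu : IsSmoothOnPos u) (hw : IsSmoothOnPos w)
    (r : ℝ) : IsSmoothOnPos fun τ => lincomb r (u τ) (w τ) := by
  have h : ContMDiffOn (𝓘(ℝ, ℝ).prod (𝓡 n)) 𝓘(ℝ, ℝ) ∞
      (fun p : ℝ × Sph n => r * u p.1 p.2) (Ioi 0 ×ˢ univ) :=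
    ContMDiffOn.smul (contMDiffOn_const : ContMDiffOn (𝓘(ℝ, ℝ).prod (𝓡 n)) 𝓘(ℝ, ℝ) ∞
      (fun _ : ℝ × Sph n => r) _) hu
  exact ContMDiffOn.add h hw

theorem IsSmoothOnPos.isSmooth {u : ℝ → Sph n → ℝ} (hu : IsSmoothOnPos u) {τ : ℝ} (hτ : 0 < τ) :
    IsSmooth (u τ) := by
  have h : ContMDiff (𝓡 n) (𝓘(ℝ, ℝ).prod (𝓡 n)) ∞ (fun x : Sph n => (τ, x)) :=
    contMDiff_const.prodMk contMDiff_id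
  exact hu.comp_contMDiff h fun x => ⟨hτ, mem_univ x⟩

/-- The time derivative of the degree zero extension of `u`. -/
theorem IsSmoothOnPos.hasDerivAt_radialExt {u : ℝ → Sph n → ℝ} (hu : IsSmoothOnPos u) {τ : ℝ}
    (hτ : 0 < τ) {y : Amb n} (hy : y ≠ 0) :
    HasDerivAt (fun s => radialExt (u s) y) (radialExt (dτ u τ) y) τ := by
  have h1 : ContDiffAt ℝ ∞ (fun p : ℝ × Amb n => radialExt (u p.1) p.2) (τ, y) :=
    hu.contDiffOn_radialExt.contDiffAt ((isOpen_Ioi.prod isOpen_punct).mem_nhds ⟨hτ, hy⟩)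
  have h2 : HasFDerivAt (fun p : ℝ × Amb n => radialExt (u p.1) p.2) _ (τ, y) :=
    (h1.differentiableAt (by simp)).hasFDerivAt
  have h3 : HasDerivAt (fun s : ℝ => (s, y)) ((1 : ℝ), (0 : Amb n)) τ :=
    (hasDerivAt_id τ).prodMk (hasDerivAt_const τ y)
  have h4 := h2.comp_hasDerivAt τ h3
  have h5 : HasDerivAt (fun s => radialExt (u s) y) _ τ := h4.differentiableAt.hasDerivAt
  convert h5 using 1
  have he : ((fun p : ℝ × Amb n => radialExt (u p.1) p.2) ∘ fun s => (s, y)) =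
      fun s => u s (toSph y) := funext fun s => radialExt_eq (u s) hy
  rw [he, radialExt_eq _ hy, dτ]

theorem IsSmoothOnPos.hasDerivAt {u : ℝ → Sph n → ℝ} (hu : IsSmoothOnPos u) {τ : ℝ}
    (hτ : 0 < τ) (x : Sph n) : HasDerivAt (fun s => u s x) (dτ u τ x) τ := by
  simpa using hu.hasDerivAt_radialExt hτ (coe_sph_ne_zero x)

theorem IsSmoothOnPos.dτ {u : ℝ → Sph n → ℝ} (hu : IsSmoothOnPos u) : IsSmoothOnPos (dτ u) := by
  have hop : IsOpen (Ioi (0:ℝ) ×ˢ ({0}ᶜ : Set (Amb n))) := isOpen_Ioi.prod isOpen_punct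
  have h1 := hu.contDiffOn_radialExt
  have h2 : ContDiffOn ℝ ∞ (fun p : ℝ × Amb n =>
      fderiv ℝ (fun p : ℝ × Amb n => radialExt (u p.1) p.2) p ((1 : ℝ), (0 : Amb n)))
      (Ioi 0 ×ˢ {0}ᶜ) := (h1.fderiv_of_isOpen hop (by simp)).clm_apply contDiffOn_const
  have h3 : ContDiffOn ℝ ∞ (fun p : ℝ × Amb n => radialExt (ModelSystem.dτ u p.1) p.2)
      (Ioi 0 ×ˢ {0}ᶜ) := by
    refine h2.congr fun p hp => ?_
    have h4 : HasFDerivAt (fun p : ℝ × Amb n => radialExt (u p.1) p.2) _ (p.1, p.2) :=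
      ((h1.contDiffAt (hop.mem_nhds hp)).differentiableAt (by simp)).hasFDerivAt
    have h5 : HasDerivAt (fun s : ℝ => (s, p.2)) ((1 : ℝ), (0 : Amb n)) p.1 :=
      (hasDerivAt_id p.1).prodMk (hasDerivAt_const p.1 p.2)
    have h6 := h4.comp_hasDerivAt p.1 h5
    exact (hu.hasDerivAt_radialExt hp.1 hp.2).unique h6
  simpa using isSmoothOnPos_of_contDiffOn isOpen_punct coe_sph_ne_zero h3

theorem dτ_lincomb {u w : ℝ → Sph n → ℝ} (hu : IsSmoothOnPos u) (hw : IsSmoothOnPos w) (r : ℝ)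
    {τ : ℝ} (hτ : 0 < τ) : dτ (fun τ => lincomb r (u τ) (w τ)) τ = lincomb r (dτ u τ) (dτ w τ) := by
  ext x
  exact (((hu.hasDerivAt hτ x).const_mul r).add (hw.hasDerivAt hτ x)).deriv

theorem dτ_dτ_lincomb {u w : ℝ → Sph n → ℝ} (hu : IsSmoothOnPos u) (hw : IsSmoothOnPos w) (r : ℝ)
    {τ : ℝ} (hτ : 0 < τ) : dτ (dτ fun τ => lincomb r (u τ) (w τ)) τ =
      lincomb r (dτ (dτ u) τ) (dτ (dτ w) τ) := by
  rw [← dτ_lincomb hu.dτ hw.dτ r hτ]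
  ext x
  refine Filter.EventuallyEq.deriv_eq ?_
  filter_upwards [Ioi_mem_nhds hτ] with s hs
  rw [dτ_lincomb hu hw r hs]

/-- The model system is linear. -/
theorem IsSmoothSolution.lincomb {χ₀ 𝒪 h χ₀' 𝒪' h' : Sph n → ℝ} {α χ α' χ' : ℝ → Sph n → ℝ}
    (hs : IsSmoothSolution q f₁ f₂ f₃ χ₀ 𝒪 h α χ) (h𝒪 : IsSmooth 𝒪) (hh : IsSmooth h)
    (hs' : IsSmoothSolution q f₁ f₂ f₃ χ₀' 𝒪' h' α' χ') (h𝒪' : IsSmooth 𝒪') (hh' : IsSmooth h')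
    (r : ℝ) :
    IsSmoothSolution q f₁ f₂ f₃ (lincomb r χ₀ χ₀') (lincomb r 𝒪 𝒪') (lincomb r h h')
      (fun τ => lincomb r (α τ) (α' τ)) (fun τ => lincomb r (χ τ) (χ' τ)) where
  smooth_α := hs.smooth_α.lincomb hs'.smooth_α r
  smooth_χ := hs.smooth_χ.lincomb hs'.smooth_χ r
  eq_α τ hτ x := by
    have h1 := hs.eq_α τ hτ x
    have h2 := hs'.eq_α τ hτ x
    rw [dτ_dτ_lincomb hs.smooth_α hs'.smooth_α r hτ, dτ_lincomb hs.smooth_α hs'.smooth_α r hτ,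
      sphLaplacian_lincomb (hs.smooth_α.isSmooth hτ) (hs'.smooth_α.isSmooth hτ)]
    simp only [ModelSystem.lincomb]
    linear_combination r * h1 + h2
  eq_χ τ hτ x := by
    have h1 := hs.eq_χ τ hτ x
    have h2 := hs'.eq_χ τ hτ x
    rw [dτ_lincomb hs.smooth_χ hs'.smooth_χ r hτ]
    simp only [ModelSystem.lincomb]
    linear_combination r * h1 + h2
  regular_α := by
    obtain ⟨u, hu, hue⟩ := hs.regular_α
    obtain ⟨u', hu', hue'⟩ := hs'.regular_α
    refine ⟨_, hu.lincomb hu' r, fun τ hτ x => ?_⟩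
    simp only [ModelSystem.lincomb, hue τ hτ x, hue' τ hτ x]
    ring
  regular_χ := hs.regular_χ.lincomb hs'.regular_χ r
  initial_χ := by rw [hs.initial_χ, hs'.initial_χ]
  expansion_α k := by
    have key : ∀ {α 𝒪 h : Sph n → ℝ}, IsSmooth α → IsSmooth 𝒪 → IsSmooth h → ∀ τ : ℝ,
        IsSmooth fun x => α x - (𝒪 x * Real.log τ + h x) := by
      intro α 𝒪 h hα h𝒪 hh τ
      have := (h𝒪.lincomb hh (Real.log τ)).lincomb hα (-1)
      convert this using 1
      ext x
      simp only [ModelSystem.lincomb]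
      ring
    have h1 := isBigO_seminormC_lincomb
      (eventually_mem_nhdsWithin.mono fun τ hτ => key (hs.smooth_α.isSmooth hτ) h𝒪 hh τ)
      (eventually_mem_nhdsWithin.mono fun τ hτ => key (hs'.smooth_α.isSmooth hτ) h𝒪' hh' τ) r
      (hs.expansion_α k) (hs'.expansion_α k)
    refine h1.congr_left fun τ => ?_
    congr 1
    ext x
    simp only [ModelSystem.lincomb]
    ring
  expansion_dα k := by
    have key : ∀ {α 𝒪 : Sph n → ℝ}, IsSmooth α → IsSmooth 𝒪 → ∀ τ : ℝ,
        IsSmooth fun x => α x - 𝒪 x / τ := by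
      intro α 𝒪 hα h𝒪 τ
      have := h𝒪.lincomb hα (-τ⁻¹)
      convert this using 1
      ext x
      simp only [ModelSystem.lincomb]
      ring
    have h1 := isBigO_seminormC_lincomb
      (eventually_mem_nhdsWithin.mono fun τ hτ => key (hs.smooth_α.dτ.isSmooth hτ) h𝒪 τ)
      (eventually_mem_nhdsWithin.mono fun τ hτ => key (hs'.smooth_α.dτ.isSmooth hτ) h𝒪' τ) r
      (hs.expansion_dα k) (hs'.expansion_dα k)
    refine h1.congr' ?_ EventuallyEq.rfl
    filter_upwards [self_mem_nhdsWithin] with τ hτ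
    congr 1
    ext x
    rw [dτ_lincomb hs.smooth_α hs'.smooth_α r hτ]
    simp only [ModelSystem.lincomb]
    ring

theorem exists_isSmoothSolution (hn : 1 ≤ n) (q : ℝ) (hf₁ : ContDiffOn ℝ ∞ f₁ (Ioi 0))
    (hf₂ : ContDiffOn ℝ ∞ f₂ (Ioi 0)) (hf₃ : ContDiffOn ℝ ∞ f₃ (Ioi 0)) (hF : BddCoeff f₁ f₂ f₃)
    {χ₀ 𝒪 h : Sph n → ℝ} (hχ₀ : IsSmooth χ₀) (h𝒪 : IsSmooth 𝒪) (hh : IsSmooth h) :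
    ∃ α χ, IsSmoothSolution q f₁ f₂ f₃ χ₀ 𝒪 h α χ := by
  have hex : ∀ (o h c₀ : ℝ) {g : Sph n → ℝ}, IsSmooth g → ∃ α χ, IsSmoothSolution q f₁ f₂ f₃
      (fun x => c₀ * g x) (fun x => o * g x) (fun x => h * g x) α χ := fun o h c₀ g hg => by
    obtain ⟨p, b, c, hm⟩ := hF.exists_modeFamily hf₁.continuousOn hf₂.continuousOn
      hf₃.continuousOn n q o h c₀
    exact ⟨_, _, isSmoothSolution_of_modeFamily hn hf₁ hf₂ hf₃ hF hm hg⟩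
  have hmul : ∀ (r : ℝ) {g : Sph n → ℝ}, IsSmooth g → IsSmooth fun x => r * g x := fun r g hg => by
    have := hg.lincomb hg (r - 1)
    convert this using 1
    ext x
    simp only [lincomb]
    ring
  -- Three solutions, each driven by one of the data `𝒪`, `h`, `χ₀` with the other two set to zero,
  -- are added.
  obtain ⟨α₁, χ₁, h1⟩ := hex 1 0 0 h𝒪
  obtain ⟨α₂, χ₂, h2⟩ := hex 0 1 0 hh
  obtain ⟨α₃, χ₃, h3⟩ := hex 0 0 1 hχ₀
  have h12 := h1.lincomb (hmul _ h𝒪) (hmul _ h𝒪) h2 (hmul _ hh) (hmul _ hh) 1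
  have h123 := h12.lincomb ((hmul _ h𝒪).lincomb (hmul _ hh) 1) ((hmul _ h𝒪).lincomb (hmul _ hh) 1)
    h3 (hmul _ hχ₀) (hmul _ hχ₀) 1
  have e1 : lincomb 1 (lincomb 1 (fun x => 0 * 𝒪 x) fun x => 0 * h x) (fun x => 1 * χ₀ x) = χ₀ := by
    ext x; simp [lincomb]
  have e2 : lincomb 1 (lincomb 1 (fun x => 1 * 𝒪 x) fun x => 0 * h x) (fun x => 0 * χ₀ x) = 𝒪 := by
    ext x; simp [lincomb]
  have e3 : lincomb 1 (lincomb 1 (fun x => 0 * 𝒪 x) fun x => 1 * h x) (fun x => 0 * χ₀ x) = h := by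
    ext x; simp [lincomb]
  rw [e1, e2, e3] at h123
  exact ⟨_, _, h123⟩

/-! ### Uniqueness by pairing with harmonics -/

theorem IsSmoothOnPos.hasDerivAt_pair {u : ℝ → Sph n → ℝ} (hu : IsSmoothOnPos u) {Y : Sph n → ℝ}
    (hY : IsSmooth Y) {τ : ℝ} (hτ : 0 < τ) :
    HasDerivAt (fun s => pair (u s) Y) (pair (ModelSystem.dτ u τ) Y) τ := by
  obtain ⟨B, hB0, hB⟩ := exists_bound_continuous hY.continuous
  have hc : ContinuousOn (fun p : ℝ × Amb n => radialExt (ModelSystem.dτ u p.1) p.2)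
      (Icc (τ / 2) (τ + 1) ×ˢ annulus n) := hu.dτ.contDiffOn_radialExt.continuousOn.mono
    (prod_mono (fun s hs => lt_of_lt_of_le (half_pos hτ) hs.1) annulus_subset)
  obtain ⟨M, hM⟩ := (isCompact_Icc.prod isCompact_annulus).exists_bound_of_continuousOn hc
  have hs : Ioo (τ / 2) (τ + 1) ∈ 𝓝 τ := Ioo_mem_nhds (by linarith) (by linarith)
  have hpos : ∀ s ∈ Ioo (τ / 2) (τ + 1), 0 < s := fun s hs => by linarith [hs.1]
  refine (hasDerivAt_integral_of_dominated_loc_of_deriv_le (bound := fun y => (M * B) * wt y)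
    (F' := fun s y => wt y * (radialExt (ModelSystem.dτ u s) y * radialExt Y y)) hs ?_ ?_ ?_ ?_ ?_ ?_).2
  · filter_upwards [hs] with s hs using
      (integrable_pair (hu.isSmooth (hpos s hs)).continuous hY.continuous).aestronglyMeasurable
  · exact integrable_pair (hu.isSmooth hτ).continuous hY.continuous
  · exact (integrable_pair (hu.dτ.isSmooth hτ).continuous hY.continuous).aestronglyMeasurable
  · refine Eventually.of_forall fun y s hs => ?_
    by_cases hy : y ∈ annulus n
    · have h1 := hM (s, y) ⟨⟨hs.1.le, hs.2.le⟩, hy⟩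
      have h2 : |radialExt Y y| ≤ B := by
        rw [radialExt_eq _ (annulus_subset hy)]
        exact hB _
      rw [norm_mul, norm_mul, Real.norm_of_nonneg (wt_nonneg y), mul_comm]
      refine mul_le_mul_of_nonneg_right ?_ (wt_nonneg y)
      exact mul_le_mul h1 h2 (abs_nonneg _) ((norm_nonneg _).trans h1)
    · simp [wt_eq_zero hy]
  · exact integrable_wt.const_mul _
  · refine Eventually.of_forall fun y s hs => ?_
    by_cases hy : y = 0
    · have : y ∉ annulus n := fun h => annulus_subset h hy
      simpa [wt_eq_zero this] using hasDerivAt_const s (0:ℝ)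
    · exact ((hu.hasDerivAt_radialExt (hpos s hs) hy).mul_const _).const_mul _

theorem pair_lincomb {f g Y : Sph n → ℝ} (hf : Continuous f) (hg : Continuous g)
    (hY : Continuous Y) (r : ℝ) : pair (lincomb r f g) Y = r * pair f Y + pair g Y := by
  have : lincomb r f g = r • f + g := rfl
  rw [this, pair_add_left (hf.const_smul r) hg hY, pair_smul_left]

theorem tendsto_pair_zero {l : Filter ℝ} {φ : ℝ → ℝ} {f : ℝ → Sph n → ℝ} {Y : Sph n → ℝ}
    (hY : Continuous Y) (hf : ∀ᶠ τ in l, ∀ x, |φ τ * f τ x| ≤ φ τ * seminormC 0 (f τ))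
    (h : Tendsto (fun τ => φ τ * seminormC 0 (f τ)) l (𝓝 0)) :
    Tendsto (fun τ => φ τ * pair (f τ) Y) l (𝓝 0) := by
  obtain ⟨B, hB0, hB⟩ := exists_bound_continuous hY
  have h2 : Tendsto (fun τ => φ τ * seminormC 0 (f τ) * B * wtMass n) l (𝓝 0) := by
    simpa using (h.mul_const B).mul_const (wtMass n)
  refine squeeze_zero_norm' ?_ h2
  filter_upwards [hf] with τ hτ
  rw [← pair_smul_left]
  exact abs_pair_le hτ hB

/-- The third power of the logarithm is forced by `b = a - τ log τ a'`, where `a'` is only known to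
be `O(τ |log τ|²)`. -/
theorem tendsto_mul_log_cube : Tendsto (fun τ : ℝ => τ ^ 2 * |Real.log τ| ^ 3) (𝓝[>] 0) (𝓝 0) := by
  have h1 := (tendsto_mul_logSq.mono_left (nhdsWithin_mono _ Ioi_subset_Ici_self)).pow 2
  rw [zero_pow two_ne_zero] at h1
  refine squeeze_zero' (Eventually.of_forall fun τ => by positivity) ?_ h1
  filter_upwards [self_mem_nhdsWithin] with τ hτ
  have hL := abs_nonneg (Real.log τ)
  rw [mul_pow, ← pow_mul]
  refine mul_le_mul_of_nonneg_left ?_ (sq_nonneg τ)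
  calc |Real.log τ| ^ 3 ≤ (1 + |Real.log τ|) ^ 3 := by gcongr; linarith
    _ ≤ (1 + |Real.log τ|) ^ (2 * 2) := pow_le_pow_right₀ (by linarith) (by norm_num)

/-- Pairing a solution with trivial asymptotic data with an eigenfunction gives a mode with
trivial initial data. -/
theorem IsSmoothSolution.isMode_pair {α χ : ℝ → Sph n → ℝ}
    (hs : IsSmoothSolution q f₁ f₂ f₃ 0 0 0 α χ) {k : ℕ} {Y : Sph n → ℝ} (hY : Y ∈ harmonics n k) :
    IsMode q f₁ f₂ f₃ (eig n k) (fun τ => if τ ≤ 0 then 0 else τ * pair (dτ α τ) Y)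
      (fun τ => if τ ≤ 0 then 0 else pair (α τ) Y - τ * Real.log τ * pair (dτ α τ) Y)
      (fun τ => if τ ≤ 0 then 0 else pair (χ τ) Y) := by
  have hYs := isSmooth_of_mem_harmonics hY
  have hYc := hYs.continuous
  set A : ℝ → ℝ := fun τ => pair (α τ) Y with hA
  set A₁ : ℝ → ℝ := fun τ => pair (dτ α τ) Y with hA₁
  set A₂ : ℝ → ℝ := fun τ => pair (dτ (dτ α) τ) Y with hA₂
  set X : ℝ → ℝ := fun τ => pair (χ τ) Y with hX
  have dA : ∀ τ, 0 < τ → HasDerivAt A (A₁ τ) τ := fun τ hτ => hs.smooth_α.hasDerivAt_pair hYs hτ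
  have dA₁ : ∀ τ, 0 < τ → HasDerivAt A₁ (A₂ τ) τ := fun τ hτ =>
    hs.smooth_α.dτ.hasDerivAt_pair hYs hτ
  have dX : ∀ τ, 0 < τ → HasDerivAt X (2 * τ * A τ) τ := fun τ hτ => by
    have h1 := hs.smooth_χ.hasDerivAt_pair hYs hτ
    have h2 : dτ χ τ = (2 * τ) • α τ := funext fun x => hs.eq_χ τ hτ x
    rwa [h2, pair_smul_left] at h1
  have hnp : ∀ {τ : ℝ}, 0 < τ → ¬ τ ≤ 0 := fun hτ => not_le.mpr hτ
  have hev : ∀ {f : ℝ → ℝ} {f' τ : ℝ}, 0 < τ → HasDerivAt f f' τ →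
      HasDerivAt (fun τ => if τ ≤ 0 then 0 else f τ) f' τ := fun hτ hf => by
    refine hf.congr_of_eventuallyEq ?_
    filter_upwards [Ioi_mem_nhds hτ] with s hs using if_neg (hnp hs)
  -- Symmetry moves the Laplacian onto the harmonic, so the paired equation closes as an ODE with
  -- eigenvalue `eig n k`.
  have hode : ∀ τ, 0 < τ → modeRhs q f₁ f₂ f₃ (eig n k) τ (τ * A₁ τ)
      (A τ - τ * Real.log τ * A₁ τ) (X τ) = A₂ τ + 1 / τ * A₁ τ := by
    intro τ hτ
    have c0 := (hs.smooth_α.isSmooth hτ)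
    have c1 := (hs.smooth_α.dτ.isSmooth hτ).continuous
    have c3 := (hs.smooth_χ.isSmooth hτ).continuous
    have he : dτ (dτ α) τ = ModelSystem.lincomb (f₁ τ * τ - 1 / τ) (dτ α τ)
        (ModelSystem.lincomb (f₂ τ * τ ^ 2 - 4 * q) (α τ)
          (ModelSystem.lincomb (4 / (τ ^ 2 + 1) ^ 2) (sphLaplacian (α τ)) (f₃ τ • χ τ))) := by
      ext x
      have := hs.eq_α τ hτ x
      simp only [ModelSystem.lincomb, Pi.smul_apply, smul_eq_mul]
      linear_combination this
    have i3 : Continuous (f₃ τ • χ τ) := c3.const_smul _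
    have i2 : Continuous
        (ModelSystem.lincomb (4 / (τ ^ 2 + 1) ^ 2) (sphLaplacian (α τ)) (f₃ τ • χ τ)) :=
      (c0.sphLaplacian.continuous.const_smul (4 / (τ ^ 2 + 1) ^ 2)).add i3
    have i1 : Continuous (ModelSystem.lincomb (f₂ τ * τ ^ 2 - 4 * q) (α τ)
        (ModelSystem.lincomb (4 / (τ ^ 2 + 1) ^ 2) (sphLaplacian (α τ)) (f₃ τ • χ τ))) :=
      (c0.continuous.const_smul (f₂ τ * τ ^ 2 - 4 * q)).add i2
    have hpair : A₂ τ = (f₁ τ * τ - 1 / τ) * A₁ τ + ((f₂ τ * τ ^ 2 - 4 * q) * A τ +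
        (4 / (τ ^ 2 + 1) ^ 2 * (-eig n k * A τ) + f₃ τ * X τ)) := by
      simp only [hA₂, he]
      rw [pair_lincomb c1 i1 hYc, pair_lincomb c0.continuous i2 hYc,
        pair_lincomb c0.sphLaplacian.continuous i3 hYc, pair_smul_left,
        pair_sphLaplacian_comm c0 hYs, sphLaplacian_harmonics hY, pair_smul_right]
    rw [hpair, modeRhs]
    ring
  have hsm : ∀ {f : Sph n → ℝ} {φ : ℝ}, IsSmooth f → 0 ≤ φ → ∀ x,
      |φ * f x| ≤ φ * seminormC 0 f := fun hf hφ x => by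
    rw [abs_mul, abs_of_nonneg hφ]
    exact mul_le_mul_of_nonneg_left (abs_le_seminormC_zero hf x) hφ
  have hpos : ∀ᶠ τ : ℝ in 𝓝[>] 0, 0 < τ := self_mem_nhdsWithin
  have hlim0 := tendsto_mul_log_cube
  have hlog1 := eventually_one_le_abs_log
  have hbig : ∀ {φ ψ : ℝ → ℝ}, φ =O[𝓝[>] 0] ψ → (∀ᶠ τ in 𝓝[>] 0,
      ‖ψ τ‖ ≤ ‖τ ^ 2 * |Real.log τ| ^ 3‖) → Tendsto φ (𝓝[>] 0) (𝓝 0) := fun h1 h2 =>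
    (h1.trans (IsBigO.of_bound 1 (by simpa using h2))).trans_tendsto hlim0
  have lA : Tendsto A (𝓝[>] 0) (𝓝 0) := by
    have h1 := hs.expansion_α 0
    simp only [Pi.zero_apply, zero_mul, add_zero, sub_zero] at h1
    have h2 := tendsto_pair_zero (φ := fun _ => 1) (f := α) (l := 𝓝[>] 0) hYc
      (hpos.mono fun τ hτ => hsm (hs.smooth_α.isSmooth hτ) zero_le_one) (by
        simp only [one_mul]
        refine hbig h1 ?_
        filter_upwards [hlog1] with τ hτ
        rw [Real.norm_of_nonneg (by positivity), Real.norm_of_nonneg (by positivity)]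
        exact mul_le_mul_of_nonneg_left (pow_le_pow_right₀ hτ.2 (by norm_num)) (sq_nonneg τ))
    simpa using h2
  have hdα := hs.expansion_dα 0
  simp only [Pi.zero_apply, zero_div, sub_zero] at hdα
  have lP : Tendsto (fun τ => τ * A₁ τ) (𝓝[>] 0) (𝓝 0) := by
    refine tendsto_pair_zero (φ := fun τ => τ) (f := dτ α) hYc
      (hpos.mono fun τ hτ => hsm (hs.smooth_α.dτ.isSmooth hτ) hτ.le) ?_
    refine hbig ((isBigO_refl (fun τ : ℝ => τ) _).mul hdα) ?_
    filter_upwards [hlog1, hpos] with τ hτ h0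
    rw [Real.norm_of_nonneg (by positivity), Real.norm_of_nonneg (by positivity), ← mul_assoc, ← sq]
    exact mul_le_mul_of_nonneg_left (pow_le_pow_right₀ hτ.2 (by norm_num)) (sq_nonneg τ)
  have lB : Tendsto (fun τ => τ * Real.log τ * A₁ τ) (𝓝[>] 0) (𝓝 0) := by
    have h2 : Tendsto (fun τ => τ * |Real.log τ| * A₁ τ) (𝓝[>] 0) (𝓝 0) := by
      refine tendsto_pair_zero (φ := fun τ => τ * |Real.log τ|) (f := dτ α) hYc
        (hpos.mono fun τ hτ => hsm (hs.smooth_α.dτ.isSmooth hτ) (by positivity)) ?_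
      refine hbig ((isBigO_refl (fun τ : ℝ => τ * |Real.log τ|) _).mul hdα) ?_
      filter_upwards [hpos] with τ h0
      refine le_of_eq ?_
      congr 1
      ring
    rw [tendsto_zero_iff_abs_tendsto_zero] at h2 ⊢
    refine h2.congr fun τ => ?_
    simp [abs_mul]
  -- Differentiability of `χ` at zero gives `χ = τ (v 0 + o(1))`, uniformly on the sphere, because
  -- its initial value is zero.
  have lX : Tendsto X (𝓝[>] 0) (𝓝 0) := by
    obtain ⟨hχs, v, hvs, hv⟩ := hs.regular_χ
    have h1 := (hv 0 0 le_rfl).1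
    simp only [hs.initial_χ, Pi.zero_apply, sub_zero] at h1
    have hle : 𝓝[>] (0:ℝ) ≤ 𝓝[Ici 0 \ {0}] 0 :=
      nhdsWithin_mono _ fun τ hτ => ⟨le_of_lt (mem_Ioi.mp hτ), ne_of_gt (mem_Ioi.mp hτ)⟩
    have h1 := h1.mono_left hle
    obtain ⟨B, hB0, hB⟩ := exists_bound_continuous hYc
    obtain ⟨V, hV0, hV⟩ := exists_bound_continuous (hvs 0 le_rfl).continuous
    have hid : Tendsto (fun τ : ℝ => τ) (𝓝[>] 0) (𝓝 0) := tendsto_id.mono_left nhdsWithin_le_nhds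
    have h2 : Tendsto (fun τ => τ * (seminormC 0 (fun x => χ τ x / τ - v 0 x) + V) * B * wtMass n)
        (𝓝[>] 0) (𝓝 0) := by
      simpa using ((hid.mul (h1.add_const V)).mul_const B).mul_const (wtMass n)
    refine squeeze_zero_norm' ?_ h2
    filter_upwards [hpos] with τ hτ
    refine abs_pair_le (fun x => ?_) hB
    have hsmooth : IsSmooth fun x => χ τ x / τ - v 0 x := by
      have := (hχs τ hτ.le).lincomb ((hvs 0 le_rfl).lincomb (hvs 0 le_rfl) (-2)) τ⁻¹
      convert this using 1
      ext x
      simp only [ModelSystem.lincomb]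
      ring
    have h3 := abs_le_seminormC_zero hsmooth x
    have h4 : χ τ x = τ * ((χ τ x / τ - v 0 x) + v 0 x) := by field_simp; ring
    rw [h4, abs_mul, abs_of_pos hτ]
    exact mul_le_mul_of_nonneg_left ((abs_add_le _ _).trans (add_le_add h3 (hV x))) hτ.le
  -- The case distinction assigns the limit value zero at `τ = 0`, which turns the limits above into
  -- continuity on the closed half-line.
  have hcont : ∀ {f : ℝ → ℝ}, (∀ τ, 0 < τ → ContinuousAt f τ) → Tendsto f (𝓝[>] 0) (𝓝 0) →
      ContinuousOn (fun τ => if τ ≤ 0 then 0 else f τ) (Ici 0) := by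
    intro f hf hl τ hτ
    rcases (mem_Ici.mp hτ).eq_or_lt with rfl | hτ
    · rw [← continuousWithinAt_Ioi_iff_Ici, ContinuousWithinAt, if_pos le_rfl]
      refine hl.congr' ?_
      filter_upwards [hpos] with τ hτ using (if_neg (hnp hτ)).symm
    · refine ((hf τ hτ).congr ?_).continuousWithinAt
      filter_upwards [Ioi_mem_nhds hτ] with s hs using (if_neg (hnp hs)).symm
  have dP : ∀ τ, 0 < τ → HasDerivAt (fun τ => τ * A₁ τ) (1 * A₁ τ + τ * A₂ τ) τ := fun τ hτ =>
    (hasDerivAt_id τ).mul (dA₁ τ hτ)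
  have dB : ∀ τ, 0 < τ → HasDerivAt (fun τ => A τ - τ * Real.log τ * A₁ τ)
      (A₁ τ - ((1 * Real.log τ + τ * τ⁻¹) * A₁ τ + τ * Real.log τ * A₂ τ)) τ := fun τ hτ =>
    (dA τ hτ).sub (((hasDerivAt_id τ).mul (Real.hasDerivAt_log hτ.ne')).mul (dA₁ τ hτ))
  refine
    { deriv_p := fun τ hτ => (hev hτ (dP τ hτ)).congr_deriv ?_
      deriv_b := fun τ hτ => (hev hτ (dB τ hτ)).congr_deriv ?_
      deriv_c := fun τ hτ => (hev hτ (dX τ hτ)).congr_deriv ?_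
      cont_p := hcont (fun τ hτ => (dP τ hτ).continuousAt) lP
      cont_b := hcont (fun τ hτ => (dB τ hτ).continuousAt) (by simpa using lA.sub lB)
      cont_c := hcont (fun τ hτ => (dX τ hτ).continuousAt) lX }
  · simp only [if_neg (hnp hτ)]
    rw [hode τ hτ]
    field_simp
    ring
  · simp only [if_neg (hnp hτ)]
    rw [hode τ hτ]
    field_simp
    ring
  · simp only [if_neg (hnp hτ)]
    ring

/-- Every paired mode starts from zero and hence vanishes. Since `τ > 0`, vanishing of `p` gives
that of the paired `∂_τ α`, then `b` gives that of the paired `α`; completeness concludes. -/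
theorem IsSmoothSolution.eq_zero (hF : BddCoeff f₁ f₂ f₃) {α χ : ℝ → Sph n → ℝ}
    (hs : IsSmoothSolution q f₁ f₂ f₃ 0 0 0 α χ) {τ : ℝ} (hτ : 0 < τ) : α τ = 0 ∧ χ τ = 0 := by
  have key : ∀ k, ∀ Y ∈ harmonics n k, pair (α τ) Y = 0 ∧ pair (χ τ) Y = 0 := by
    intro k Y hY
    obtain ⟨h1, h2, h3⟩ := (hs.isMode_pair hY).eq_zero hF (eig_nonneg n k) (if_pos le_rfl)
      (if_pos le_rfl) (if_pos le_rfl) hτ.le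
    rw [if_neg (not_le.mpr hτ)] at h1 h2 h3
    refine ⟨?_, h3⟩
    have h4 : pair (dτ α τ) Y = 0 := (mul_eq_zero.mp h1).resolve_left hτ.ne'
    rwa [h4, mul_zero, sub_zero] at h2
  exact ⟨eq_zero_of_pair_harmonics (hs.smooth_α.isSmooth hτ).continuous fun k Y hY => (key k Y hY).1,
    eq_zero_of_pair_harmonics (hs.smooth_χ.isSmooth hτ).continuous fun k Y hY => (key k Y hY).2⟩

theorem IsSmoothSolution.unique (hF : BddCoeff f₁ f₂ f₃) {χ₀ 𝒪 h : Sph n → ℝ}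
    (h𝒪 : IsSmooth 𝒪) (hh : IsSmooth h) {α χ α' χ' : ℝ → Sph n → ℝ}
    (hs : IsSmoothSolution q f₁ f₂ f₃ χ₀ 𝒪 h α χ)
    (hs' : IsSmoothSolution q f₁ f₂ f₃ χ₀ 𝒪 h α' χ') :
    (∀ τ, 0 < τ → α' τ = α τ) ∧ (∀ τ, 0 ≤ τ → χ' τ = χ τ) := by
  have h0 : ∀ f : Sph n → ℝ, ModelSystem.lincomb (-1) f f = 0 := fun f => by
    ext x
    simp [ModelSystem.lincomb]
  have hd := hs.lincomb h𝒪 hh hs' h𝒪 hh (-1)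
  rw [h0, h0, h0] at hd
  have he : ∀ f g : Sph n → ℝ, ModelSystem.lincomb (-1) f g = 0 → g = f := fun f g hfg => by
    ext x
    have := congrFun hfg x
    simp only [ModelSystem.lincomb, Pi.zero_apply] at this
    linarith
  refine ⟨fun τ hτ => he _ _ (hd.eq_zero hF hτ).1, fun τ hτ => ?_⟩
  rcases hτ.eq_or_lt with rfl | hτ
  · rw [hs.initial_χ, hs'.initial_χ]
  · exact he _ _ (hd.eq_zero hF hτ).2

end ModelSystem

end

theorem mainTheorem5 (n : ℕ) (hn : 1 ≤ n) (q : ℝ) (hq : 1 ≤ q) (f₁ f₂ f₃ : ℝ → ℝ)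
    (hf₁ : ContDiffOn ℝ ∞ f₁ (Ioi 0)) (hf₂ : ContDiffOn ℝ ∞ f₂ (Ioi 0))
    (hf₃ : ContDiffOn ℝ ∞ f₃ (Ioi 0))
    (hf : (fun τ => |f₁ τ| + |f₂ τ| + |f₃ τ|) =O[𝓝[>] 0] (fun _ => (1 : ℝ)))
    (χ₀ 𝒪 h : ModelSystem.Sph n → ℝ)
    (hχ₀ : ModelSystem.IsSmooth χ₀) (h𝒪 : ModelSystem.IsSmooth 𝒪) (hh : ModelSystem.IsSmooth h) :
    ∃ α χ : ℝ → ModelSystem.Sph n → ℝ,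
      ModelSystem.IsSmoothSolution q f₁ f₂ f₃ χ₀ 𝒪 h α χ ∧
      ∀ α' χ' : ℝ → ModelSystem.Sph n → ℝ,
        ModelSystem.IsSmoothSolution q f₁ f₂ f₃ χ₀ 𝒪 h α' χ' →
          (∀ τ, 0 < τ → α' τ = α τ) ∧ (∀ τ, 0 ≤ τ → χ' τ = χ τ) := by
  have hF := ModelSystem.bddCoeff_of_isBigO hf₁.continuousOn hf₂.continuousOn hf₃.continuousOn hf
  obtain ⟨α, χ, hs⟩ := ModelSystem.exists_isSmoothSolution hn q hf₁ hf₂ hf₃ hF hχ₀ h𝒪 hh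
  exact ⟨α, χ, hs, fun α' χ' hs' => hs.unique hF h𝒪 hh hs'⟩
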